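/- Fix integers $n, r\ge 1$. A Mandelstam matrix of rank $r$ is a real symmetric $n\times n$ matrix $S=[s_{ij}]$ of rank $r$ with $s_{ii}\ge 0$ for all $i$ that has, counted with multiplicity, exactly one positive and $r-1$ negative eigenvalues. A (rank two) matroid $P$ on $[n]=\{1,\dots,n\}$ is a partition $P=P_1\sqcup\cdots\sqcup P_m$ of a subset of $[n]$ into $m\ge 2$ non-empty parts; the elements of $[n]\setminus P$ are its loops, and $l$ is their number; the bases of $P$ are the pairs $\{u,v\}$ with $u,v$ in different parts. The restriction of $P$ to $I\subseteq[n]$ is given by the non-empty sets $P_\mu\cap I$; $U_4$ denotes the partition of a four-element set into four singletons. A signed matroid $(P,\sigma)$ is a matroid $P$ on $[n]$ with a sign vector $\sigma\in\{+,-\}^n$, where $\sigma$ and $-\sigma$ are identified. The MMC stratum $\mathcal C^0_{P,\sigma,r}$ is the set of Mandelstam matrices $S$ of rank $r$ such that $s_{ii}=0$ for all $i$, $\operatorname{sign}(s_{ij})=\sigma_i\sigma_j$ if $\{i,j\}$ is a basis of $P$, $s_{ij}=0$ if $\{i,j\}$ is not a basis of $P$, and all row and column sums of $S$ are zero. The signed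 matroid $(P,\sigma)$ is called $r$-momentum conserving if $\mathcal C^0_{P,\sigma,r}\neq\emptyset$. **Theorem.** Let $(P,\sigma)$ be a signed matroid on $[n]$ with $m$ parts and $l$ loops. Then $(P,\sigma)$ is $r$-momentum conserving if and only if one of the following holds: 1. $3\le r<m$, and there exist distinct $i,j,k,l'$ in $[n]$ with $\sigma_i=\sigma_j=+$ and $\sigma_k=\sigma_{l'}=-$ such that the restriction of $P$ to $\{i,j,k,l'\}$ is either $U_4$ or $\{\{i,k\},\{j,l'\}\}$; 2. $2\le r=m$, and every part of $P$ contains two elements with opposite signs. (In particular, the stratum is empty if neither $3\le r<m$ nor $2\le r=m$.) Moreover, if $(P,\sigma)$ is $r$-momentum conserving, then the dimension of its MMC stratum as a semialgebraic set (the Krull dimension of $\mathbb R[x]/I$, where $I$ is the ideal of all polynomials in the matrix entries that vanish on the stratum) is $$\dim \mathcal C^0_{P,\sigma,r} = (m-1)(r-1)-\binom r2+(n-l-m)-1 .$$ -/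

import Mathlib

/-- A rank two matroid on `[n]`: a partition of a subset `nonloops` of `[n]` into at least two
(nonempty, pairwise disjoint) parts. The elements outside `nonloops` are the loops, and two
non-loops are parallel when they lie in the same part. -/
structure RankTwoMatroid (n : ℕ) where
  nonloops : Finset (Fin n)
  partition : Finpartition nonloops
  two_le_card_parts : 2 ≤ partition.parts.card

namespace RankTwoMatroid

variable {n : ℕ} (P : RankTwoMatroid n)

/-- The number `m` of parts. -/
def numParts : ℕ := P.partition.parts.card

/-- The number `l` of loops. -/
def numLoops : ℕ := P.nonloopsᶜ.card

/-- `{i, j}` is a basis when `i` and `j` lie in two different parts. -/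
def IsBasis (i j : Fin n) : Prop :=
  ∃ A ∈ P.partition.parts, ∃ B ∈ P.partition.parts, A ≠ B ∧ i ∈ A ∧ j ∈ B

/-- The restriction to a subset `I` of `[n]`, given by its collection of parts: the nonempty
intersections of parts with `I`. (The loops of the restriction are the elements of `I` that lie
in none of these sets.) -/
def restrictParts (I : Finset (Fin n)) : Finset (Finset (Fin n)) :=
  (P.partition.parts.image fun A => A ∩ I).erase ∅

end RankTwoMatroid

/-- A signed matroid `(P, σ)`: a rank two matroid with a sign vector `σ ∈ {+, -}ⁿ`, where the
signs are the units `1` and `-1` of `ℤ`. A sign vector and its negative represent the same signed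
matroid; everything below depends on `σ` only up to this identification. -/
structure SignedMatroid (n : ℕ) extends RankTwoMatroid n where
  sign : Fin n → ℤˣ

/-- Mandelstam matrices of rank `r`: symmetric real `n × n` matrices of rank `r` with non-negative
diagonal that have, counted with multiplicity, precisely one positive eigenvalue and `r - 1`
negative eigenvalues. -/
def mandelstamRegion (n r : ℕ) : Set (Matrix (Fin n) (Fin n) ℝ) :=
  {S | S.rank = r ∧ (∀ i, 0 ≤ S i i) ∧
    ∃ hS : S.IsHermitian,
      {a : Fin n | 0 < hS.eigenvalues a}.ncard = 1 ∧
      {a : Fin n | hS.eigenvalues a < 0}.ncard + 1 = r}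

/-- The massless Mandelstam region: Mandelstam matrices with zero diagonal. -/
def masslessMandelstamRegion (n r : ℕ) : Set (Matrix (Fin n) (Fin n) ℝ) :=
  {S | S ∈ mandelstamRegion n r ∧ ∀ i, S i i = 0}

/-- The massless momentum conserving (MMC) region: massless Mandelstam matrices all of whose row
sums and column sums are zero. -/
def mmcRegion (n r : ℕ) : Set (Matrix (Fin n) (Fin n) ℝ) :=
  {S | S ∈ masslessMandelstamRegion n r ∧ (∀ i, ∑ j, S i j = 0) ∧ (∀ j, ∑ i, S i j = 0)}

namespace SignedMatroid

variable {n : ℕ} (M : SignedMatroid n)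

/-- The kinematic stratum of `(P, σ)` in rank `r`: massless Mandelstam matrices `S` of rank `r`
such that `S i j` has sign `σ i * σ j` if `{i, j}` is a basis of `P`, and vanishes otherwise. -/
def kinematicStratum (r : ℕ) : Set (Matrix (Fin n) (Fin n) ℝ) :=
  {S | S ∈ masslessMandelstamRegion n r ∧
    (∀ i j, M.IsBasis i j → Real.sign (S i j) = ((M.sign i * M.sign j : ℤˣ) : ℤ)) ∧
    (∀ i j, ¬ M.IsBasis i j → S i j = 0)}

/-- The MMC stratum of `(P, σ)` in rank `r`. -/
def mmcStratum (r : ℕ) : Set (Matrix (Fin n) (Fin n) ℝ) :=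
  M.kinematicStratum r ∩ mmcRegion n r

/-- `(P, σ)` is `r`-momentum conserving when its MMC stratum is non-empty. -/
def IsMomentumConserving (r : ℕ) : Prop :=
  (M.mmcStratum r).Nonempty

end SignedMatroid

/-- The dimension of a semialgebraic set `A ⊆ ℝ^ι`: the Krull dimension of its ring of polynomial
functions `ℝ[x] / I(A)`, where `I(A)` is the ideal of the polynomials that vanish on `A`. -/
noncomputable def semialgebraicDim {ι : Type*} (A : Set (ι → ℝ)) : WithBot ℕ∞ :=
  ringKrullDim (MvPolynomial ι ℝ ⧸ MvPolynomial.vanishingIdeal ℝ A)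

/-- The dimension of a semialgebraic set of `n × n` matrices, seen in the space `ℝ^(n × n)` of
matrix entries. -/
noncomputable def matrixSetDim {n : ℕ} (A : Set (Matrix (Fin n) (Fin n) ℝ)) : WithBot ℕ∞ :=
  semialgebraicDim ((fun (S : Matrix (Fin n) (Fin n) ℝ) (p : Fin n × Fin n) => S p.1 p.2) '' A)

open Matrix

/-! ### Krull dimension of finitely generated algebras of functions -/

/-! A symmetric matrix of rank `r` with one positive and `r - 1` negative eigenvalues is the Gram
matrix of `n` spanning vectors in Minkowski space of dimension `r`. A zero diagonal makes the
vectors light-like or zero, zero row sums make them add up to zero, and a zero entry between two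
non-zero vectors makes them parallel. The parts of `P` are therefore the light rays that occur. Put
`k = r - 2`. In light cone coordinates one ray is sent to infinity, `(0, 1, 0)`, and one to the
origin, `(1, 0, 0)`. Every finite ray is `(1, |z|²/2, z)` with `z` in `ℝ^k`, different for different
rays, and the vector `i` is `a i` times its ray. Different rays have positive product, so the signs
of the matrix entries are those of `a i * a j`. This dictionary is `exists_isMomentumConfig`
together with `mem_mmcRegion`.

Momentum conservation only involves the weights `c x`, the sum of the multiples on the ray `x`: the
rays satisfy the linear relation with coefficients `c`. Since `m` rays span, `k + 2 ≤ m`. If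
equality holds, the rays are a basis, so `c = 0` and each part contains both signs. If `k + 2 < m`,
then `k > 0`, and either `c = 0`, so that every part is mixed, or `exists_two_pos_of_kernel` yields
two positive and two negative weights. Conversely, `c = 0` with independent points settles `r = m`,
and for `r < m` a perturbation argument (`exists_weights_and_points`) builds a configuration with `c
≠ 0`.

For the dimension, scaling and rotation normalize one multiple to `1` and make a chosen coordinate
matrix triangular, which removes `k.choose 2` coordinates. If `c κ ≠ 0` at a finite ray `κ` off the
origin, momentum conservation is solved rationally for the point of `κ` and two multiples. If `c =
0`, it is solved for one multiple on each ray. With `N` non-loops these charts have `N - 3 + (m - 3)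
* k - k.choose 2` and `N - m - 1 + (m - 2) * k - k.choose 2` parameters; the first number exceeds
the second by `m - 2 - k` and is the claimed dimension. The charts cover the stratum, which bounds
its dimension above by transcendence degree (`algDimLE_of_specializesTo`). A neighbourhood in the
relevant chart lands in the stratum, and its parameters are obtained from the Gram matrix by field
operations and square roots, hence are algebraic over its entries; this is the lower bound
(`card_le_of_eventually_specializesTo`). Noether normalization links both bounds to the Krull
dimension. -/

theorem ringKrullDim_eq_of_isIntegral_of_injective {R S : Type*} [CommRing R] [CommRing S]
    [Algebra R S] [Algebra.IsIntegral R S] (hinj : Function.Injective (algebraMap R S)) :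
    ringKrullDim S = ringKrullDim R := by
  apply le_antisymm
  · refine Order.krullDim_le_of_strictMono (PrimeSpectrum.comap (algebraMap R S)) ?_
    intro I J hIJ
    exact Ideal.IsIntegral.comap_lt_comap (R := R) (I := I.asIdeal) (J := J.asIdeal) hIJ
  · have : FaithfulSMul R S := (faithfulSMul_iff_algebraMap_injective R S).mpr hinj
    -- Lying over lifts the smallest prime of a chain, and going up lifts the rest with the same
    -- length.
    refine iSup_le fun l => ?_
    obtain ⟨Q, hQ, hQ'⟩ := (Ideal.nonempty_primesOver (S := S) l.head.asIdeal).some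
    have := hQ
    have := hQ'
    obtain ⟨L, hL, -⟩ := Ideal.exists_ltSeries_of_hasGoingUp (S := S) l Q
    rw [← hL]
    exact le_iSup (fun p : LTSeries (PrimeSpectrum S) => ((p.length : ℕ∞) : WithBot ℕ∞)) L

open MvPolynomial in
/-- Noether normalization for the ring of polynomial functions on a set. -/
theorem exists_noether_normalization_of_set {ι : Type*} [Finite ι] {A : Set (ι → ℝ)}
    (hA : A.Nonempty) :
    ∃ (s : ℕ) (Y : Fin s → MvPolynomial ι ℝ), semialgebraicDim A = s ∧
      (∀ G : MvPolynomial (Fin s) ℝ,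
        (∀ x ∈ A, aeval x (aeval Y G : MvPolynomial ι ℝ) = 0) → G = 0) ∧
      ∀ p : MvPolynomial ι ℝ, ∃ P : Polynomial (MvPolynomial (Fin s) ℝ), P.Monic ∧
        ∀ x ∈ A, aeval x (P.eval₂ (aeval Y : MvPolynomial (Fin s) ℝ →ₐ[ℝ] _).toRingHom p) = 0 := by
  set I := vanishingIdeal ℝ A with hI
  have hmem : ∀ p, Ideal.Quotient.mk I p = 0 ↔ ∀ x ∈ A, aeval x p = 0 := fun p => by
    rw [Ideal.Quotient.eq_zero_iff_mem]; exact Iff.rfl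
  have : Nontrivial (MvPolynomial ι ℝ ⧸ I) := by
    rw [Ideal.Quotient.nontrivial_iff]
    intro htop
    obtain ⟨x, hx⟩ := hA
    have h1 : (1 : MvPolynomial ι ℝ) ∈ I := htop ▸ Submodule.mem_top
    simpa using h1 x hx
  obtain ⟨s, g, hinj, hint⟩ := exists_integral_inj_algHom_of_fg ℝ (MvPolynomial ι ℝ ⧸ I)
  have hlift : ∀ i, ∃ y : MvPolynomial ι ℝ, Ideal.Quotient.mk I y = g (X i) :=
    fun i => Ideal.Quotient.mk_surjective _
  choose Y hY using hlift
  have hgY : g = (Ideal.Quotient.mkₐ ℝ I).comp (aeval Y) := by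
    ext i
    simp [hY]
  have hg : ∀ G, Ideal.Quotient.mk I (aeval Y G) = g G := fun G => by rw [hgY]; rfl
  refine ⟨s, Y, ?_, ?_, ?_⟩
  · let : Algebra (MvPolynomial (Fin s) ℝ) (MvPolynomial ι ℝ ⧸ I) := g.toRingHom.toAlgebra
    have : Algebra.IsIntegral (MvPolynomial (Fin s) ℝ) (MvPolynomial ι ℝ ⧸ I) := ⟨hint⟩
    have h := ringKrullDim_eq_of_isIntegral_of_injective
      (R := MvPolynomial (Fin s) ℝ) (S := MvPolynomial ι ℝ ⧸ I) hinj
    unfold semialgebraicDim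
    rw [← hI, h, MvPolynomial.ringKrullDim_of_isNoetherianRing]
    simp
  · intro G hG
    apply hinj
    rw [map_zero, ← hg, hmem]
    exact hG
  · intro p
    obtain ⟨P, hP, hP0⟩ := hint (Ideal.Quotient.mk I p)
    refine ⟨P, hP, ?_⟩
    rw [← hmem, Polynomial.hom_eval₂, ← hP0]
    congr 1
    ext G
    · simp [hgY]
    · simp [hgY]

/-- `A` carries at most `D` algebraically independent polynomial functions. -/
def AlgDimLE {ι : Type*} (A : Set (ι → ℝ)) (D : ℕ) : Prop :=
  ∀ s, D < s → ∀ Y : Fin s → MvPolynomial ι ℝ, ∃ G : MvPolynomial (Fin s) ℝ, G ≠ 0 ∧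
    ∀ x ∈ A, MvPolynomial.aeval x (MvPolynomial.aeval Y G : MvPolynomial ι ℝ) = 0

/-! ### Upper bounds for the number of independent functions on a set. -/

namespace AlgDimLE

variable {ι : Type*} {A B : Set (ι → ℝ)} {D E : ℕ}

theorem mono (h : AlgDimLE A D) (hAB : B ⊆ A) (hDE : D ≤ E) : AlgDimLE B E := by
  intro s hs Y
  obtain ⟨G, hG, hG'⟩ := h s (hDE.trans_lt hs) Y
  exact ⟨G, hG, fun x hx => hG' x (hAB hx)⟩

theorem empty : AlgDimLE (∅ : Set (ι → ℝ)) D :=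
  fun _ _ _ => ⟨1, one_ne_zero, fun _ hx => hx.elim⟩

/-- The product of the two relations vanishes on both sets, and it is non-zero because polynomial
rings over a field are domains. -/
theorem union (hA : AlgDimLE A D) (hB : AlgDimLE B D) : AlgDimLE (A ∪ B) D := by
  intro s hs Y
  obtain ⟨G, hG, hG'⟩ := hA s hs Y
  obtain ⟨H, hH, hH'⟩ := hB s hs Y
  refine ⟨G * H, mul_ne_zero hG hH, ?_⟩
  rintro x (hx | hx)
  · rw [map_mul, map_mul, hG' x hx, zero_mul]
  · rw [map_mul, map_mul, hH' x hx, mul_zero]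

theorem iUnion {κ : Type*} [Finite κ] {A : κ → Set (ι → ℝ)} (h : ∀ k, AlgDimLE (A k) D) :
    AlgDimLE (⋃ k, A k) D := by
  classical
  have := Fintype.ofFinite κ
  suffices H : ∀ t : Finset κ, AlgDimLE (⋃ k ∈ t, A k) D by simpa using H Finset.univ
  intro t
  induction t using Finset.induction_on with
  | empty => simpa using empty
  | insert a t _ ih => simpa [Set.iUnion_or, Set.iUnion_union_distrib] using (h a).union ih

/-- Noether normalization provides as many functions without a relation on `A` as the dimension. -/
theorem semialgebraicDim_le [Finite ι] (h : AlgDimLE A D) (hA : A.Nonempty) {d : ℕ}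
    (hd : semialgebraicDim A = d) : d ≤ D := by
  obtain ⟨s, Y, hs, hY, -⟩ := exists_noether_normalization_of_set hA
  have : d = s := by rw [hd] at hs; exact_mod_cast hs
  subst this
  by_contra hlt
  obtain ⟨G, hG, hG'⟩ := h d (not_le.mp hlt) Y
  exact hG (hY G hG')

end AlgDimLE

/-- The rational function `f` is defined at the point `θ` and takes the value `v` there. -/
def SpecializesTo {Θ : Type*} (θ : Θ → ℝ) (f : FractionRing (MvPolynomial Θ ℝ)) (v : ℝ) : Prop :=
  ∃ N D : MvPolynomial Θ ℝ, MvPolynomial.eval θ D ≠ 0 ∧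
    f * algebraMap _ (FractionRing (MvPolynomial Θ ℝ)) D = algebraMap _ _ N ∧
    v * MvPolynomial.eval θ D = MvPolynomial.eval θ N

/-! ### Arithmetic of values of rational functions. -/

namespace SpecializesTo

open MvPolynomial

variable {Θ : Type*} {θ : Θ → ℝ} {f g : FractionRing (MvPolynomial Θ ℝ)} {v w : ℝ}

theorem of_polynomial (p : MvPolynomial Θ ℝ) :
    SpecializesTo θ (algebraMap _ _ p) (eval θ p) :=
  ⟨p, 1, by simp, by simp, by simp⟩

theorem const (c : ℝ) : SpecializesTo θ (algebraMap ℝ _ c) c := by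
  have h := of_polynomial (θ := θ) (C c)
  rw [eval_C] at h
  rwa [IsScalarTower.algebraMap_apply ℝ (MvPolynomial Θ ℝ) (FractionRing (MvPolynomial Θ ℝ))]

theorem zero : SpecializesTo θ 0 0 := by simpa using of_polynomial (θ := θ) 0

theorem one : SpecializesTo θ 1 1 := by simpa using of_polynomial (θ := θ) 1

theorem add (hf : SpecializesTo θ f v) (hg : SpecializesTo θ g w) :
    SpecializesTo θ (f + g) (v + w) := by
  obtain ⟨N, D, hD, h1, h2⟩ := hf
  obtain ⟨N', D', hD', h1', h2'⟩ := hg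
  refine ⟨N * D' + N' * D, D * D', by simp [hD, hD'], ?_, ?_⟩
  · simp only [map_mul, map_add, ← h1, ← h1']; ring
  · simp only [map_mul, map_add, ← h2, ← h2']; ring

theorem mul (hf : SpecializesTo θ f v) (hg : SpecializesTo θ g w) :
    SpecializesTo θ (f * g) (v * w) := by
  obtain ⟨N, D, hD, h1, h2⟩ := hf
  obtain ⟨N', D', hD', h1', h2'⟩ := hg
  refine ⟨N * N', D * D', by simp [hD, hD'], ?_, ?_⟩
  · simp only [map_mul, ← h1, ← h1']; ring
  · simp only [map_mul, ← h2, ← h2']; ring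

theorem neg (hf : SpecializesTo θ f v) : SpecializesTo θ (-f) (-v) := by
  obtain ⟨N, D, hD, h1, h2⟩ := hf
  exact ⟨-N, D, hD, by rw [map_neg, ← h1]; ring, by rw [map_neg, ← h2]; ring⟩

theorem sub (hf : SpecializesTo θ f v) (hg : SpecializesTo θ g w) :
    SpecializesTo θ (f - g) (v - w) := by
  rw [sub_eq_add_neg, sub_eq_add_neg]; exact hf.add hg.neg

theorem inv (hf : SpecializesTo θ f v) (hv : v ≠ 0) : SpecializesTo θ f⁻¹ v⁻¹ := by
  obtain ⟨N, D, hD, h1, h2⟩ := hf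
  have hN : eval θ N ≠ 0 := by rw [← h2]; exact mul_ne_zero hv hD
  have hN0 : algebraMap _ (FractionRing (MvPolynomial Θ ℝ)) N ≠ 0 := by
    intro h
    rw [IsFractionRing.to_map_eq_zero_iff] at h
    simp [h] at hN
  have hf0 : f ≠ 0 := fun h => hN0 (by rw [← h1, h, zero_mul])
  refine ⟨D, N, hN, ?_, ?_⟩
  · rw [← h1]; field_simp
  · rw [← h2]; field_simp

theorem div (hf : SpecializesTo θ f v) (hg : SpecializesTo θ g w) (hw : w ≠ 0) :
    SpecializesTo θ (f / g) (v / w) := by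
  rw [div_eq_mul_inv, div_eq_mul_inv]; exact hf.mul (hg.inv hw)

theorem sum {κ : Type*} (s : Finset κ) {f : κ → FractionRing (MvPolynomial Θ ℝ)} {v : κ → ℝ}
    (h : ∀ i ∈ s, SpecializesTo θ (f i) (v i)) :
    SpecializesTo θ (∑ i ∈ s, f i) (∑ i ∈ s, v i) := by
  classical
  induction s using Finset.induction_on with
  | empty => simpa using zero
  | insert a s ha ih =>
    rw [Finset.sum_insert ha, Finset.sum_insert ha]
    exact (h a (Finset.mem_insert_self _ _)).add
      (ih fun i hi => h i (Finset.mem_insert_of_mem hi))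

theorem ne_zero (hf : SpecializesTo θ f v) (hv : v ≠ 0) : f ≠ 0 := by
  rintro rfl
  obtain ⟨N, D, hD, h1, h2⟩ := hf
  rw [zero_mul, eq_comm, IsFractionRing.to_map_eq_zero_iff] at h1
  rw [h1, map_zero] at h2
  exact (mul_ne_zero hv hD) h2

/-- The value does not depend on the fraction that represents `f`; here the denominator `D` may even
vanish at `θ`. -/
theorem mul_eval_eq {N D : MvPolynomial Θ ℝ}
    (hf : SpecializesTo θ f v) (h : f * algebraMap _ _ D = algebraMap _ _ N) :
    v * eval θ D = eval θ N := by
  obtain ⟨N', D', hD', h1, h2⟩ := hf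
  have : N * D' = N' * D := by
    apply IsFractionRing.injective (MvPolynomial Θ ℝ) (FractionRing (MvPolynomial Θ ℝ))
    rw [map_mul, map_mul, ← h, ← h1]; ring
  have h3 := congrArg (eval θ) this
  rw [map_mul, map_mul, ← h2] at h3
  apply mul_right_cancel₀ hD'
  rw [h3]; ring

theorem aeval {ι : Type*} {f : ι → FractionRing (MvPolynomial Θ ℝ)} {x : ι → ℝ}
    (h : ∀ i, SpecializesTo θ (f i) (x i)) (p : MvPolynomial ι ℝ) :
    SpecializesTo θ (MvPolynomial.aeval f p) (MvPolynomial.aeval x p) := by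
  induction p using MvPolynomial.induction_on with
  | C c => simpa using const c
  | add p q hp hq => simpa using hp.add hq
  | mul_X p i hp => simpa using hp.mul (h i)

end SpecializesTo

/-- A neighbourhood contains a box, which is a product of infinite sets. -/
theorem MvPolynomial.eq_zero_of_eventually_eval_eq_zero {Θ : Type*} [Finite Θ] {θ₀ : Θ → ℝ}
    {p : MvPolynomial Θ ℝ} (h : ∀ᶠ θ in nhds θ₀, MvPolynomial.eval θ p = 0) : p = 0 := by
  have := Fintype.ofFinite Θ
  obtain ⟨ε, hε, hball⟩ := Metric.eventually_nhds_iff.mp h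
  refine MvPolynomial.funext_set (fun i => Set.Ioo (θ₀ i - ε) (θ₀ i + ε))
    (fun i => Set.Ioo_infinite (by linarith)) fun x hx => ?_
  rw [map_zero]
  apply hball
  rw [dist_pi_lt_iff hε]
  intro i
  have := hx i (Set.mem_univ i)
  rw [Real.dist_eq, abs_lt]
  constructor <;> linarith [this.1, this.2]

theorem isTranscendenceBasis_fractionRing_X (Θ : Type) :
    IsTranscendenceBasis ℝ fun i : Θ =>
      algebraMap (MvPolynomial Θ ℝ) (FractionRing (MvPolynomial Θ ℝ)) (MvPolynomial.X i) :=
  have : Algebra.IsAlgebraic (MvPolynomial Θ ℝ) (FractionRing (MvPolynomial Θ ℝ)) :=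
    IsLocalization.isAlgebraic _ (nonZeroDivisors (MvPolynomial Θ ℝ))
  (IsTranscendenceBasis.mvPolynomial Θ ℝ).algebraMap_comp

/-- A set covered by a rational family with finitely many parameters has at most that dimension. -/
theorem algDimLE_of_specializesTo {ι : Type*} {Θ : Type} [Fintype Θ] {A : Set (ι → ℝ)}
    (f : ι → FractionRing (MvPolynomial Θ ℝ))
    (h : ∀ x ∈ A, ∃ θ : Θ → ℝ, ∀ i, SpecializesTo θ (f i) (x i)) :
    AlgDimLE A (Fintype.card Θ) := by
  intro s hs Y
  -- The function field has transcendence degree `card Θ`, so more than that many elements satisfy a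
  -- relation.
  have hdep : ¬ AlgebraicIndependent ℝ (fun i => MvPolynomial.aeval f (Y i)) := by
    intro hind
    have h1 := hind.cardinalMk_le_trdeg
    rw [← (isTranscendenceBasis_fractionRing_X Θ).cardinalMk_eq_trdeg, Cardinal.mk_fin,
      Cardinal.mk_fintype, Nat.cast_le] at h1
    omega
  rw [algebraicIndependent_iff] at hdep
  push Not at hdep
  obtain ⟨G, hG, hG0⟩ := hdep
  refine ⟨G, hG0, fun x hx => ?_⟩
  obtain ⟨θ, hθ⟩ := h x hx
  have h1 := SpecializesTo.aeval hθ (MvPolynomial.aeval Y G)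
  have h2 : MvPolynomial.aeval f (MvPolynomial.aeval Y G : MvPolynomial ι ℝ) = 0 := by
    rw [← hG]
    have : (MvPolynomial.aeval f).comp (MvPolynomial.aeval Y) =
        MvPolynomial.aeval (R := ℝ) (fun i => MvPolynomial.aeval f (Y i)) := by
      ext i; simp
    exact DFunLike.congr_fun this G
  rw [h2] at h1
  by_contra hne
  exact h1.ne_zero hne rfl

/-- A set that contains a rational family with generically algebraic parameters has at least the
dimension of the parameter space. -/
theorem card_le_of_eventually_specializesTo {ι : Type*} {Θ : Type} [Finite ι] [Fintype Θ]
    {A : Set (ι → ℝ)} (f : ι → FractionRing (MvPolynomial Θ ℝ)) (θ₀ : Θ → ℝ)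
    (h : ∀ᶠ θ in nhds θ₀, ∃ x ∈ A, ∀ i, SpecializesTo θ (f i) (x i))
    (hgen : ∀ L : IntermediateField ℝ (FractionRing (MvPolynomial Θ ℝ)),
      (∀ x, x ^ 2 ∈ L → x ∈ L) → (∀ i, f i ∈ L) →
      ∀ j, algebraMap (MvPolynomial Θ ℝ) _ (MvPolynomial.X j) ∈ L)
    {d : ℕ} (hd : semialgebraicDim A = d) : Fintype.card Θ ≤ d := by
  have hA : A.Nonempty := by
    obtain ⟨θ, x, hx, -⟩ := h.exists
    exact ⟨x, hx⟩
  -- Pulled back along the family, a polynomial that vanishes on `A` becomes a rational function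
  -- whose numerator vanishes near `θ₀`.
  have hker : ∀ q : MvPolynomial ι ℝ, (∀ x ∈ A, MvPolynomial.aeval x q = 0) →
      MvPolynomial.aeval f q = 0 := by
    intro q hq
    obtain ⟨⟨N, D⟩, hND⟩ := IsLocalization.surj (nonZeroDivisors (MvPolynomial Θ ℝ))
      (MvPolynomial.aeval f q)
    have hN : N = 0 := by
      apply MvPolynomial.eq_zero_of_eventually_eval_eq_zero (θ₀ := θ₀)
      filter_upwards [h] with θ ⟨x, hx, hθ⟩
      rw [← (SpecializesTo.aeval hθ q).mul_eval_eq hND, hq x hx, zero_mul]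
    subst hN
    simp only [map_zero, mul_eq_zero] at hND
    refine hND.resolve_right ?_
    rw [IsFractionRing.to_map_eq_zero_iff]
    exact nonZeroDivisors.ne_zero D.2
  obtain ⟨s, Y, hs, -, hint⟩ := exists_noether_normalization_of_set hA
  have : d = s := by rw [hd] at hs; exact_mod_cast hs
  subst this
  let F := FractionRing (MvPolynomial Θ ℝ)
  let y : Fin d → F := fun i => MvPolynomial.aeval f (Y i)
  let K := IntermediateField.adjoin ℝ (Set.range y)
  -- `L` is the algebraic closure, inside the function field, of the field generated by the pulled
  -- back Noether coordinates. It is closed under square roots, and it contains every `f i` because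
  -- the coordinate functions are integral over the Noether coordinates. By `hgen` it contains all
  -- parameters.
  let L : IntermediateField ℝ F := (algebraicClosure K F).restrictScalars ℝ
  have hL : ∀ x, x ∈ L ↔ IsAlgebraic K x := fun x => mem_algebraicClosure_iff
  have hyK : ∀ G : MvPolynomial (Fin d) ℝ, MvPolynomial.aeval f (MvPolynomial.aeval Y G :
      MvPolynomial ι ℝ) ∈ K := by
    intro G
    have : (MvPolynomial.aeval f).comp (MvPolynomial.aeval Y) =
        MvPolynomial.aeval (R := ℝ) y := by
      ext i; simp [y]
    have h2 := DFunLike.congr_fun this G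
    simp only [AlgHom.comp_apply] at h2
    rw [h2]
    exact IntermediateField.algebra_adjoin_le_adjoin ℝ _
      (Algebra.adjoin_range_eq_range_aeval ℝ y ▸ ⟨G, rfl⟩)
  have hX : ∀ j, algebraMap (MvPolynomial Θ ℝ) F (MvPolynomial.X j) ∈ L := by
    apply hgen
    · intro x hx
      rw [hL] at hx ⊢
      exact hx.of_pow two_pos
    · intro i
      rw [hL]
      obtain ⟨P, hP, hP0⟩ := hint (MvPolynomial.X i)
      have h1 := hker _ hP0
      let ψ : MvPolynomial (Fin d) ℝ →+* K :=
        (((MvPolynomial.aeval f).comp (MvPolynomial.aeval Y) :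
          MvPolynomial (Fin d) ℝ →ₐ[ℝ] F).toRingHom).codRestrict K.toSubfield hyK
      refine IsIntegral.isAlgebraic ⟨P.map ψ, hP.map ψ, ?_⟩
      rw [Polynomial.eval₂_map, ← h1]
      have h3 := Polynomial.hom_eval₂ P
        (MvPolynomial.aeval Y : MvPolynomial (Fin d) ℝ →ₐ[ℝ] MvPolynomial ι ℝ).toRingHom
        (MvPolynomial.aeval f : MvPolynomial ι ℝ →ₐ[ℝ] F).toRingHom (MvPolynomial.X i)
      simp only [AlgHom.toRingHom_eq_coe, RingHom.coe_coe, MvPolynomial.aeval_X] at h3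
      simp only [AlgHom.toRingHom_eq_coe]
      rw [h3]
      rfl
  have halgK : Algebra.IsAlgebraic K F := by
    rw [(isTranscendenceBasis_fractionRing_X Θ).isAlgebraic_iff (S := K)]
    exact fun j => (hL _).mp (hX j)
  have halg : Algebra.IsAlgebraic (Algebra.adjoin ℝ (Set.range y)) F := by
    open scoped IntermediateField.algebraAdjoinAdjoin in
    exact (IsFractionRing.comap_isAlgebraic_iff (A := Algebra.adjoin ℝ (Set.range y))
      (K := K)).mpr halgK
  -- The function field is algebraic over at most `d` generators, so its transcendence degree is at
  -- most `d`.
  have h1 := Algebra.IsAlgebraic.trdeg_le_cardinalMk ℝ (Set.range y)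
  have h2 := (isTranscendenceBasis_fractionRing_X Θ).cardinalMk_eq_trdeg
  rw [← h2, Cardinal.mk_fintype] at h1
  have h4 : Cardinal.mk (Set.range y) ≤ d := by
    have : Fintype (Set.range y) := Fintype.ofFinite _
    rw [Cardinal.mk_fintype]
    classical
    have := Fintype.card_range_le y
    exact_mod_cast (by simpa using this)
  exact_mod_cast h1.trans h4

/-! ### Signatures of symmetric matrices -/

theorem Matrix.toQuadraticForm'_apply_eq_dotProduct {n : ℕ} (S : Matrix (Fin n) (Fin n) ℝ)
    (x : Fin n → ℝ) : S.toQuadraticForm' x = x ⬝ᵥ S *ᵥ x := by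
  simp [Matrix.toQuadraticForm', Matrix.toLinearMap₂'_apply']

/-- The spectral theorem, phrased so that Sylvester's law of inertia counts eigenvalues by sign. -/
theorem Matrix.IsHermitian.equivalent_weightedSumSquares {n : ℕ} {S : Matrix (Fin n) (Fin n) ℝ}
    (hS : S.IsHermitian) : S.toQuadraticForm'.Equivalent
      (QuadraticMap.weightedSumSquares ℝ hS.eigenvalues) := by
  set U : Matrix (Fin n) (Fin n) ℝ := (hS.eigenvectorUnitary : Matrix (Fin n) (Fin n) ℝ) with hU
  have h1 : star U * U = 1 := Unitary.coe_star_mul_self hS.eigenvectorUnitary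
  have h2 : U * star U = 1 := Unitary.coe_mul_star_self hS.eigenvectorUnitary
  have hspec : S = U * diagonal hS.eigenvalues * star U := by
    conv_lhs => rw [hS.spectral_theorem, Unitary.conjStarAlgAut_apply]
    rfl
  refine ⟨{ toLinearEquiv := Matrix.toLin'OfInv h2 h1, map_app' := fun x => ?_ }⟩
  rw [Matrix.toQuadraticForm'_apply_eq_dotProduct]
  change QuadraticMap.weightedSumSquares ℝ hS.eigenvalues ((star U) *ᵥ x) = _
  conv_rhs => rw [hspec, Matrix.mul_assoc, ← Matrix.mulVec_mulVec, ← Matrix.mulVec_mulVec,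
    Matrix.dotProduct_mulVec]
  rw [QuadraticMap.weightedSumSquares_apply, dotProduct]
  refine Finset.sum_congr rfl fun i _ => ?_
  rw [Matrix.mulVec_diagonal]
  have : x ᵥ* U = star U *ᵥ x := by
    rw [← Matrix.mulVec_transpose]; rfl
  rw [this, smul_eq_mul]
  ring

/-- Positivity makes `f` injective, and its range is then a positive definite subspace of the same
dimension as `E`. -/
theorem QuadraticForm.finrank_le_sigPos_of_pos {M E : Type*} [AddCommGroup M] [Module ℝ M]
    [FiniteDimensional ℝ M] [AddCommGroup E] [Module ℝ E] (Q : QuadraticForm ℝ M) (f : E →ₗ[ℝ] M)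
    (h : ∀ x, x ≠ 0 → 0 < Q (f x)) : Module.finrank ℝ E ≤ sigPos Q := by
  have hinj : Function.Injective f := by
    rw [injective_iff_map_eq_zero]
    intro x hx
    by_contra hne
    have := h x hne
    simp [hx] at this
  rw [← LinearMap.finrank_range_of_inj hinj]
  apply le_sigPos_of_posDef
  rintro ⟨_, x, rfl⟩ hx
  apply h
  rintro rfl
  exact hx (by simp)

/-- The Lorentzian Gram matrix of the vectors `(u i, v i, w i)` in light cone coordinates. -/
def lorentzGram {n k : ℕ} (u v : Fin n → ℝ) (w : Fin n → Fin k → ℝ) : Matrix (Fin n) (Fin n) ℝ :=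
  .of fun i j => u i * v j + v i * u j - w i ⬝ᵥ w j

/-! ### Gram matrices in Minkowski space. -/

section lorentzGram

variable {n k : ℕ} (u v : Fin n → ℝ) (w : Fin n → Fin k → ℝ)

theorem lorentzGram_isHermitian : (lorentzGram u v w).IsHermitian := by
  ext i j
  simp only [conjTranspose_apply, lorentzGram, of_apply, star_trivial, dotProduct_comm (w j)]
  ring

theorem lorentzGram_rank_le : (lorentzGram u v w).rank ≤ k + 2 := by
  let A : Matrix (Fin n) (Fin 2 ⊕ Fin k) ℝ :=
    .of fun i => Sum.elim ![u i, v i] (w i)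
  let B : Matrix (Fin 2 ⊕ Fin k) (Fin n) ℝ :=
    .of fun l j => Sum.elim ![v j, u j] (-w j) l
  have : lorentzGram u v w = A * B := by
    ext i j
    simp [A, B, lorentzGram, mul_apply, dotProduct, Fin.sum_univ_two, sub_eq_add_neg]
  rw [this]
  refine (rank_mul_le_left A B).trans (A.rank_le_card_width.trans ?_)
  simp [add_comm]

/-- The form is the pullback of the Minkowski form `2uv - |w|²` along linear combination of the
given vectors. -/
theorem lorentzGram_quadraticForm (x : Fin n → ℝ) :
    x ⬝ᵥ lorentzGram u v w *ᵥ x =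
      2 * (∑ i, x i * u i) * (∑ i, x i * v i)
        - (∑ i, x i • w i) ⬝ᵥ (∑ i, x i • w i) := by
  have h1 : (∑ i, x i • w i) ⬝ᵥ (∑ i, x i • w i) = ∑ i, ∑ j, x i * x j * (w i ⬝ᵥ w j) := by
    simp_rw [sum_dotProduct, dotProduct_sum, smul_dotProduct, dotProduct_smul, smul_eq_mul,
      mul_assoc]
  have h2 : 2 * (∑ i, x i * u i) * (∑ i, x i * v i) =
      ∑ i, ∑ j, x i * x j * (u i * v j + v i * u j) := by
    have e1 : (∑ i, x i * u i) * (∑ i, x i * v i) = ∑ i, ∑ j, x i * x j * (u i * v j) := by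
      rw [Finset.sum_mul_sum]
      exact Finset.sum_congr rfl fun i _ => Finset.sum_congr rfl fun j _ => by ring
    have e2 : (∑ i, x i * v i) * (∑ i, x i * u i) = ∑ i, ∑ j, x i * x j * (v i * u j) := by
      rw [Finset.sum_mul_sum]
      exact Finset.sum_congr rfl fun i _ => Finset.sum_congr rfl fun j _ => by ring
    have e3 : 2 * (∑ i, x i * u i) * (∑ i, x i * v i) =
        (∑ i, x i * u i) * (∑ i, x i * v i) + (∑ i, x i * v i) * (∑ i, x i * u i) := by ring
    rw [e3, e1, e2, ← Finset.sum_add_distrib]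
    refine Finset.sum_congr rfl fun i _ => ?_
    rw [← Finset.sum_add_distrib]
    exact Finset.sum_congr rfl fun j _ => by ring
  rw [h1, h2, ← Finset.sum_sub_distrib, dotProduct]
  refine Finset.sum_congr rfl fun i _ => ?_
  rw [mulVec, dotProduct, Finset.mul_sum, ← Finset.sum_sub_distrib]
  refine Finset.sum_congr rfl fun j _ => ?_
  simp only [lorentzGram, of_apply]
  ring

theorem dotProduct_self_pos {k : ℕ} {c : Fin k → ℝ} (h : c ≠ 0) : 0 < c ⬝ᵥ c := by
  have h0 : 0 ≤ c ⬝ᵥ c := Finset.sum_nonneg fun i _ => mul_self_nonneg _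
  exact h0.lt_of_ne' fun h' => h (dotProduct_self_eq_zero.mp h')

/-- The Lorentzian Gram matrix of a spanning family of vectors has the Lorentzian signature. -/
theorem lorentzGram_signature
    (hspan : Submodule.span ℝ (Set.range fun i => (u i, v i, w i)) = ⊤)
    (hS : (lorentzGram u v w).IsHermitian) :
    (lorentzGram u v w).rank = k + 2 ∧ {a | 0 < hS.eigenvalues a}.ncard = 1 ∧
      {a | hS.eigenvalues a < 0}.ncard + 1 = k + 2 := by
  have hle := lorentzGram_rank_le u v w
  have hquad := lorentzGram_quadraticForm u v w
  generalize lorentzGram u v w = S at *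
  let Φ : (Fin n → ℝ) →ₗ[ℝ] ℝ × ℝ × (Fin k → ℝ) := Fintype.linearCombination ℝ
    (fun i => (u i, v i, w i))
  have hΦ : ∀ x, Φ x = (∑ i, x i * u i, ∑ i, x i * v i, ∑ i, x i • w i) := by
    intro x
    simp only [Φ, Fintype.linearCombination_apply]
    simp [Prod.ext_iff, Prod.fst_sum, Prod.snd_sum]
  have hQ : ∀ x, S.toQuadraticForm' x =
      2 * (Φ x).1 * (Φ x).2.1 - (Φ x).2.2 ⬝ᵥ (Φ x).2.2 := by
    intro x
    rw [Matrix.toQuadraticForm'_apply_eq_dotProduct, hquad, hΦ]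
  -- A section of `Φ` transports definite subspaces of Minkowski space back. The resulting lower
  -- bounds `1` and `k + 1` for the inertia indices are attained, since the rank is at most `k + 2`.
  obtain ⟨Ψ, hΨ⟩ := Φ.exists_rightInverse_of_surjective (by
    rw [Fintype.range_linearCombination, hspan])
  have hΨ' : ∀ y, Φ (Ψ y) = y := fun y => LinearMap.congr_fun hΨ y
  -- The positive line consists of the vectors `(t, t, 0)`.
  have hpos : 1 ≤ sigPos S.toQuadraticForm' := by
    have := QuadraticForm.finrank_le_sigPos_of_pos S.toQuadraticForm'
      (Ψ ∘ₗ LinearMap.prod LinearMap.id (LinearMap.prod LinearMap.id 0)) (by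
        intro x hx
        rw [LinearMap.comp_apply, hQ, hΨ']
        have : 0 < x ^ 2 := by positivity
        simp
        nlinarith)
    simpa using this
  -- The negative definite subspace consists of the vectors `(t, -t, c)`.
  have hneg : k + 1 ≤ sigNeg S.toQuadraticForm' := by
    have := QuadraticForm.finrank_le_sigPos_of_pos (-S.toQuadraticForm')
      (Ψ ∘ₗ LinearMap.prod (LinearMap.fst ℝ ℝ (Fin k → ℝ))
        (LinearMap.prod (-LinearMap.fst ℝ ℝ (Fin k → ℝ)) (LinearMap.snd ℝ ℝ (Fin k → ℝ)))) (by
        rintro ⟨t, c⟩ hx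
        rw [LinearMap.comp_apply, _root_.neg_apply, hQ, hΨ']
        change 0 < -(2 * t * -t - c ⬝ᵥ c)
        by_cases hc : c = 0
        · subst hc
          have ht : t ≠ 0 := fun h => hx (by rw [h]; rfl)
          have : 0 < t ^ 2 := by positivity
          simp
          nlinarith
        · have := dotProduct_self_pos hc
          nlinarith [sq_nonneg t])
    simpa [add_comm] using this
  rw [QuadraticForm.sigPos_of_equiv_weightedSumSquares hS.equivalent_weightedSumSquares] at hpos
  rw [QuadraticForm.sigNeg_of_equiv_weightedSumSquares hS.equivalent_weightedSumSquares] at hneg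
  have hsum : S.rank = {a | 0 < hS.eigenvalues a}.ncard + {a | hS.eigenvalues a < 0}.ncard := by
    have hset : {a | hS.eigenvalues a ≠ 0} =
        {a | 0 < hS.eigenvalues a} ∪ {a | hS.eigenvalues a < 0} := Set.ext fun a =>
      ⟨fun h => (lt_or_gt_of_ne h).symm, fun h => h.elim (fun h => h.ne') fun h => h.ne⟩
    rw [hS.rank_eq_card_non_zero_eigs, ← Set.ncard_union_eq, ← hset, ← Nat.card_eq_fintype_card]
    · exact Nat.card_coe_set_eq _
    · exact Set.disjoint_left.mpr fun a h1 h2 => lt_asymm (Set.mem_ofPred_eq.mp h1) h2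
  omega

end lorentzGram

/-- A symmetric matrix with a single positive eigenvalue is a Lorentzian Gram matrix, in light cone
coordinates adapted to two isotropic coordinate vectors. -/
theorem exists_lorentzGram_of_one_pos_eigenvalue {n : ℕ} {S : Matrix (Fin n) (Fin n) ℝ}
    (hS : S.IsHermitian) (hpos : {a | 0 < hS.eigenvalues a}.ncard = 1) {p q : Fin n}
    (hp : S p p = 0) (hq : S q q = 0) (hpq : S p q ≠ 0) :
    ∃ (k : ℕ) (w : Fin n → Fin k → ℝ), S.rank = k + 2 ∧
      S = lorentzGram (S p) (fun i => S q i / S p q) w ∧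
      Submodule.span ℝ (Set.range w) = ⊤ := by
  have hsymm : ∀ i j, S i j = S j i := fun i j => by
    have := congrFun (congrFun hS j) i
    simpa using this
  set s := S p q with hs
  have hqp : S q p = s := hsymm q p
  let B : (Fin n → ℝ) →ₗ[ℝ] (Fin n → ℝ) →ₗ[ℝ] ℝ := Matrix.toLinearMap₂' ℝ S
  have hB : ∀ x y, B x y = x ⬝ᵥ S *ᵥ y := fun x y => Matrix.toLinearMap₂'_apply' _ _ _
  have hBsymm : ∀ x y, B x y = B y x := by
    intro x y
    rw [hB, hB, dotProduct_mulVec, dotProduct_comm, ← mulVec_transpose]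
    congr 2
  have hBp : ∀ x i, B (Pi.single i 1) x = S i ⬝ᵥ x := by
    intro x i
    rw [hB, single_one_dotProduct]
    rfl
  have hBpp : ∀ i j, B (Pi.single i 1) (Pi.single j 1) = S i j := by
    intro i j
    rw [hBp, dotProduct_single_one]
  -- Minus the Gram matrix of the projections of the coordinate vectors to the orthogonal complement
  -- of the hyperbolic plane spanned by the coordinate vectors `p` and `q`.
  let N : Matrix (Fin n) (Fin n) ℝ := .of fun i j => (S p i * S q j + S q i * S p j) / s - S i j
  have hN : ∀ x, x ⬝ᵥ N *ᵥ x = 2 * (S p ⬝ᵥ x) * (S q ⬝ᵥ x) / s - B x x := by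
    intro x
    have : N = s⁻¹ • (vecMulVec (S p) (S q) + vecMulVec (S q) (S p)) - S := by
      ext i j
      simp [N, vecMulVec_apply]
      ring
    rw [this, sub_mulVec, smul_mulVec, add_mulVec, vecMulVec_mulVec, vecMulVec_mulVec, hB,
      dotProduct_sub, dotProduct_smul, dotProduct_add]
    simp only [op_smul_eq_smul, smul_eq_mul, dotProduct_comm x, smul_dotProduct]
    field_simp
    ring
  have hpsd : N.PosSemidef := by
    refine .of_dotProduct_mulVec_nonneg ?_ fun x => ?_
    · ext i j
      simp [N, hsymm i j]
      ring
    · rw [star_trivial, hN]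
      by_contra! hlt
      set b := S p ⬝ᵥ x
      set c := S q ⬝ᵥ x
      -- If `N` is negative at `x`, then the projection `y` of `x` to the complement has positive
      -- square. So has the vector `g` of the hyperbolic plane below, and the two span a positive
      -- definite plane, contradicting the single positive eigenvalue.
      let y : Fin n → ℝ := x - (c / s) • Pi.single p 1 - (b / s) • Pi.single q 1
      have hyp : B (Pi.single p 1) y = 0 := by
        simp only [y, map_sub, map_smul, smul_eq_mul, hBpp, hp]
        rw [hBp]
        change b - _ - b / s * s = 0
        field_simp
        ring
      have hyq : B (Pi.single q 1) y = 0 := by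
        simp only [y, map_sub, map_smul, smul_eq_mul, hBpp, hq]
        rw [hBp, hqp]
        change c - c / s * s - _ = 0
        field_simp
        ring
      have hyy : B y y = B x x - 2 * b * c / s := by
        have : B y y = B x y := by
          change B (x - (c / s) • Pi.single p 1 - (b / s) • Pi.single q 1) y = _
          simp only [map_sub, map_smul, LinearMap.sub_apply, LinearMap.smul_apply, hyp, hyq]
          simp
        rw [this]
        simp only [y, map_sub, map_smul, hBsymm x (Pi.single _ _), hBp, smul_eq_mul]
        change B x x - c / s * b - b / s * c = _
        field_simp
        ring
      have hy : 0 < B y y := by rw [hyy]; linarith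
      let g : Fin n → ℝ := Pi.single p 1 + s • Pi.single q 1
      have hgy : B g y = 0 := by
        simp only [g, map_add, map_smul, LinearMap.add_apply, LinearMap.smul_apply, hyp, hyq]
        simp
      have hgg : B g g = 2 * s ^ 2 := by
        simp only [g, map_add, map_smul, LinearMap.add_apply, LinearMap.smul_apply, hBpp, hp, hq,
          hqp, smul_eq_mul]
        change 0 + s * s + s * (s + s * 0) = _
        ring
      have h2 := QuadraticForm.finrank_le_sigPos_of_pos S.toQuadraticForm'
        (LinearMap.coprod (LinearMap.toSpanSingleton ℝ _ y) (LinearMap.toSpanSingleton ℝ _ g))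
        (by
          rintro ⟨α, β⟩ hne
          rw [Matrix.toQuadraticForm'_apply_eq_dotProduct, ← hB]
          have : B (α • y + β • g) (α • y + β • g) = α ^ 2 * B y y + β ^ 2 * (2 * s ^ 2) := by
            simp only [map_add, map_smul, LinearMap.add_apply, LinearMap.smul_apply, hgy,
              hBsymm y g, hgg, smul_eq_mul]
            ring
          simp only [LinearMap.coprod_apply, LinearMap.toSpanSingleton_apply]
          rw [this]
          by_cases hα : α = 0
          · have hβ : β ≠ 0 := fun h => hne (by rw [hα, h]; rfl)
            have : 0 < β ^ 2 * (2 * s ^ 2) := by positivity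
            nlinarith [sq_nonneg α]
          · have : 0 < α ^ 2 * B y y := by positivity
            have : 0 ≤ β ^ 2 * (2 * s ^ 2) := by positivity
            linarith)
      rw [QuadraticForm.sigPos_of_equiv_weightedSumSquares hS.equivalent_weightedSumSquares,
        hpos] at h2
      simp at h2
  -- `N` is the Gram matrix of the vectors `col i`. Orthonormal coordinates on their span `W` turn
  -- them into vectors `w i` that span the whole coordinate space.
  obtain ⟨m, t, ht⟩ := posSemidef_iff_eq_sum_vecMulVec.mp hpsd
  let col : Fin n → EuclideanSpace ℝ (Fin m) := fun i => WithLp.toLp 2 fun l => t l i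
  let W := Submodule.span ℝ (Set.range col)
  have hcol : ∀ i, col i ∈ W := fun i => Submodule.subset_span ⟨i, rfl⟩
  let b := stdOrthonormalBasis ℝ W
  let w : Fin n → Fin (Module.finrank ℝ W) → ℝ := fun i => b.repr ⟨col i, hcol i⟩
  have hw : ∀ i j, w i ⬝ᵥ w j = N i j := by
    intro i j
    have h1 : inner ℝ (b.repr ⟨col j, hcol j⟩) (b.repr ⟨col i, hcol i⟩) = w i ⬝ᵥ w j := by
      rw [EuclideanSpace.inner_eq_star_dotProduct, star_trivial]
    rw [← h1, LinearIsometryEquiv.inner_map_map, Submodule.coe_inner, ht]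
    change inner ℝ (col j) (col i) = _
    rw [EuclideanSpace.inner_eq_star_dotProduct, Matrix.sum_apply]
    simp [dotProduct, vecMulVec_apply, col]
  have hspan : Submodule.span ℝ (Set.range w) = ⊤ := by
    let e : W ≃ₗ[ℝ] (Fin (Module.finrank ℝ W) → ℝ) :=
      b.repr.toLinearEquiv.trans (WithLp.linearEquiv 2 ℝ _)
    have h1 : Set.range w = e '' (Set.range fun i => (⟨col i, hcol i⟩ : W)) := by
      rw [← Set.range_comp]
      rfl
    have h2 : Submodule.span ℝ (Set.range fun i => (⟨col i, hcol i⟩ : W)) = ⊤ := by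
      have := Submodule.span_span_coe_preimage (R := ℝ) (s := Set.range col)
      rw [← this]
      congr 1
      ext ⟨x, hx⟩
      simp [Subtype.ext_iff]
    rw [h1, ← LinearEquiv.coe_coe, ← Submodule.map_span, h2, Submodule.map_top, LinearEquiv.range]
  have hSeq : S = lorentzGram (S p) (fun i => S q i / s) w := by
    ext i j
    simp only [lorentzGram, of_apply, hw, N]
    field_simp
    ring
  refine ⟨_, w, ?_, hSeq, hspan⟩
  have hwp : ∀ i, N i i = 0 → w i = 0 := fun i h => by
    rw [← hw] at h
    exact dotProduct_self_eq_zero.mp h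
  have hw1 : w p = 0 := hwp p (by simp [N, hp])
  have hw2 : w q = 0 := hwp q (by simp [N, hq])
  -- The vectors of `p` and `q` are `(0, 1, 0)` and `(s, 0, 0)`, which complete the span of the `w
  -- i`; the rank then follows from `lorentzGram_signature`.
  have hfull : Submodule.span ℝ (Set.range fun i => (S p i, S q i / s, w i)) = ⊤ := by
    set V := Submodule.span ℝ (Set.range fun i => (S p i, S q i / s, w i))
    have hmem : ∀ i, (S p i, S q i / s, w i) ∈ V := fun i => Submodule.subset_span ⟨i, rfl⟩
    have m1 : ((0 : ℝ), (1 : ℝ), (0 : Fin (Module.finrank ℝ W) → ℝ)) ∈ V := by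
      have := hmem p
      rwa [hp, hqp, hw1, div_self hpq] at this
    have m2 : ((1 : ℝ), (0 : ℝ), (0 : Fin (Module.finrank ℝ W) → ℝ)) ∈ V := by
      have := V.smul_mem s⁻¹ (hmem q)
      rw [hq, hw2] at this
      simpa [← hs, hpq] using this
    have m3 : ∀ c, ((0 : ℝ), (0 : ℝ), c) ∈ V := by
      intro c
      have hc : c ∈ Submodule.span ℝ (Set.range w) := hspan ▸ Submodule.mem_top
      induction hc using Submodule.span_induction with
      | mem x hx =>
        obtain ⟨i, rfl⟩ := hx
        have := V.sub_mem (V.sub_mem (hmem i) (V.smul_mem (S p i) m2)) (V.smul_mem (S q i / s) m1)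
        simpa using this
      | zero => exact V.zero_mem
      | add x y _ _ hx hy => simpa using V.add_mem hx hy
      | smul a x _ hx => simpa using V.smul_mem a hx
    rw [eq_top_iff]
    rintro ⟨x, y, c⟩ -
    have := V.add_mem (V.add_mem (V.smul_mem x m2) (V.smul_mem y m1)) (m3 c)
    simpa using this
  have := (lorentzGram_signature _ _ w hfull (lorentzGram_isHermitian _ _ _)).1
  rw [← hSeq] at this
  exact this

/-! ### Configurations of light-like vectors -/

section Configuration

variable {n k : ℕ} {Λ : Type} [DecidableEq Λ] {𝕂 : Type*} [Field 𝕂]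

/-- First light cone coordinate of the light-like vector attached to a label. The label `inf` is
the point at infinity of the celestial sphere. -/
def lightU (𝕂 : Type*) [Field 𝕂] (inf x : Λ) : 𝕂 := if x = inf then 0 else 1

/-- Second light cone coordinate of the light-like vector attached to a label. -/
def lightV (inf : Λ) (z : Λ → Fin k → 𝕂) (x : Λ) : 𝕂 := if x = inf then 1 else z x ⬝ᵥ z x / 2

/-- Lorentzian inner product of the light-like vectors attached to two labels. -/
def lightPairing (inf : Λ) (z : Λ → Fin k → 𝕂) (x y : Λ) : 𝕂 :=
  lightU 𝕂 inf x * lightV inf z y + lightV inf z x * lightU 𝕂 inf y - z x ⬝ᵥ z y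

/-- The Gram matrix of multiples of light-like vectors, where index `i` carries the multiple `a i`
of the vector of its label. Unlabelled indices carry the zero vector. -/
def configMatrix (lab : Fin n → Option Λ) (inf : Λ) (a : Fin n → 𝕂) (z : Λ → Fin k → 𝕂) :
    Matrix (Fin n) (Fin n) 𝕂 :=
  .of fun i j => (lab i).elim 0 fun x => (lab j).elim 0 fun y => a i * a j * lightPairing inf z x y

/-- The sum of the multiples over all indices with a given label. -/
def labelWeight (lab : Fin n → Option Λ) (a : Fin n → 𝕂) (x : Λ) : 𝕂 :=
  ∑ i, if lab i = some x then a i else 0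

theorem configMatrix_apply {lab : Fin n → Option Λ} {inf : Λ} {a : Fin n → 𝕂}
    {z : Λ → Fin k → 𝕂} {i j : Fin n} {x y : Λ} (hi : lab i = some x) (hj : lab j = some y) :
    configMatrix lab inf a z i j = a i * a j * lightPairing inf z x y := by
  simp [configMatrix, hi, hj]

theorem lightPairing_comm (inf : Λ) (z : Λ → Fin k → 𝕂) (x y : Λ) :
    lightPairing inf z x y = lightPairing inf z y x := by
  rw [lightPairing, lightPairing, dotProduct_comm (z x)]
  ring

theorem lightPairing_inf {inf : Λ} {z : Λ → Fin k → 𝕂} (hz : z inf = 0) {x : Λ} (hx : x ≠ inf) :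
    lightPairing inf z inf x = 1 := by
  simp [lightPairing, lightU, lightV, hx, hz]

/-- Finite rays `(1, |z|²/2, z)` have half the squared distance of their points as product;
positivity and the vanishing of self-products both come from here. -/
theorem lightPairing_of_ne [CharZero 𝕂] {inf : Λ} (z : Λ → Fin k → 𝕂) {x y : Λ} (hx : x ≠ inf)
    (hy : y ≠ inf) : lightPairing inf z x y = (z x - z y) ⬝ᵥ (z x - z y) / 2 := by
  simp only [lightPairing, lightU, lightV, hx, hy, if_false, sub_dotProduct, dotProduct_sub,
    dotProduct_comm (z y) (z x)]
  ring

theorem lightPairing_self [CharZero 𝕂] {inf : Λ} {z : Λ → Fin k → 𝕂} (hz : z inf = 0) (x : Λ) :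
    lightPairing inf z x x = 0 := by
  by_cases hx : x = inf
  · subst hx; simp [lightPairing, lightU, hz]
  · simp [lightPairing_of_ne z hx hx]

theorem lightPairing_pos {inf : Λ} {z : Λ → Fin k → ℝ} (hz : z inf = 0)
    (hinj : ∀ x y, x ≠ inf → y ≠ inf → x ≠ y → z x ≠ z y) {x y : Λ} (hxy : x ≠ y) :
    0 < lightPairing inf z x y := by
  by_cases hx : x = inf
  · subst hx; rw [lightPairing_inf hz (Ne.symm hxy)]; exact one_pos
  by_cases hy : y = inf
  · subst hy; rw [lightPairing_comm, lightPairing_inf hz hxy]; exact one_pos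
  rw [lightPairing_of_ne z hx hy]
  exact half_pos (dotProduct_self_pos (sub_ne_zero.mpr (hinj x y hx hy hxy)))

theorem configMatrix_eq_lorentzGram (lab : Fin n → Option Λ) (inf : Λ) (a : Fin n → ℝ)
    (z : Λ → Fin k → ℝ) :
    configMatrix lab inf a z = lorentzGram (fun i => a i • (lab i).elim 0 (lightU ℝ inf))
      (fun i => a i • (lab i).elim 0 (lightV inf z)) (fun i => a i • (lab i).elim 0 z) := by
  ext i j
  simp only [configMatrix, lorentzGram, of_apply]
  cases lab i <;> cases lab j <;> simp [lightPairing]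
  ring

/-- A sign pattern of a symmetric matrix: the entry of two differently labelled indices has the
prescribed sign, all other entries vanish. -/
structure HasSignPattern (lab : Fin n → Option Λ) (ε : Fin n → ℝ)
    (S : Matrix (Fin n) (Fin n) ℝ) : Prop where
  sign : ∀ i j x y, lab i = some x → lab j = some y → x ≠ y → 0 < ε i * ε j * S i j
  zero : ∀ i j, (∀ x y, lab i = some x → lab j = some y → x = y) → S i j = 0

variable [Fintype Λ]

/-- Grouping indices by label shows that momentum conservation depends on the multiples only through
the weights. -/
theorem sum_smul_label {V : Type*} [AddCommGroup V] [Module 𝕂 V] (lab : Fin n → Option Λ)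
    (a : Fin n → 𝕂) (g : Λ → V) :
    ∑ i, a i • (lab i).elim 0 g = ∑ x, labelWeight lab a x • g x := by
  simp_rw [labelWeight, Finset.sum_smul]
  rw [Finset.sum_comm]
  refine Finset.sum_congr rfl fun i _ => ?_
  cases h : lab i with
  | none => simp
  | some x => simp [ite_smul]

/-- Configurations of light-like vectors with prescribed signs that span and add up to zero,
normalized to put the label `inf` at infinity and the label `o` at the origin. -/
structure IsMomentumConfig (lab : Fin n → Option Λ) (ε : Fin n → ℝ) (inf o : Λ) (a : Fin n → ℝ)
    (z : Λ → Fin k → ℝ) : Prop where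
  loops : ∀ i, lab i = none → a i = 0
  signs : ∀ i j, lab i ≠ none → lab j ≠ none → 0 < ε i * ε j * (a i * a j)
  z_inf : z inf = 0
  z_origin : z o = 0
  injOn : ∀ x y, x ≠ inf → y ≠ inf → x ≠ y → z x ≠ z y
  span : Submodule.span ℝ (Set.range z) = ⊤
  sum_u : ∑ x, labelWeight lab a x * lightU ℝ inf x = 0
  sum_v : ∑ x, labelWeight lab a x * lightV inf z x = 0
  sum_z : ∑ x, labelWeight lab a x • z x = 0

namespace IsMomentumConfig

variable {lab : Fin n → Option Λ} {ε : Fin n → ℝ} {inf o : Λ} {a : Fin n → ℝ} {z : Λ → Fin k → ℝ}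

theorem ne_zero (h : IsMomentumConfig lab ε inf o a z) {i : Fin n} (hi : lab i ≠ none) :
    a i ≠ 0 := by
  intro h0
  have := h.signs i i hi hi
  simp [h0] at this

theorem hasSignPattern (h : IsMomentumConfig lab ε inf o a z) :
    HasSignPattern lab ε (configMatrix lab inf a z) where
  sign i j x y hi hj hxy := by
    rw [configMatrix_apply hi hj, ← mul_assoc]
    exact mul_pos (h.signs i j (by simp [hi]) (by simp [hj])) (lightPairing_pos h.z_inf h.injOn hxy)
  zero i j hij := by
    cases hi : lab i with
    | none => simp [configMatrix, hi]
    | some x =>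
      cases hj : lab j with
      | none => simp [configMatrix, hi, hj]
      | some y =>
        rw [configMatrix_apply hi hj, hij x y hi hj, lightPairing_self h.z_inf, mul_zero]

theorem row_sum (h : IsMomentumConfig lab ε inf o a z) (i : Fin n) :
    ∑ j, configMatrix lab inf a z i j = 0 := by
  have h1 := sum_smul_label lab a (lightU ℝ inf)
  have h2 := sum_smul_label lab a (lightV inf z)
  have h3 := sum_smul_label lab a z
  simp only [smul_eq_mul] at h1 h2
  rw [h.sum_u] at h1
  rw [h.sum_v] at h2
  rw [h.sum_z] at h3
  rw [configMatrix_eq_lorentzGram]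
  simp only [lorentzGram, of_apply, smul_eq_mul]
  rw [Finset.sum_sub_distrib, Finset.sum_add_distrib, ← Finset.mul_sum, ← Finset.mul_sum, h1, h2,
    ← dotProduct_sum, h3]
  simp

/-- The labels `inf` and `o` supply the two isotropic axes, and modulo these the points supply the
remaining directions. Hence the vectors span, and the Gram matrix has Lorentzian signature. -/
theorem mem_mmcRegion (h : IsMomentumConfig lab ε inf o a z) (hne : inf ≠ o)
    (hlab : ∀ x, ∃ i, lab i = some x) : configMatrix lab inf a z ∈ mmcRegion n (k + 2) := by
  have hherm : (configMatrix lab inf a z).IsHermitian := by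
    rw [configMatrix_eq_lorentzGram]; exact lorentzGram_isHermitian _ _ _
  have hdiag : ∀ i, configMatrix lab inf a z i i = 0 := fun i =>
    h.hasSignPattern.zero i i fun x y hx hy => Option.some_injective _ (hx.symm.trans hy)
  have hcol : ∀ j, ∑ i, configMatrix lab inf a z i j = 0 := by
    intro j
    rw [← h.row_sum j]
    refine Finset.sum_congr rfl fun i _ => ?_
    simpa using (congrFun (congrFun hherm i) j).symm
  have hfull : Submodule.span ℝ (Set.range fun i => (a i • (lab i).elim 0 (lightU ℝ inf),
      a i • (lab i).elim 0 (lightV inf z), a i • (lab i).elim 0 z)) = ⊤ := by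
    set V := Submodule.span ℝ (Set.range fun i => (a i • (lab i).elim 0 (lightU ℝ inf),
      a i • (lab i).elim 0 (lightV inf z), a i • (lab i).elim 0 z))
    have hmem : ∀ x, (lightU ℝ inf x, lightV inf z x, z x) ∈ V := by
      intro x
      obtain ⟨i, hi⟩ := hlab x
      have h1 : (a i • (lab i).elim 0 (lightU ℝ inf),
        a i • (lab i).elim 0 (lightV inf z), a i • (lab i).elim 0 z) ∈ V :=
        Submodule.subset_span ⟨i, rfl⟩
      have h2 := V.smul_mem (a i)⁻¹ h1
      have h3 : a i ≠ 0 := h.ne_zero (by simp [hi])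
      simpa [hi, smul_smul, h3] using h2
    have m1 : ((0 : ℝ), (1 : ℝ), (0 : Fin k → ℝ)) ∈ V := by
      simpa [lightU, lightV, h.z_inf] using hmem inf
    have m2 : ((1 : ℝ), (0 : ℝ), (0 : Fin k → ℝ)) ∈ V := by
      simpa [lightU, lightV, h.z_origin, hne.symm] using hmem o
    have m3 : ∀ c, ((0 : ℝ), (0 : ℝ), c) ∈ V := by
      intro c
      have hc : c ∈ Submodule.span ℝ (Set.range z) := h.span ▸ Submodule.mem_top
      induction hc using Submodule.span_induction with
      | mem x hx =>
        obtain ⟨x, rfl⟩ := hx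
        have := V.sub_mem (V.sub_mem (hmem x) (V.smul_mem (lightU ℝ inf x) m2))
          (V.smul_mem (lightV inf z x) m1)
        simpa using this
      | zero => exact V.zero_mem
      | add x y _ _ hx hy => simpa using V.add_mem hx hy
      | smul a x _ hx => simpa using V.smul_mem a hx
    rw [eq_top_iff]
    rintro ⟨x, y, c⟩ -
    have := V.add_mem (V.add_mem (V.smul_mem x m2) (V.smul_mem y m1)) (m3 c)
    simpa using this
  have hsig := lorentzGram_signature _ _ _ hfull (lorentzGram_isHermitian _ _ _)
  simp only [← configMatrix_eq_lorentzGram] at hsig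
  exact ⟨⟨⟨hsig.1, fun i => (hdiag i).ge, hherm, hsig.2.1, hsig.2.2⟩, hdiag⟩, h.row_sum, hcol⟩

/-- Scaling the celestial sphere does not change the Gram matrix. -/
theorem scale (h : IsMomentumConfig lab ε inf o a z) {t : ℝ} (ht : t ≠ 0) :
    IsMomentumConfig lab ε inf o (fun i => a i * if lab i = some inf then t else t⁻¹)
        (fun x => t • z x) ∧
      configMatrix lab inf (fun i => a i * if lab i = some inf then t else t⁻¹)
        (fun x => t • z x) = configMatrix lab inf a z ∧
      ∀ x, labelWeight lab (fun i => a i * if lab i = some inf then t else t⁻¹) x =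
        labelWeight lab a x * if x = inf then t else t⁻¹ := by
  -- The transformation is the boost `(u, v, w) ↦ (t⁻¹u, tv, w)`, expressed in multiples and points.
  have hw : ∀ x, labelWeight lab (fun i => a i * if lab i = some inf then t else t⁻¹) x =
      labelWeight lab a x * if x = inf then t else t⁻¹ := by
    intro x
    simp only [labelWeight]
    rw [Finset.sum_mul]
    refine Finset.sum_congr rfl fun i _ => ?_
    by_cases hi : lab i = some x
    · simp [hi]
    · simp [hi]
  have hV : ∀ x, lightV inf (fun x => t • z x) x =
      lightV inf z x * if x = inf then 1 else t ^ 2 := by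
    intro x
    by_cases hx : x = inf
    · simp [lightV, hx]
    · simp only [lightV, hx, if_false, smul_dotProduct, dotProduct_smul, smul_eq_mul]
      ring
  refine ⟨⟨?_, ?_, ?_, ?_, ?_, ?_, ?_, ?_, ?_⟩, ?_, hw⟩
  · intro i hi
    simp [h.loops i hi]
  · intro i j hi hj
    have h1 := h.signs i j hi hj
    have h2 : 0 < (if lab i = some inf then t else t⁻¹) * (if lab j = some inf then t else t⁻¹) := by
      split_ifs <;> simp [ht]
    have := mul_pos h1 h2
    nlinarith
  · simp [h.z_inf]
  · simp [h.z_origin]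
  · intro x y hx hy hxy heq
    exact h.injOn x y hx hy hxy (smul_right_injective _ ht heq)
  · rw [eq_top_iff, ← h.span, Submodule.span_le]
    rintro _ ⟨x, rfl⟩
    have := Submodule.smul_mem (Submodule.span ℝ (Set.range fun x => t • z x)) t⁻¹
      (Submodule.subset_span ⟨x, rfl⟩)
    simpa [smul_smul, ht] using this
  · simp_rw [hw]
    rw [← mul_zero t⁻¹, ← h.sum_u, Finset.mul_sum]
    refine Finset.sum_congr rfl fun x _ => ?_
    by_cases hx : x = inf
    · simp [lightU, hx]
    · simp [hx]; ring
  · simp_rw [hw, hV]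
    rw [← mul_zero t, ← h.sum_v, Finset.mul_sum]
    refine Finset.sum_congr rfl fun x _ => ?_
    by_cases hx : x = inf
    · simp [hx]; ring
    · simp only [hx, if_false]; field_simp
  · simp_rw [hw]
    rw [← h.sum_z]
    refine Finset.sum_congr rfl fun x _ => ?_
    by_cases hx : x = inf
    · simp [hx, h.z_inf]
    · simp [hx, smul_smul, ht]
  · ext i j
    cases hi : lab i with
    | none => simp [configMatrix, hi]
    | some x =>
      cases hj : lab j with
      | none => simp [configMatrix, hj]
      | some y =>
        rw [configMatrix_apply hi hj, configMatrix_apply hi hj]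
        simp only [lightPairing, hV, hi, hj, Option.some.injEq, smul_dotProduct, dotProduct_smul,
          smul_eq_mul]
        by_cases hx : x = inf <;> by_cases hy : y = inf <;>
          simp only [hx, hy, lightU, h.z_inf, if_true, if_false, zero_dotProduct,
            dotProduct_zero] <;> field_simp <;> ring

/-- Rotating the celestial sphere does not change the Gram matrix. -/
theorem rotate (h : IsMomentumConfig lab ε inf o a z)
    (R : EuclideanSpace ℝ (Fin k) ≃ₗᵢ[ℝ] EuclideanSpace ℝ (Fin k)) :
    IsMomentumConfig lab ε inf o a (fun x => (R (WithLp.toLp 2 (z x))).ofLp) ∧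
      configMatrix lab inf a (fun x => (R (WithLp.toLp 2 (z x))).ofLp) =
        configMatrix lab inf a z := by
  let ρ : (Fin k → ℝ) ≃ₗ[ℝ] (Fin k → ℝ) :=
    (WithLp.linearEquiv 2 ℝ (Fin k → ℝ)).symm.trans
      (R.toLinearEquiv.trans (WithLp.linearEquiv 2 ℝ (Fin k → ℝ)))
  have hρ : ∀ c, (R (WithLp.toLp 2 c)).ofLp = ρ c := fun c => rfl
  have hdot : ∀ c d, ρ c ⬝ᵥ ρ d = c ⬝ᵥ d := by
    intro c d
    have h1 : inner ℝ (R (WithLp.toLp 2 d)) (R (WithLp.toLp 2 c)) =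
      inner ℝ (WithLp.toLp 2 d) (WithLp.toLp 2 c) := R.inner_map_map _ _
    rw [EuclideanSpace.inner_eq_star_dotProduct, EuclideanSpace.inner_eq_star_dotProduct] at h1
    simpa [hρ] using h1
  simp_rw [hρ]
  have hV : ∀ x, lightV inf (fun x => ρ (z x)) x = lightV inf z x := by
    intro x; simp [lightV, hdot]
  refine ⟨⟨h.loops, h.signs, ?_, ?_, ?_, ?_, h.sum_u, ?_, ?_⟩, ?_⟩
  · simp [h.z_inf]
  · simp [h.z_origin]
  · intro x y hx hy hxy heq
    exact h.injOn x y hx hy hxy (ρ.injective heq)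
  · have : (Set.range fun x => ρ (z x)) = (ρ : (Fin k → ℝ) →ₗ[ℝ] _) '' Set.range z := by
      rw [← Set.range_comp]; rfl
    rw [this, ← Submodule.map_span, h.span, Submodule.map_top, LinearEquiv.range]
  · simp_rw [hV]; exact h.sum_v
  · simp_rw [← map_smul]
    rw [← map_sum, h.sum_z, map_zero]
  · ext i j
    simp only [configMatrix, lightPairing, hV, hdot]

/-- Every configuration can be normalized by scaling and rotation. -/
theorem exists_normalized (h : IsMomentumConfig lab ε inf o a z) {q : Fin n} {κ : Λ}
    (hq : lab q = some κ) (hκ : κ ≠ inf) (e : Fin k → Λ) :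
    ∃ (a' : Fin n → ℝ) (z' : Λ → Fin k → ℝ), IsMomentumConfig lab ε inf o a' z' ∧
      configMatrix lab inf a' z' = configMatrix lab inf a z ∧ a' q = 1 ∧
      (∀ i j, i < j → z' (e i) j = 0) ∧
      (∀ x, labelWeight lab a' x = 0 ↔ labelWeight lab a x = 0) ∧
      (LinearIndependent ℝ (z ∘ e) → LinearIndependent ℝ (z' ∘ e)) := by
  have hq0 : a q ≠ 0 := h.ne_zero (by simp [hq])
  -- Boosting by `a q` divides the multiples at finite labels by `a q`. Gram-Schmidt on the points
  -- `e j` then gives the rotation that makes them triangular.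
  obtain ⟨h1, h2, h3⟩ := h.scale hq0
  let f : Fin k → EuclideanSpace ℝ (Fin k) := fun j => WithLp.toLp 2 (a q • z (e j))
  have hcard : Module.finrank ℝ (EuclideanSpace ℝ (Fin k)) = Fintype.card (Fin k) := by simp
  let b := InnerProductSpace.gramSchmidtOrthonormalBasis hcard f
  obtain ⟨h4, h5⟩ := h1.rotate b.repr
  refine ⟨_, _, h4, h5.trans h2, ?_, ?_, ?_, ?_⟩
  · simp [hq, hκ, hq0]
  · intro i j hij
    exact InnerProductSpace.gramSchmidtOrthonormalBasis_inv_triangular' hcard f hij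
  · intro x
    have : (if x = inf then a q else (a q)⁻¹) ≠ 0 := by split_ifs <;> simp [hq0]
    rw [h3, mul_eq_zero, or_iff_left this]
  · intro hli
    have h6 := hli.units_smul fun _ => Units.mk0 (a q) hq0
    let ρ : (Fin k → ℝ) ≃ₗ[ℝ] (Fin k → ℝ) :=
      (WithLp.linearEquiv 2 ℝ (Fin k → ℝ)).symm.trans
        (b.repr.toLinearEquiv.trans (WithLp.linearEquiv 2 ℝ (Fin k → ℝ)))
    exact h6.map' ρ.toLinearMap (LinearEquiv.ker ρ)

end IsMomentumConfig

/-- Every matrix in the massless momentum conserving region with a given sign pattern comes from a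
configuration of light-like vectors. -/
theorem exists_isMomentumConfig {lab : Fin n → Option Λ} {ε : Fin n → ℝ}
    (hε : ∀ i, ε i * ε i = 1) {inf o : Λ} (hne : inf ≠ o)
    (hlab : ∀ x, ∃ i, lab i = some x) {S : Matrix (Fin n) (Fin n) ℝ} {r : ℕ}
    (hS : S ∈ mmcRegion n r) (hpat : HasSignPattern lab ε S) :
    ∃ (k : ℕ) (a : Fin n → ℝ) (z : Λ → Fin k → ℝ), r = k + 2 ∧
      IsMomentumConfig lab ε inf o a z ∧ configMatrix lab inf a z = S := by
  obtain ⟨⟨⟨hrank, -, hherm, hpos, -⟩, hdiag⟩, hrow, -⟩ := hS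
  have hsymm : ∀ i j, S i j = S j i := fun i j => by
    simpa using congrFun (congrFun hherm j) i
  obtain ⟨p, hp⟩ := hlab inf
  obtain ⟨q, hq⟩ := hlab o
  have hpq : S p q ≠ 0 := by
    intro h
    have := hpat.sign p q _ _ hp hq hne
    simp [h] at this
  -- Taking the isotropic axes along the vectors of `p` and `q` sends `inf` to infinity and `o` to
  -- the origin.
  obtain ⟨k, w, hk, hgram, hspan⟩ := exists_lorentzGram_of_one_pos_eigenvalue hherm hpos
    (hdiag p) (hdiag q) hpq
  set u : Fin n → ℝ := S p with hu
  set v : Fin n → ℝ := fun i => S q i / S p q with hv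
  have hS : ∀ i j, S i j = u i * v j + v i * u j - w i ⬝ᵥ w j := fun i j =>
    congrFun (congrFun hgram i) j
  have hu0 : ∀ i, (∀ x, lab i = some x → x = inf) → u i = 0 := by
    intro i hi
    apply hpat.zero
    intro x y hx hy
    rw [hp] at hx
    rw [hi y hy, ← Option.some_injective _ hx]
  have hv0 : ∀ i, lab i = none → v i = 0 := by
    intro i hi
    rw [hv]
    simp only
    rw [hpat.zero q i (by simp [hi]), zero_div]
  have hw0 : ∀ i, u i = 0 → w i = 0 := by
    intro i hi
    have := hS i i
    rw [hdiag, hi, zero_mul, mul_zero, add_zero, zero_sub, eq_comm, neg_eq_zero] at this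
    exact dotProduct_self_eq_zero.mp this
  have hsu : ∀ i x, lab i = some x → x ≠ inf → 0 < ε p * ε i * u i := fun i x hi hx =>
    hpat.sign p i _ _ hp hi (Ne.symm hx)
  have hune : ∀ i x, lab i = some x → x ≠ inf → u i ≠ 0 := by
    intro i x hi hx h
    have := hsu i x hi hx
    simp [h] at this
  have hsv : ∀ i, lab i = some inf → 0 < ε p * ε i * v i := by
    intro i hi
    have h1 := hpat.sign q i _ _ hq hi hne.symm
    have h2 := hpat.sign p q _ _ hp hq hne
    have h3 : ε p * ε i * v i = (ε q * ε i * S q i) * (ε p * ε q * S p q) / (S p q) ^ 2 := by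
      have h4 : v i * S p q = S q i := div_mul_cancel₀ _ hpq
      rw [eq_div_iff (pow_ne_zero 2 hpq), ← h4]
      linear_combination (-(ε p * ε i * v i * S p q ^ 2)) * hε q
    rw [h3]
    positivity
  choose rep hrep using hlab
  -- Finite rays are normalized by `u = 1` and the ray at infinity by `v = 1`, so the multiple is
  -- the respective coordinate.
  let a : Fin n → ℝ := fun i => if lab i = some inf then v i else u i
  let z : Λ → Fin k → ℝ := fun x => if x = inf then 0 else (u (rep x))⁻¹ • w (rep x)
  -- Orthogonal light-like vectors with non-zero `u` are parallel: the squared distance of their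
  -- normalized points is a multiple of their product.
  have hparallel : ∀ i j x, lab i = some x → lab j = some x → x ≠ inf →
      (u i)⁻¹ • w i = (u j)⁻¹ • w j := by
    intro i j x hi hj hx
    have hui := hune i x hi hx
    have huj := hune j x hj hx
    have h1 := hS i i
    have h2 := hS j j
    have h3 := hS i j
    rw [hdiag] at h1 h2
    rw [hpat.zero i j (by rw [hi, hj]; rintro x y ⟨⟩ ⟨⟩; rfl)] at h3
    rw [← sub_eq_zero]
    apply dotProduct_self_eq_zero.mp
    simp only [sub_dotProduct, dotProduct_sub, smul_dotProduct, dotProduct_smul, smul_eq_mul,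
      dotProduct_comm (w j) (w i)]
    have e1 : w i ⬝ᵥ w i = 2 * u i * v i := by linarith
    have e2 : w j ⬝ᵥ w j = 2 * u j * v j := by linarith
    have e3 : w i ⬝ᵥ w j = u i * v j + v i * u j := by linarith
    rw [e1, e2, e3]
    field_simp
    ring
  have hau : ∀ i, u i = a i • (lab i).elim 0 (lightU ℝ inf) := by
    intro i
    cases hi : lab i with
    | none => simpa using hu0 i (by simp [hi])
    | some x =>
      by_cases hx : x = inf
      · subst hx
        simpa [lightU] using hu0 i (by rw [hi]; rintro _ ⟨⟩; rfl)
      · simp [a, hi, hx, lightU]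
  have haz : ∀ i, w i = a i • (lab i).elim 0 z := by
    intro i
    cases hi : lab i with
    | none => simpa using hw0 i (hu0 i (by simp [hi]))
    | some x =>
      by_cases hx : x = inf
      · subst hx
        simpa [z] using hw0 i (hu0 i (by rw [hi]; rintro _ ⟨⟩; rfl))
      · simp only [a, z, hi, hx, Option.some.injEq, if_false, Option.elim_some]
        rw [← hparallel i (rep x) x hi (hrep x) hx, smul_smul, mul_inv_cancel₀ (hune i x hi hx),
          one_smul]
  have hav : ∀ i, v i = a i • (lab i).elim 0 (lightV inf z) := by
    intro i
    cases hi : lab i with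
    | none => simpa using hv0 i hi
    | some x =>
      by_cases hx : x = inf
      · subst hx
        simp [a, hi, lightV]
      · have h1 := hS i i
        rw [hdiag, haz i, hi] at h1
        have h2 : a i = u i := by simp [a, hi, hx]
        have h3 := hune i x hi hx
        simp only [Option.elim_some, smul_dotProduct, dotProduct_smul, smul_eq_mul, h2] at h1
        simp only [Option.elim_some, lightV, hx, if_false, smul_eq_mul, h2]
        have : u i * (u i * (z x ⬝ᵥ z x) - 2 * v i) = 0 := by linarith
        have := (mul_eq_zero.mp this).resolve_left h3
        linarith
  have hmat : configMatrix lab inf a z = S := by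
    rw [configMatrix_eq_lorentzGram]
    simp_rw [← hau, ← hav, ← haz]
    exact hgram.symm
  have hsa : ∀ i, lab i ≠ none → 0 < ε p * ε i * a i := by
    intro i hi
    obtain ⟨x, hx⟩ := Option.ne_none_iff_exists'.mp hi
    by_cases hx' : x = inf
    · subst hx'
      simpa [a, hx] using hsv i hx
    · simpa [a, hx, hx'] using hsu i x hx hx'
  have hsumu : ∑ i, u i = 0 := hrow p
  have hsumv : ∑ i, v i = 0 := by
    rw [hv]; simp only; rw [← Finset.sum_div, hrow q, zero_div]
  -- The quadratic form vanishes at the all-ones vector, and so does `∑ u`; what remains is `-|∑ w|²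
  -- = 0`.
  have hsumw : ∑ i, w i = 0 := by
    have h1 := lorentzGram_quadraticForm u v w (fun _ => 1)
    rw [← hgram] at h1
    have h2 : S *ᵥ (fun _ => (1 : ℝ)) = 0 := by
      ext i
      simp [mulVec, dotProduct, hrow i]
    simp only [h2, dotProduct_zero, one_mul, one_smul, hsumu, mul_zero, zero_mul, zero_sub] at h1
    exact dotProduct_self_eq_zero.mp (by linarith)
  have hz_inf : z inf = 0 := by simp [z]
  refine ⟨k, a, z, hrank ▸ hk, ⟨?_, ?_, hz_inf, ?_, ?_, ?_, ?_, ?_, ?_⟩, hmat⟩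
  · intro i hi
    simpa [a, hi] using hu0 i (by simp [hi])
  · intro i j hi hj
    have h1 := mul_pos (hsa i hi) (hsa j hj)
    have h2 : ε i * ε j * (a i * a j) = ε p * ε i * a i * (ε p * ε j * a j) := by
      linear_combination (-(ε i * ε j * a i * a j)) * hε p
    rwa [h2]
  · have h1 := haz q
    have h2 : w q = 0 := by
      have := hS q q
      have hvq : v q = 0 := by simp [hv, hdiag]
      rw [hdiag, hvq, zero_mul, mul_zero, add_zero, zero_sub, eq_comm, neg_eq_zero] at this
      exact dotProduct_self_eq_zero.mp this
    rw [h2, hq, eq_comm, smul_eq_zero] at h1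
    refine h1.resolve_left fun h => ?_
    have := hsa q (by simp [hq])
    simp [h] at this
  · intro x y hx hy hxy heq
    have h1 := hpat.sign _ _ x y (hrep x) (hrep y) hxy
    rw [← hmat, configMatrix_apply (hrep x) (hrep y), lightPairing_of_ne z hx hy, heq] at h1
    simp at h1
  · rw [eq_top_iff, ← hspan, Submodule.span_le]
    rintro _ ⟨i, rfl⟩
    rw [haz i]
    cases lab i with
    | none => simp
    | some x => exact Submodule.smul_mem _ _ (Submodule.subset_span ⟨x, rfl⟩)
  · have := sum_smul_label lab a (lightU ℝ inf)
    simp_rw [← hau, hsumu] at this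
    simpa using this.symm
  · have := sum_smul_label lab a (lightV inf z)
    simp_rw [← hav, hsumv] at this
    simpa using this.symm
  · have := sum_smul_label lab a z
    simp_rw [← haz, hsumw] at this
    exact this.symm

end Configuration

/-! ### Momentum weights -/

/-- If only `c x` could be positive, or none is and `c x ≠ 0`, then row `x`, with its zero diagonal
entry, is a sum of non-positive terms equal to zero. So `c` vanishes off `x`, and any other row
forces `c x = 0`. -/
theorem exists_two_pos_of_kernel {Λ : Type} [Fintype Λ] [Nontrivial Λ] {c : Λ → ℝ}
    {T : Λ → Λ → ℝ} (hdiag : ∀ x, T x x = 0) (hpos : ∀ x y, x ≠ y → 0 < T x y)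
    (hker : ∀ x, ∑ y, c y * T x y = 0) (hc : c ≠ 0) : ∃ x y, x ≠ y ∧ 0 < c x ∧ 0 < c y := by
  by_contra! hcon
  obtain ⟨x, hx0, hx⟩ : ∃ x, c x ≠ 0 ∧ ∀ y, y ≠ x → c y ≤ 0 := by
    by_cases h : ∃ x, 0 < c x
    · obtain ⟨x, hx⟩ := h
      exact ⟨x, hx.ne', fun y hy => hcon x y hy.symm hx⟩
    · push Not at h
      obtain ⟨x, hx⟩ := Function.ne_iff.mp hc
      exact ⟨x, hx, fun y _ => h y⟩
  have hterm : ∀ y ∈ Finset.univ, c y * T x y ≤ 0 := by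
    intro y _
    by_cases hy : y = x
    · rw [hy, hdiag, mul_zero]
    · exact mul_nonpos_of_nonpos_of_nonneg (hx y hy) (hpos x y (Ne.symm hy)).le
  have hzero : ∀ y, y ≠ x → c y = 0 := by
    intro y hy
    have := (Finset.sum_eq_zero_iff_of_nonpos hterm).mp (hker x) y (Finset.mem_univ _)
    exact (mul_eq_zero.mp this).resolve_right (hpos x y (Ne.symm hy)).ne'
  obtain ⟨y, hy⟩ := exists_ne x
  have h1 := hker y
  rw [Finset.sum_eq_single x (fun b _ hb => by rw [hzero b hb, zero_mul]) (by simp)] at h1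
  exact hx0 ((mul_eq_zero.mp h1).resolve_right (hpos y x hy).ne')

theorem Finset.card_erase_erase_univ {Λ : Type} [Fintype Λ] [DecidableEq Λ] {x y : Λ}
    (h : x ≠ y) : ((Finset.univ.erase x).erase y).card + 2 = Fintype.card Λ := by
  have h1 := Finset.card_erase_add_one
    (Finset.mem_erase.mpr ⟨h.symm, Finset.mem_univ y⟩ : y ∈ Finset.univ.erase x)
  have h2 := Finset.card_erase_add_one (Finset.mem_univ x)
  rw [Finset.card_univ] at h2
  omega

namespace IsMomentumConfig

variable {n k : ℕ} {Λ : Type} [Fintype Λ] [DecidableEq Λ]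
  {lab : Fin n → Option Λ} {ε : Fin n → ℝ} {inf o : Λ} {a : Fin n → ℝ} {z : Λ → Fin k → ℝ}

/-- The zero total momentum is paired with the ray of `x`. -/
theorem sum_weight_mul_lightPairing (h : IsMomentumConfig lab ε inf o a z) (x : Λ) :
    ∑ y, labelWeight lab a y * lightPairing inf z x y = 0 := by
  have : ∀ y, labelWeight lab a y * lightPairing inf z x y =
      lightU ℝ inf x * (labelWeight lab a y * lightV inf z y) +
        lightV inf z x * (labelWeight lab a y * lightU ℝ inf y) -
          z x ⬝ᵥ (labelWeight lab a y • z y) := by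
    intro y
    rw [lightPairing, dotProduct_smul, smul_eq_mul]
    ring
  simp_rw [this]
  rw [Finset.sum_sub_distrib, Finset.sum_add_distrib, ← Finset.mul_sum, ← Finset.mul_sum,
    ← dotProduct_sum, h.sum_u, h.sum_v, h.sum_z]
  simp

theorem exists_two_pos (h : IsMomentumConfig lab ε inf o a z) (hne : inf ≠ o)
    (hc : labelWeight lab a ≠ 0) :
    ∃ x y, x ≠ y ∧ 0 < labelWeight lab a x ∧ 0 < labelWeight lab a y := by
  have : Nontrivial Λ := ⟨inf, o, hne⟩
  exact exists_two_pos_of_kernel (fun x => lightPairing_self h.z_inf x)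
    (fun x y hxy => lightPairing_pos h.z_inf h.injOn hxy) h.sum_weight_mul_lightPairing hc

theorem exists_two_neg (h : IsMomentumConfig lab ε inf o a z) (hne : inf ≠ o)
    (hc : labelWeight lab a ≠ 0) :
    ∃ x y, x ≠ y ∧ labelWeight lab a x < 0 ∧ labelWeight lab a y < 0 := by
  have : Nontrivial Λ := ⟨inf, o, hne⟩
  obtain ⟨x, y, hxy, hx, hy⟩ := exists_two_pos_of_kernel (c := -labelWeight lab a)
    (fun x => lightPairing_self h.z_inf x)
    (fun x y hxy => lightPairing_pos h.z_inf h.injOn hxy) (fun x => by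
      simp only [Pi.neg_apply, neg_mul, Finset.sum_neg_distrib, neg_eq_zero]
      exact h.sum_weight_mul_lightPairing x) (neg_ne_zero.mpr hc)
  exact ⟨x, y, hxy, by simpa using hx, by simpa using hy⟩

/-- The total momentum is determined by the labels other than the two normalized ones. -/
theorem labelWeight_eq_zero (h : IsMomentumConfig lab ε inf o a z) (hne : inf ≠ o)
    (hc : ∀ x, x ≠ inf → x ≠ o → labelWeight lab a x = 0) : labelWeight lab a = 0 := by
  have h1 : labelWeight lab a o = 0 := by
    have := h.sum_u
    rw [Finset.sum_eq_single o] at this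
    · simpa [lightU, hne.symm] using this
    · intro x _ hx
      by_cases hx' : x = inf
      · simp [hx', lightU]
      · rw [hc x hx' hx, zero_mul]
    · simp
  have h2 : ∀ x, x ≠ inf → labelWeight lab a x = 0 := by
    intro x hx
    by_cases hx' : x = o
    · rw [hx', h1]
    · exact hc x hx hx'
  funext x
  by_cases hx : x = inf
  · have := h.sum_v
    rw [Finset.sum_eq_single inf (fun b _ hb => by rw [h2 b hb, zero_mul]) (by simp)] at this
    rw [hx]
    simpa [lightV] using this
  · exact h2 x hx

theorem span_image_erase (h : IsMomentumConfig lab ε inf o a z) :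
    Submodule.span ℝ (Set.range fun x : ((Finset.univ.erase inf).erase o : Finset Λ) => z x) =
      ⊤ := by
  rw [eq_top_iff, ← h.span, Submodule.span_le]
  rintro _ ⟨x, rfl⟩
  by_cases hx : x = inf
  · rw [hx, h.z_inf]; exact Submodule.zero_mem _
  by_cases hx' : x = o
  · rw [hx', h.z_origin]; exact Submodule.zero_mem _
  · exact Submodule.subset_span ⟨⟨x, by simp [hx, hx']⟩, rfl⟩

/-- The points of `inf` and `o` are zero, so the other `card Λ - 2` points span `ℝ^k`. -/
theorem add_two_le_card (h : IsMomentumConfig lab ε inf o a z) (hne : inf ≠ o) :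
    k + 2 ≤ Fintype.card Λ := by
  rw [← Finset.card_erase_erase_univ hne]
  have h1 := finrank_range_le_card (R := ℝ)
    (b := fun x : ((Finset.univ.erase inf).erase o : Finset Λ) => z x)
  rw [Set.finrank, h.span_image_erase, finrank_top, Module.finrank_fin_fun,
    Fintype.card_coe] at h1
  omega

/-- The points away from `inf` and `o` are now a basis, so their weights vanish, and the other two
weights vanish with them. -/
theorem labelWeight_eq_zero_of_card_eq (h : IsMomentumConfig lab ε inf o a z) (hne : inf ≠ o)
    (hcard : k + 2 = Fintype.card Λ) : labelWeight lab a = 0 := by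
  rw [← Finset.card_erase_erase_univ hne] at hcard
  have hli : LinearIndependent ℝ
      (fun x : ((Finset.univ.erase inf).erase o : Finset Λ) => z x) := by
    apply linearIndependent_of_top_le_span_of_card_eq_finrank h.span_image_erase.ge
    rw [Fintype.card_coe, Module.finrank_fin_fun]
    omega
  apply h.labelWeight_eq_zero hne
  intro x hx hx'
  have hsum : ∑ y : ((Finset.univ.erase inf).erase o : Finset Λ), labelWeight lab a y • z y = 0 := by
    rw [Finset.sum_coe_sort _ fun y => labelWeight lab a y • z y, ← h.sum_z]
    apply Finset.sum_subset (Finset.subset_univ _)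
    intro y _ hy
    by_cases hy1 : y = inf
    · rw [hy1, h.z_inf, smul_zero]
    by_cases hy2 : y = o
    · rw [hy2, h.z_origin, smul_zero]
    · exact absurd (by simp [hy1, hy2]) hy
  exact Fintype.linearIndependent_iff.mp hli _ hsum ⟨x, by simp [hx, hx']⟩

/-- `ℝ^0` is a single point, so for `k = 0` there is at most one finite label. This excludes rank
two with more than two parts. -/
theorem pos_of_two_lt_card (h : IsMomentumConfig lab ε inf o a z)
    (hcard : 2 < Fintype.card Λ) : 0 < k := by
  rw [pos_iff_ne_zero]
  rintro rfl
  by_cases hne : inf = o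
  · have := Finset.card_erase_add_one (Finset.mem_univ inf)
    rw [Finset.card_univ] at this
    obtain ⟨x, hx, y, hy, hxy⟩ := Finset.one_lt_card.mp
      (show 1 < (Finset.univ.erase inf).card by omega)
    exact h.injOn x y (Finset.ne_of_mem_erase hx) (Finset.ne_of_mem_erase hy) hxy
      (Subsingleton.elim _ _)
  · have := Finset.card_erase_erase_univ hne
    obtain ⟨x, hx⟩ := Finset.card_pos.mp
      (show 0 < ((Finset.univ.erase inf).erase o).card by omega)
    simp only [Finset.mem_erase, Finset.mem_univ, and_true] at hx
    exact h.injOn x o hx.2 (Ne.symm hne) hx.1 (Subsingleton.elim _ _)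

end IsMomentumConfig

section

variable {n : ℕ} {Λ : Type} [DecidableEq Λ] {lab : Fin n → Option Λ} {a : Fin n → ℝ} {x : Λ}

theorem exists_pos_of_labelWeight_pos (h : 0 < labelWeight lab a x) :
    ∃ i, lab i = some x ∧ 0 < a i := by
  obtain ⟨i, -, hi⟩ := Finset.exists_lt_of_sum_lt (s := Finset.univ) (f := fun _ : Fin n => (0 : ℝ))
    (by simpa [labelWeight] using h)
  split_ifs at hi with h'
  · exact ⟨i, h', hi⟩
  · exact absurd hi (lt_irrefl _)

theorem labelWeight_neg : labelWeight lab (-a) x = -labelWeight lab a x := by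
  simp only [labelWeight, Pi.neg_apply, ← Finset.sum_neg_distrib]
  exact Finset.sum_congr rfl fun i _ => by split_ifs <;> simp

theorem exists_neg_of_labelWeight_neg (h : labelWeight lab a x < 0) :
    ∃ i, lab i = some x ∧ a i < 0 := by
  have : 0 < labelWeight lab (-a) x := by rw [labelWeight_neg]; linarith
  obtain ⟨i, hi, hi'⟩ := exists_pos_of_labelWeight_pos this
  exact ⟨i, hi, by simpa using hi'⟩

theorem exists_pos_of_labelWeight_nonneg (ha : ∀ i, lab i ≠ none → a i ≠ 0)
    (hx : ∃ i, lab i = some x) (h : 0 ≤ labelWeight lab a x) : ∃ i, lab i = some x ∧ 0 < a i := by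
  by_contra! hcon
  obtain ⟨i, hi⟩ := hx
  have hlt : labelWeight lab a x < ∑ _i : Fin n, (0 : ℝ) := by
    refine Finset.sum_lt_sum (fun j _ => ?_) ⟨i, Finset.mem_univ _, ?_⟩
    · split_ifs with hj
      · exact hcon j hj
      · exact le_rfl
    · rw [if_pos hi]
      exact (hcon i hi).lt_of_ne (ha i (by simp [hi]))
  simp at hlt
  linarith

theorem exists_neg_of_labelWeight_nonpos (ha : ∀ i, lab i ≠ none → a i ≠ 0)
    (hx : ∃ i, lab i = some x) (h : labelWeight lab a x ≤ 0) : ∃ i, lab i = some x ∧ a i < 0 := by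
  obtain ⟨i, hi, hi'⟩ := exists_pos_of_labelWeight_nonneg (lab := lab) (a := -a) (x := x)
    (fun i hi => neg_ne_zero.mpr (ha i hi)) hx (by rw [labelWeight_neg]; linarith)
  exact ⟨i, hi, by simpa using hi'⟩

end

/-! ### Dimension bounds from rational families of configurations -/

namespace SpecializesTo

variable {Θ : Type*} {θ : Θ → ℝ}

/-- The values of a rational function depend continuously on the point. -/
theorem continuousAt {f : FractionRing (MvPolynomial Θ ℝ)} {g : (Θ → ℝ) → ℝ}
    (h : ∀ᶠ θ' in nhds θ, SpecializesTo θ' f (g θ')) : ContinuousAt g θ := by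
  obtain ⟨N, D, hD, hfD, -⟩ := h.self_of_nhds
  have hcont : ∀ p : MvPolynomial Θ ℝ, ContinuousAt (fun θ' => MvPolynomial.eval θ' p) θ :=
    fun p => (MvPolynomial.continuous_eval p).continuousAt
  have hev : (fun θ' => MvPolynomial.eval θ' N / MvPolynomial.eval θ' D) =ᶠ[nhds θ] g := by
    filter_upwards [h, (hcont D).eventually_ne hD] with θ' h1 h2
    rw [← h1.mul_eval_eq hfD, mul_div_cancel_right₀ _ h2]
  exact ((hcont N).div (hcont D) hD).congr hev

variable {n k : ℕ} {Λ : Type} [DecidableEq Λ]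
  {lab : Fin n → Option Λ} {inf : Λ} {A : Fin n → FractionRing (MvPolynomial Θ ℝ)}
  {a : Fin n → ℝ} {Z : Λ → Fin k → FractionRing (MvPolynomial Θ ℝ)} {z : Λ → Fin k → ℝ}

theorem dotProduct {V W : Fin k → FractionRing (MvPolynomial Θ ℝ)} {v w : Fin k → ℝ}
    (hV : ∀ t, SpecializesTo θ (V t) (v t)) (hW : ∀ t, SpecializesTo θ (W t) (w t)) :
    SpecializesTo θ (V ⬝ᵥ W) (v ⬝ᵥ w) :=
  sum _ fun t _ => (hV t).mul (hW t)

theorem ite {p : Prop} [Decidable p] {f f' : FractionRing (MvPolynomial Θ ℝ)} {v v' : ℝ}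
    (h : SpecializesTo θ f v) (h' : SpecializesTo θ f' v') :
    SpecializesTo θ (if p then f else f') (if p then v else v') := by
  split_ifs <;> assumption

theorem lightU (x : Λ) :
    SpecializesTo θ (_root_.lightU (FractionRing (MvPolynomial Θ ℝ)) inf x)
      (_root_.lightU ℝ inf x) :=
  zero.ite one

theorem lightV (hZ : ∀ x t, SpecializesTo θ (Z x t) (z x t)) (x : Λ) :
    SpecializesTo θ (_root_.lightV inf Z x) (_root_.lightV inf z x) := by
  have h2 : SpecializesTo θ 2 2 := by simpa [one_add_one_eq_two] using (one (θ := θ)).add one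
  exact one.ite (((dotProduct (hZ x) (hZ x))).div h2 two_ne_zero)

theorem labelWeight (hA : ∀ i, SpecializesTo θ (A i) (a i)) (x : Λ) :
    SpecializesTo θ (_root_.labelWeight lab A x) (_root_.labelWeight lab a x) :=
  sum _ fun i _ => (hA i).ite zero

theorem configMatrix (hA : ∀ i, SpecializesTo θ (A i) (a i))
    (hZ : ∀ x t, SpecializesTo θ (Z x t) (z x t)) (i j : Fin n) :
    SpecializesTo θ (_root_.configMatrix lab inf A Z i j) (_root_.configMatrix lab inf a z i j) := by
  simp only [_root_.configMatrix, of_apply]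
  cases lab i with
  | none => exact zero
  | some x =>
    cases lab j with
    | none => exact zero
    | some y =>
      exact ((hA i).mul (hA j)).mul
        ((((lightU x).mul (lightV hZ y)).add ((lightV hZ x).mul (lightU y))).sub
          (dotProduct (hZ x) (hZ y)))

end SpecializesTo

/-! ### Recovering a normalized configuration from its Gram matrix. -/

section Generation

variable {n k : ℕ} {Λ : Type} [DecidableEq Λ] {𝕂 : Type*} [Field 𝕂] [Algebra ℝ 𝕂]
  {lab : Fin n → Option Λ} {inf o : Λ} {a : Fin n → 𝕂} {z : Λ → Fin k → 𝕂}

/-- The multiples and points of a normalized configuration are obtained from its Gram matrix by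
field operations and square roots. -/
theorem mem_of_configMatrix_mem (L : IntermediateField ℝ 𝕂) (hsq : ∀ x, x ^ 2 ∈ L → x ∈ L)
    (hL : ∀ i j, configMatrix lab inf a z i j ∈ L) (hne : inf ≠ o)
    (hlab : ∀ x, ∃ i, lab i = some x)
    (hloop : ∀ i, lab i = none → a i = 0) (ha : ∀ i, lab i ≠ none → a i ≠ 0)
    {q : Fin n} {κ : Λ} (hq : lab q = some κ) (hκ : κ ≠ inf) (haq : a q = 1)
    (hinf : z inf = 0) (ho : z o = 0) (e : Fin k → Λ) (htri : ∀ i j, i < j → z (e i) j = 0)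
    (hdiag : ∀ i, z (e i) i ≠ 0) : (∀ i, a i ∈ L) ∧ ∀ x t, z x t ∈ L := by
  have : CharZero 𝕂 := charZero_of_injective_algebraMap (algebraMap ℝ 𝕂).injective
  have h2 : (2 : 𝕂) ∈ L := ofNat_mem L 2
  obtain ⟨p, hp⟩ := hlab inf
  have hS : ∀ {i j x y}, lab i = some x → lab j = some y →
      a i * a j * lightPairing inf z x y ∈ L := fun {i j x y} hi hj => by
    rw [← configMatrix_apply hi hj]; exact hL i j
  -- The product with the ray at infinity is `1` and `a q = 1`, so the matrix entry at `i, q` is `a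
  -- i` itself.
  have hap : ∀ i, lab i = some inf → a i ∈ L := by
    intro i hi
    have := hS hi hq
    rwa [haq, mul_one, lightPairing_inf hinf hκ, mul_one] at this
  have haL : ∀ i, a i ∈ L := by
    intro i
    cases hi : lab i with
    | none => rw [hloop i hi]; exact zero_mem L
    | some x =>
      by_cases hx : x = inf
      · exact hap i (hx ▸ hi)
      · have h := hS hp hi
        rw [lightPairing_inf hinf hx, mul_one] at h
        have := L.div_mem h (hap p hp)
        rwa [mul_div_cancel_left₀ _ (ha p (by simp [hp]))] at this
  have hT : ∀ x y, lightPairing inf z x y ∈ L := by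
    intro x y
    obtain ⟨i, hi⟩ := hlab x
    obtain ⟨j, hj⟩ := hlab y
    have := L.div_mem (hS hi hj) (L.mul_mem (haL i) (haL j))
    rwa [mul_div_cancel_left₀ _ (mul_ne_zero (ha i (by simp [hi])) (ha j (by simp [hj])))] at this
  have hD : ∀ x y, x ≠ inf → y ≠ inf → (z x - z y) ⬝ᵥ (z x - z y) ∈ L := by
    intro x y hx hy
    have := L.mul_mem (hT x y) h2
    rwa [lightPairing_of_ne z hx hy, div_mul_cancel₀ _ two_ne_zero] at this
  -- Polarization, with distances to the origin available through the label `o`.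
  have hdot : ∀ x y, z x ⬝ᵥ z y ∈ L := by
    intro x y
    by_cases hx : x = inf
    · rw [hx, hinf, zero_dotProduct]; exact zero_mem L
    by_cases hy : y = inf
    · rw [hy, hinf, dotProduct_zero]; exact zero_mem L
    have h1 := hD x o hx hne.symm
    have h3 := hD y o hy hne.symm
    have h4 := hD x y hx hy
    rw [ho, sub_zero] at h1 h3
    have h5 : z x ⬝ᵥ z y = (z x ⬝ᵥ z x + z y ⬝ᵥ z y - (z x - z y) ⬝ᵥ (z x - z y)) / 2 := by
      simp only [sub_dotProduct, dotProduct_sub, dotProduct_comm (z y) (z x)]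
      ring
    rw [h5]
    exact L.div_mem (L.sub_mem (L.add_mem h1 h3) h4) h2
  refine ⟨haL, fun x t => ?_⟩
  induction t using WellFoundedLT.induction generalizing x with
  | ind t ih =>
    -- In the dot product with the point of `e t`, earlier coordinates are known by induction and
    -- later ones vanish by triangularity. For `x = e t` the remaining term is a square, the only
    -- place where a root is taken.
    have hkey : ∀ x, z x t * z (e t) t ∈ L := by
      intro x
      have h1 := hdot x (e t)
      rw [dotProduct, ← Finset.add_sum_erase _ _ (Finset.mem_univ t)] at h1
      have h3 : ∑ s ∈ Finset.univ.erase t, z x s * z (e t) s ∈ L := by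
        refine sum_mem fun s hs => ?_
        rcases lt_or_gt_of_ne (Finset.ne_of_mem_erase hs) with hlt | hlt
        · exact L.mul_mem (ih s hlt x) (ih s hlt (e t))
        · rw [htri t s hlt, mul_zero]; exact zero_mem L
      simpa using L.sub_mem h1 h3
    have h3 : z (e t) t ∈ L := hsq _ (by rw [sq]; exact hkey (e t))
    have h4 := L.div_mem (hkey x) h3
    rwa [mul_div_cancel_right₀ _ (hdiag t)] at h4

end Generation

/-! ### From rational families of configurations to dimension bounds. -/

section Bounds

variable {n k : ℕ} {Λ : Type} [DecidableEq Λ] {lab : Fin n → Option Λ} {ε : Fin n → ℝ}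
  {inf o : Λ}

/-- The entries of a matrix, as a point of the space of functions on pairs of indices. -/
def matrixEntries (S : Matrix (Fin n) (Fin n) ℝ) : Fin n × Fin n → ℝ := fun p => S p.1 p.2

theorem algDimLE_image_matrixEntries {Θ : Type} [Fintype Θ] {𝒮 : Set (Matrix (Fin n) (Fin n) ℝ)}
    (A : Fin n → FractionRing (MvPolynomial Θ ℝ))
    (Z : Λ → Fin k → FractionRing (MvPolynomial Θ ℝ))
    (h : ∀ S ∈ 𝒮, ∃ (θ : Θ → ℝ) (a : Fin n → ℝ) (z : Λ → Fin k → ℝ),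
      (∀ i, SpecializesTo θ (A i) (a i)) ∧ (∀ x t, SpecializesTo θ (Z x t) (z x t)) ∧
      configMatrix lab inf a z = S) :
    AlgDimLE (matrixEntries '' 𝒮) (Fintype.card Θ) := by
  apply algDimLE_of_specializesTo fun p : Fin n × Fin n => configMatrix lab inf A Z p.1 p.2
  rintro _ ⟨S, hS, rfl⟩
  obtain ⟨θ, a, z, hA, hZ, rfl⟩ := h S hS
  exact ⟨θ, fun p => SpecializesTo.configMatrix hA hZ p.1 p.2⟩

variable [Fintype Λ]

/-- Being a momentum configuration is an open condition, given the equations. -/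
theorem IsMomentumConfig.eventually {X : Type*} [TopologicalSpace X] {θ₀ : X}
    {a : X → Fin n → ℝ} {z : X → Λ → Fin k → ℝ}
    (h₀ : IsMomentumConfig lab ε inf o (a θ₀) (z θ₀))
    (ha : ∀ i, ContinuousAt (fun θ => a θ i) θ₀) (hz : ∀ x t, ContinuousAt (fun θ => z θ x t) θ₀)
    {e : Fin k → Λ} (he : LinearIndependent ℝ (z θ₀ ∘ e))
    (heq : ∀ᶠ θ in nhds θ₀, (∀ i, lab i = none → a θ i = 0) ∧ z θ inf = 0 ∧ z θ o = 0 ∧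
      ∑ x, labelWeight lab (a θ) x * lightU ℝ inf x = 0 ∧
      ∑ x, labelWeight lab (a θ) x * lightV inf (z θ) x = 0 ∧
      ∑ x, labelWeight lab (a θ) x • z θ x = 0) :
    ∀ᶠ θ in nhds θ₀, IsMomentumConfig lab ε inf o (a θ) (z θ) := by
  have hsign : ∀ᶠ θ in nhds θ₀, ∀ i j, lab i ≠ none → lab j ≠ none →
      0 < ε i * ε j * (a θ i * a θ j) := by
    simp only [Filter.eventually_all]
    intro i j hi hj
    exact (continuousAt_const.mul ((ha i).mul (ha j))).eventually (lt_mem_nhds (h₀.signs i j hi hj))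
  have hinj : ∀ᶠ θ in nhds θ₀, ∀ x y, x ≠ inf → y ≠ inf → x ≠ y → z θ x ≠ z θ y := by
    simp only [Filter.eventually_all]
    intro x y hx hy hxy
    have hcx : ∀ x, ContinuousAt (fun θ => z θ x) θ₀ := fun x => continuousAt_pi.mpr (hz x)
    exact (((hcx x).sub (hcx y)).eventually_ne (sub_ne_zero.mpr (h₀.injOn x y hx hy hxy))).mono
      fun θ h => sub_ne_zero.mp h
  have hspan : ∀ᶠ θ in nhds θ₀, Submodule.span ℝ (Set.range (z θ)) = ⊤ := by
    -- Spanning becomes an open condition through one non-zero determinant.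
    have hdet : ∀ᶠ θ in nhds θ₀, (Matrix.of fun i j => z θ (e i) j).det ≠ 0 := by
      have hc : ContinuousAt (fun θ => (Matrix.of fun i j => z θ (e i) j).det) θ₀ := by
        simp only [Matrix.det_apply, Matrix.of_apply]
        exact tendsto_finsetSum _ fun σ _ =>
          (tendsto_finsetProd _ fun i _ => hz (e (σ i)) i).const_smul _
      refine hc.eventually_ne ?_
      have hu := Matrix.linearIndependent_rows_iff_isUnit.mp
        (show LinearIndependent ℝ (Matrix.of fun i j => z θ₀ (e i) j).row from he)
      exact ((Matrix.isUnit_iff_isUnit_det _).mp hu).ne_zero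
    filter_upwards [hdet] with θ hθ
    have hu : IsUnit (Matrix.of fun i j => z θ (e i) j) :=
      (Matrix.isUnit_iff_isUnit_det _).mpr hθ.isUnit
    have hli : LinearIndependent ℝ (z θ ∘ e) := Matrix.linearIndependent_rows_iff_isUnit.mpr hu
    rw [eq_top_iff, ← hli.span_eq_top_of_card_eq_finrank' (by simp)]
    exact Submodule.span_mono (Set.range_comp_subset_range _ _)
  filter_upwards [hsign, hinj, hspan, heq] with θ h1 h2 h3 ⟨h4, h5, h6, h7, h8, h9⟩
  exact ⟨h4, h1, h5, h6, h2, h3, h7, h8, h9⟩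

/-- The equations hold along the family and the remaining conditions are open, so a neighbourhood of
`θ₀` maps into `𝒮`. Each parameter is a multiple or a coordinate of the generic member, hence is
recovered from its Gram matrix by `mem_of_configMatrix_mem`. -/
theorem card_le_of_family {Θ : Type} [Fintype Θ] {𝒮 : Set (Matrix (Fin n) (Fin n) ℝ)}
    (A : Fin n → FractionRing (MvPolynomial Θ ℝ))
    (Z : Λ → Fin k → FractionRing (MvPolynomial Θ ℝ))
    (a : (Θ → ℝ) → Fin n → ℝ) (z : (Θ → ℝ) → Λ → Fin k → ℝ) (θ₀ : Θ → ℝ)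
    (hA : ∀ᶠ θ in nhds θ₀, ∀ i, SpecializesTo θ (A i) (a θ i))
    (hZ : ∀ᶠ θ in nhds θ₀, ∀ x t, SpecializesTo θ (Z x t) (z θ x t))
    (h₀ : IsMomentumConfig lab ε inf o (a θ₀) (z θ₀)) (hne : inf ≠ o)
    (hlab : ∀ x, ∃ i, lab i = some x)
    (heq : ∀ᶠ θ in nhds θ₀, (∀ i, lab i = none → a θ i = 0) ∧ z θ inf = 0 ∧ z θ o = 0 ∧
      ∑ x, labelWeight lab (a θ) x * lightU ℝ inf x = 0 ∧
      ∑ x, labelWeight lab (a θ) x * lightV inf (z θ) x = 0 ∧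
      ∑ x, labelWeight lab (a θ) x • z θ x = 0)
    {e : Fin k → Λ} (he : LinearIndependent ℝ (z θ₀ ∘ e))
    (hloop : ∀ i, lab i = none → A i = 0) {q : Fin n} {κ : Λ} (hq : lab q = some κ) (hκ : κ ≠ inf)
    (hAq : A q = 1) (hinf : Z inf = 0) (ho : Z o = 0) (htri : ∀ i j, i < j → Z (e i) j = 0)
    (hcoord : ∀ j, (∃ i, A i = algebraMap (MvPolynomial Θ ℝ) _ (MvPolynomial.X j)) ∨
      ∃ x t, Z x t = algebraMap (MvPolynomial Θ ℝ) _ (MvPolynomial.X j))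
    (h𝒮 : ∀ (a : Fin n → ℝ) (z : Λ → Fin k → ℝ), IsMomentumConfig lab ε inf o a z → configMatrix lab inf a z ∈ 𝒮)
    {d : ℕ} (hd : semialgebraicDim (matrixEntries '' 𝒮) = d) : Fintype.card Θ ≤ d := by
  have hev := h₀.eventually (fun i => SpecializesTo.continuousAt (hA.mono fun θ h => h i))
    (fun x t => SpecializesTo.continuousAt (hZ.mono fun θ h => h x t)) he heq
  have hA₀ := hA.self_of_nhds
  have hZ₀ := hZ.self_of_nhds
  have htri₀ : ∀ i j, i < j → z θ₀ (e i) j = 0 := by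
    intro i j hij
    by_contra h
    exact (hZ₀ (e i) j).ne_zero h (htri i j hij)
  -- A triangular invertible matrix has non-zero diagonal; non-vanishing at `θ₀` then passes to the
  -- generic coordinates.
  have hdiag₀ : ∀ i, z θ₀ (e i) i ≠ 0 := by
    have hu := Matrix.linearIndependent_rows_iff_isUnit.mp
      (show LinearIndependent ℝ (Matrix.of fun i j => z θ₀ (e i) j).row from he)
    have hdet := ((Matrix.isUnit_iff_isUnit_det _).mp hu).ne_zero
    rw [Matrix.det_of_isLowerTriangular
      (Matrix.of fun i j => z θ₀ (e i) j) fun i j hij => htri₀ i j hij] at hdet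
    exact fun i => Finset.prod_ne_zero_iff.mp hdet i (Finset.mem_univ i)
  refine card_le_of_eventually_specializesTo
    (fun p : Fin n × Fin n => configMatrix lab inf A Z p.1 p.2) θ₀ ?_ ?_ hd
  · filter_upwards [hev, hA, hZ] with θ h1 h2 h3
    exact ⟨_, ⟨_, h𝒮 _ _ h1, rfl⟩, fun p => SpecializesTo.configMatrix h2 h3 p.1 p.2⟩
  · intro L hsq hL j
    obtain ⟨h1, h2⟩ := mem_of_configMatrix_mem L hsq (fun i j => hL (i, j)) hne hlab hloop
      (fun i hi => (hA₀ i).ne_zero (h₀.ne_zero hi)) hq hκ hAq hinf ho e htri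
      (fun i => (hZ₀ _ _).ne_zero (hdiag₀ i))
    rcases hcoord j with ⟨i, hi⟩ | ⟨x, t, hi⟩
    · exact hi ▸ h1 i
    · exact hi ▸ h2 x t

end Bounds

/-! ### Rational charts on the space of configurations -/

theorem Fin.card_filter_lt_pairs (k : ℕ) :
    (Finset.univ.filter fun p : Fin k × Fin k => p.1 < p.2).card = k.choose 2 := by
  have h1 : (Finset.univ.filter fun p : Fin k × Fin k => p.1 < p.2).card =
      ∑ t : Fin k, (t : ℕ) := by
    rw [Finset.card_filter, ← Finset.univ_product_univ, Finset.sum_product_right]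
    refine Finset.sum_congr rfl fun t _ => ?_
    rw [← Finset.card_filter, Finset.filter_gt_eq_Iio, Fin.card_Iio]
  rw [h1, Fin.sum_univ_eq_sum_range (fun i => i) k, Finset.sum_range_id, Nat.choose_two_right]

section LabelWeight

variable {n : ℕ} {Λ : Type} [DecidableEq Λ] {𝕂 : Type*} [Field 𝕂] {lab : Fin n → Option Λ}

theorem labelWeight_add (a b : Fin n → 𝕂) (x : Λ) :
    labelWeight lab (a + b) x = labelWeight lab a x + labelWeight lab b x := by
  simp only [labelWeight, ← Finset.sum_add_distrib, Pi.add_apply]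
  exact Finset.sum_congr rfl fun i _ => by split_ifs <;> simp

theorem labelWeight_sub (a b : Fin n → 𝕂) (x : Λ) :
    labelWeight lab (a - b) x = labelWeight lab a x - labelWeight lab b x := by
  simp only [labelWeight, ← Finset.sum_sub_distrib, Pi.sub_apply]
  exact Finset.sum_congr rfl fun i _ => by split_ifs <;> simp

theorem labelWeight_single (i : Fin n) (α : 𝕂) (x : Λ) :
    labelWeight lab (Pi.single i α) x = if lab i = some x then α else 0 := by
  rw [labelWeight, Finset.sum_eq_single i]
  · simp
  · intro j _ hj; simp [Pi.single_eq_of_ne hj]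
  · simp

theorem labelWeight_sum_single [Fintype Λ] {rep : Λ → Fin n} (hrep : ∀ x, lab (rep x) = some x)
    (c : Λ → 𝕂) (x : Λ) : labelWeight lab (fun i => ∑ y, if i = rep y then c y else 0) x = c x := by
  have h1 : ∀ i, (if lab i = some x then ∑ y, (if i = rep y then c y else 0) else 0) =
      if i = rep x then c x else 0 := by
    intro i
    split_ifs with h1 h2 h2
    · rw [Finset.sum_eq_single x]
      · simp [h2]
      · intro y _ hy
        rw [if_neg]
        rintro rfl
        rw [hrep] at h1
        exact hy (Option.some_injective _ h1)
      · simp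
    · refine Finset.sum_eq_zero fun y _ => if_neg ?_
      rintro rfl
      rw [hrep] at h1
      exact h2 (by rw [Option.some_injective _ h1])
    · exact absurd (h2 ▸ hrep x) h1
    · rfl
  simp_rw [labelWeight, h1]
  simp

end LabelWeight

/-! ### Parameter spaces of charts. -/

section Parameters

variable {n k : ℕ} {Λ : Type} [DecidableEq Λ]

/-- Parameters of a chart: free multiples for the indices in `I`, and free coordinates of the points
with labels in `J`, where the points labelled by `e` have a triangular coordinate matrix. -/
def freeParams (I : Finset (Fin n)) (J : Finset Λ) (e : Fin k → Λ) :
    Finset (Fin n ⊕ Λ × Fin k) :=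
  I.disjSum ((J ×ˢ Finset.univ).filter fun p => ∀ j, e j = p.1 → p.2 ≤ j)

variable {I : Finset (Fin n)} {J : Finset Λ} {e : Fin k → Λ}

theorem inl_mem_freeParams {i : Fin n} : Sum.inl i ∈ freeParams I J e ↔ i ∈ I := by
  simp [freeParams]

theorem inr_mem_freeParams {x : Λ} {t : Fin k} :
    Sum.inr (x, t) ∈ freeParams I J e ↔ x ∈ J ∧ ∀ j, e j = x → t ≤ j := by
  simp [freeParams]

/-- Triangularity removes coordinate `t` of the point `e j` exactly for the pairs `j < t`. -/
theorem card_freeParams (he : Function.Injective e) (heJ : ∀ j, e j ∈ J) :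
    (freeParams I J e).card + k.choose 2 = I.card + J.card * k := by
  rw [freeParams, Finset.card_disjSum, add_assoc]
  congr 1
  have h1 := Finset.card_filter_add_card_filter_not (s := J ×ˢ (Finset.univ : Finset (Fin k)))
    (fun p => ∀ j, e j = p.1 → p.2 ≤ j)
  rw [Finset.card_product, Finset.card_univ, Fintype.card_fin] at h1
  rw [← h1, ← Fin.card_filter_lt_pairs]
  congr 1
  refine Finset.card_bij (fun p _ => (e p.1, p.2)) ?_ ?_ ?_
  · rintro ⟨j, t⟩ h
    simp only [Finset.mem_filter, Finset.mem_univ, true_and] at h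
    simp only [Finset.mem_filter, Finset.mem_product, heJ, Finset.mem_univ, true_and, not_forall]
    exact ⟨j, rfl, not_le.mpr h⟩
  · rintro ⟨j, t⟩ _ ⟨j', t'⟩ _ h
    simp only [Prod.mk.injEq] at h
    rw [he h.1, h.2]
  · rintro ⟨x, t⟩ h
    simp only [Finset.mem_filter, Finset.mem_product, Finset.mem_univ, and_true, not_forall] at h
    obtain ⟨-, j, rfl, hj⟩ := h
    exact ⟨(j, t), by simpa using hj, rfl⟩

/-- Values of parameters, extended by zero. -/
def extendParams {P 𝕂 : Type*} [DecidableEq P] [Zero 𝕂] {s : Finset P} (θ : s → 𝕂) (p : P) : 𝕂 :=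
  if h : p ∈ s then θ ⟨p, h⟩ else 0

variable {𝕂 : Type*} [Field 𝕂]

/-- The multiples read off from the parameters, with the multiple of `q` normalized to `1`. -/
def baseMult (q : Fin n) (θ : freeParams I J e → 𝕂) (i : Fin n) : 𝕂 :=
  if i = q then 1 else extendParams θ (Sum.inl i)

/-- The points read off from the parameters. -/
def basePoint (θ : freeParams I J e → 𝕂) (x : Λ) (t : Fin k) : 𝕂 :=
  extendParams θ (Sum.inr (x, t))

theorem baseMult_eq_zero {q i : Fin n} (θ : freeParams I J e → 𝕂) (hq : i ≠ q) (hi : i ∉ I) :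
    baseMult q θ i = 0 := by
  rw [baseMult, if_neg hq, extendParams, dif_neg (by rwa [inl_mem_freeParams])]

theorem basePoint_eq_zero {x : Λ} (θ : freeParams I J e → 𝕂) (hx : x ∉ J) :
    basePoint θ x = 0 := by
  funext t
  rw [basePoint, extendParams, dif_neg (by rw [inr_mem_freeParams]; exact fun h => hx h.1)]
  rfl

theorem basePoint_triangular (θ : freeParams I J e → 𝕂) {i j : Fin k} (hij : i < j) :
    basePoint θ (e i) j = 0 := by
  rw [basePoint, extendParams, dif_neg]
  rw [inr_mem_freeParams]
  exact fun h => (h.2 i rfl).not_gt hij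

/-- The parameters of a given configuration. -/
def paramsOf (I : Finset (Fin n)) (J : Finset Λ) (e : Fin k → Λ) (a : Fin n → 𝕂)
    (z : Λ → Fin k → 𝕂) (p : freeParams I J e) : 𝕂 :=
  Sum.elim a (fun p => z p.1 p.2) p.1

theorem baseMult_paramsOf {q i : Fin n} {a : Fin n → 𝕂} (z : Λ → Fin k → 𝕂) (hq : a q = 1)
    (hi : i = q ∨ i ∈ I) : baseMult q (paramsOf I J e a z) i = a i := by
  by_cases h : i = q
  · rw [baseMult, if_pos h, h, hq]
  · have hi' := hi.resolve_left h
    rw [baseMult, if_neg h, extendParams, dif_pos (by rwa [inl_mem_freeParams])]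
    rfl

theorem basePoint_paramsOf (a : Fin n → 𝕂) {z : Λ → Fin k → 𝕂}
    (htri : ∀ i j, i < j → z (e i) j = 0) {x : Λ} (hx : x ∈ J) :
    basePoint (paramsOf I J e a z) x = z x := by
  funext t
  by_cases h : ∀ j, e j = x → t ≤ j
  · rw [basePoint, extendParams, dif_pos (by rw [inr_mem_freeParams]; exact ⟨hx, h⟩)]
    rfl
  · rw [basePoint, extendParams, dif_neg (by rw [inr_mem_freeParams]; exact fun h' => h h'.2)]
    push Not at h
    obtain ⟨j, rfl, hj⟩ := h
    exact (htri j t hj).symm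

/-- The generic point of a parameter space. -/
noncomputable def genericParams (s : Finset (Fin n ⊕ Λ × Fin k)) (j : s) :
    FractionRing (MvPolynomial s ℝ) :=
  algebraMap (MvPolynomial s ℝ) _ (MvPolynomial.X j)

theorem specializesTo_genericParams {s : Finset (Fin n ⊕ Λ × Fin k)} (θ : s → ℝ) (j : s) :
    SpecializesTo θ (genericParams s j) (θ j) := by
  simpa [genericParams] using SpecializesTo.of_polynomial (θ := θ) (MvPolynomial.X j)

theorem specializesTo_extendParams {s : Finset (Fin n ⊕ Λ × Fin k)} (θ : s → ℝ)
    (p : Fin n ⊕ Λ × Fin k) :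
    SpecializesTo θ (extendParams (genericParams s) p) (extendParams θ p) := by
  unfold extendParams
  split_ifs with h
  · exact specializesTo_genericParams θ _
  · exact SpecializesTo.zero

theorem specializesTo_baseMult (q : Fin n) (θ : freeParams I J e → ℝ) (i : Fin n) :
    SpecializesTo θ (baseMult q (genericParams (freeParams I J e)) i) (baseMult q θ i) :=
  SpecializesTo.one.ite (specializesTo_extendParams θ _)

theorem specializesTo_basePoint (θ : freeParams I J e → ℝ) (x : Λ) (t : Fin k) :
    SpecializesTo θ (basePoint (genericParams (freeParams I J e)) x t) (basePoint θ x t) :=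
  specializesTo_extendParams θ _

theorem genericParams_eq_baseMult_or_basePoint {q : Fin n} (hq : q ∉ I) (j : freeParams I J e) :
    (∃ i ∈ I, baseMult q (genericParams (freeParams I J e)) i =
        genericParams (freeParams I J e) j) ∨
      ∃ x ∈ J, ∃ t, basePoint (genericParams (freeParams I J e)) x t =
        genericParams (freeParams I J e) j := by
  obtain ⟨i | ⟨x, t⟩, hj⟩ := j
  · have hi := inl_mem_freeParams.mp hj
    refine Or.inl ⟨i, hi, ?_⟩
    rw [baseMult, if_neg (fun h : i = q => hq (h ▸ hi)), extendParams, dif_pos hj]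
  · refine Or.inr ⟨x, (inr_mem_freeParams.mp hj).1, t, ?_⟩
    rw [basePoint, extendParams, dif_pos hj]

end Parameters

/-! ### Solving momentum conservation rationally. -/

section Charts

variable {n k : ℕ} {Λ : Type} [Fintype Λ] [DecidableEq Λ] {𝕂 : Type*} [Field 𝕂]
  {lab : Fin n → Option Λ} {inf o κ : Λ}

/-- Solve the momentum equation for the point with label `κ`. -/
def solvePoint (lab : Fin n → Option Λ) (κ : Λ) (a : Fin n → 𝕂) (z : Λ → Fin k → 𝕂) :
    Λ → Fin k → 𝕂 :=
  z + Pi.single κ (-(labelWeight lab a κ)⁻¹ • ∑ y, labelWeight lab a y • z y)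

/-- Solve the momentum equation for the multiples of `p` at infinity and `p'` at the origin. -/
def solveMult (lab : Fin n → Option Λ) (inf : Λ) (p p' : Fin n) (a : Fin n → 𝕂)
    (z : Λ → Fin k → 𝕂) : Fin n → 𝕂 :=
  a + Pi.single p' (-∑ y, labelWeight lab a y * lightU 𝕂 inf y) +
    Pi.single p (-∑ y, labelWeight lab a y * lightV inf z y)

/-- Subtract from the representative of each label the total weight of the label. -/
def balanceMult (lab : Fin n → Option Λ) (rep : Λ → Fin n) (a : Fin n → 𝕂) : Fin n → 𝕂 :=
  a - fun i => ∑ y, if i = rep y then labelWeight lab a y else 0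

theorem labelWeight_balanceMult {rep : Λ → Fin n} (hrep : ∀ x, lab (rep x) = some x)
    (a : Fin n → 𝕂) (x : Λ) : labelWeight lab (balanceMult lab rep a) x = 0 := by
  rw [balanceMult, labelWeight_sub, labelWeight_sum_single hrep, sub_self]

theorem balanceMult_apply_of_ne {rep : Λ → Fin n} (a : Fin n → 𝕂) {i : Fin n}
    (hi : ∀ x, i ≠ rep x) : balanceMult lab rep a i = a i := by
  simp [balanceMult, hi]

/-- Clearing balanced multiples at the representatives leaves weight `-a (rep x)` at each label `x`,
which balancing puts back. -/
theorem balanceMult_eq {rep : Λ → Fin n} (hrep : ∀ x, lab (rep x) = some x) {a a₀ : Fin n → 𝕂}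
    (hc : ∀ x, labelWeight lab a x = 0) (h₀ : ∀ x, a₀ (rep x) = 0)
    (h : ∀ i, (∀ x, i ≠ rep x) → a₀ i = a i) : balanceMult lab rep a₀ = a := by
  have hinj : Function.Injective rep := fun x y hxy =>
    Option.some_injective _ (by rw [← hrep x, ← hrep y, hxy])
  have hsum : ∀ x, (∑ y, if rep x = rep y then a (rep y) else 0) = a (rep x) := by
    intro x
    rw [Finset.sum_eq_single x]
    · simp
    · intro y _ hy
      exact if_neg fun hxy => hy (hinj hxy).symm
    · simp
  have h1 : a₀ = a - fun i => ∑ y, if i = rep y then a (rep y) else 0 := by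
    funext i
    by_cases hi : ∃ x, i = rep x
    · obtain ⟨x, rfl⟩ := hi
      rw [h₀, Pi.sub_apply, hsum, sub_self]
    · push Not at hi
      simp [h i hi, hi]
  have h2 : ∀ x, labelWeight lab a₀ x = -a (rep x) := by
    intro x
    rw [h1, labelWeight_sub, hc, labelWeight_sum_single hrep, zero_sub]
  funext i
  rw [balanceMult, Pi.sub_apply]
  by_cases hi : ∃ x, i = rep x
  · obtain ⟨x, rfl⟩ := hi
    have h3 := hsum x
    simp_rw [h2]
    rw [h₀, zero_sub, ← Finset.sum_neg_distrib, ← h3]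
    exact Finset.sum_congr rfl fun y _ => by split_ifs <;> simp
  · push Not at hi
    simp [h i hi, hi]

theorem labelWeight_solveMult {p p' : Fin n} (hp : lab p = some inf) (hp' : lab p' = some o)
    (a : Fin n → 𝕂) (z : Λ → Fin k → 𝕂) (x : Λ) :
    labelWeight lab (solveMult lab inf p p' a z) x = labelWeight lab a x +
      (if x = o then -∑ y, labelWeight lab a y * lightU 𝕂 inf y else 0) +
      (if x = inf then -∑ y, labelWeight lab a y * lightV inf z y else 0) := by
  rw [solveMult, labelWeight_add, labelWeight_add, labelWeight_single, labelWeight_single, hp, hp']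
  simp [eq_comm]

/-- The system is triangular. Labels `inf` and `o` do not enter the equation for the points, which
is solved by the point of `κ`. The `u` equation is then corrected at the origin and the `v` equation
at infinity; neither correction disturbs the other equations. -/
theorem solve_momentum {p p' : Fin n} (hne : inf ≠ o) (hκinf : κ ≠ inf) (hκo : κ ≠ o)
    (hp : lab p = some inf) (hp' : lab p' = some o) {a : Fin n → 𝕂} {z : Λ → Fin k → 𝕂}
    (hinf : z inf = 0) (ho : z o = 0) (hκ : z κ = 0) (hc : labelWeight lab a κ ≠ 0) :
    (∑ x, labelWeight lab (solveMult lab inf p p' a (solvePoint lab κ a z)) x *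
        lightU 𝕂 inf x = 0) ∧
      (∑ x, labelWeight lab (solveMult lab inf p p' a (solvePoint lab κ a z)) x *
        lightV inf (solvePoint lab κ a z) x = 0) ∧
      ∑ x, labelWeight lab (solveMult lab inf p p' a (solvePoint lab κ a z)) x •
        solvePoint lab κ a z x = 0 := by
  have hzinf : solvePoint lab κ a z inf = 0 := by
    simp [solvePoint, hinf, Pi.single_eq_of_ne hκinf.symm]
  have hzo : solvePoint lab κ a z o = 0 := by
    simp [solvePoint, ho, Pi.single_eq_of_ne hκo.symm]
  have hzsum : ∑ y, labelWeight lab a y • solvePoint lab κ a z y = 0 := by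
    have h1 : ∀ y, labelWeight lab a y • solvePoint lab κ a z y = labelWeight lab a y • z y +
        if y = κ then -∑ y, labelWeight lab a y • z y else 0 := by
      intro y
      rw [solvePoint, Pi.add_apply, smul_add]
      congr 1
      by_cases hy : y = κ
      · subst hy
        simp [smul_smul, hc]
      · simp [hy]
    simp_rw [h1]
    rw [Finset.sum_add_distrib]
    simp
  simp_rw [labelWeight_solveMult hp hp']
  refine ⟨?_, ?_, ?_⟩
  · simp only [add_mul, ite_mul, zero_mul, Finset.sum_add_distrib, Finset.sum_ite_eq',
      Finset.mem_univ, if_true]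
    simp [lightU, hne.symm]
  · simp only [add_mul, ite_mul, zero_mul, Finset.sum_add_distrib, Finset.sum_ite_eq',
      Finset.mem_univ, if_true]
    simp [lightV, hne.symm, hzo]
  · simp only [add_smul, ite_smul, zero_smul, Finset.sum_add_distrib, Finset.sum_ite_eq',
      Finset.mem_univ, if_true]
    simp [hzinf, hzo, hzsum]

/-- The three solved quantities are the only solution, so a configuration is recovered from its data
with these three erased. -/
theorem solve_eq {p p' : Fin n} (hne : inf ≠ o) (hκinf : κ ≠ inf) (hκo : κ ≠ o)
    (hp : lab p = some inf) (hp' : lab p' = some o) {a a₀ : Fin n → 𝕂} {z z₀ : Λ → Fin k → 𝕂}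
    (hinf : z inf = 0) (ho : z o = 0) (hc : labelWeight lab a κ ≠ 0)
    (hu : ∑ x, labelWeight lab a x * lightU 𝕂 inf x = 0)
    (hv : ∑ x, labelWeight lab a x * lightV inf z x = 0)
    (hz : ∑ x, labelWeight lab a x • z x = 0)
    (ha₀ : ∀ i, i ≠ p → i ≠ p' → a₀ i = a i) (hp₀ : a₀ p = 0) (hp₀' : a₀ p' = 0)
    (hz₀ : ∀ x, x ≠ κ → z₀ x = z x) (hκ₀ : z₀ κ = 0) :
    solvePoint lab κ a₀ z₀ = z ∧ solveMult lab inf p p' a₀ z = a ∧ labelWeight lab a₀ κ ≠ 0 := by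
  have hpp' : p ≠ p' := by
    rintro rfl
    exact hne (Option.some_injective _ (hp.symm.trans hp'))
  have ha : a = a₀ + Pi.single p' (a p') + Pi.single p (a p) := by
    funext i
    by_cases h1 : i = p
    · subst h1; simp [hp₀, hpp']
    by_cases h2 : i = p'
    · subst h2; simp [hp₀', h1]
    simp [ha₀ i h1 h2, h1, h2]
  have hw : ∀ x, labelWeight lab a x = labelWeight lab a₀ x +
      (if x = o then a p' else 0) + (if x = inf then a p else 0) := by
    intro x
    conv_lhs => rw [ha]
    rw [labelWeight_add, labelWeight_add, labelWeight_single, labelWeight_single, hp, hp']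
    simp [eq_comm]
  have hwκ : labelWeight lab a κ = labelWeight lab a₀ κ := by simp [hw κ, hκinf, hκo]
  have hzz : z = z₀ + Pi.single κ (z κ) := by
    funext x
    by_cases h1 : x = κ
    · subst h1; simp [hκ₀]
    · simp [hz₀ x h1, h1]
  have hpt : solvePoint lab κ a₀ z₀ = z := by
    have h1 : ∑ y, labelWeight lab a₀ y • z y = 0 := by
      simp_rw [hw] at hz
      simp only [add_smul, ite_smul, zero_smul, Finset.sum_add_distrib, Finset.sum_ite_eq',
        Finset.mem_univ, if_true, hinf, ho, smul_zero, add_zero] at hz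
      exact hz
    have h2 : ∑ y, labelWeight lab a₀ y • z₀ y = -(labelWeight lab a₀ κ • z κ) := by
      rw [eq_neg_iff_add_eq_zero, ← h1]
      rw [← Finset.sum_erase_add _ _ (Finset.mem_univ κ),
        ← Finset.sum_erase_add _ _ (Finset.mem_univ κ), hκ₀, smul_zero, add_zero]
      congr 1
      exact Finset.sum_congr rfl fun y hy => by rw [hz₀ y (Finset.ne_of_mem_erase hy)]
    rw [solvePoint, h2, smul_neg, neg_smul, neg_neg, smul_smul, inv_mul_cancel₀ (hwκ ▸ hc),
      one_smul, ← hzz]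
  refine ⟨hpt, ?_, hwκ ▸ hc⟩
  rw [solveMult]
  conv_rhs => rw [ha]
  congr 3
  · simp_rw [hw] at hu
    simp only [add_mul, ite_mul, zero_mul, Finset.sum_add_distrib, Finset.sum_ite_eq',
      Finset.mem_univ, if_true] at hu
    simp only [lightU, hne.symm, if_true, if_false, mul_zero, mul_one, add_zero] at hu ⊢
    linear_combination -hu
  · simp_rw [hw] at hv
    simp only [add_mul, ite_mul, zero_mul, Finset.sum_add_distrib, Finset.sum_ite_eq',
      Finset.mem_univ, if_true] at hv
    have h1 : lightV inf z o = 0 := by simp [lightV, hne.symm, ho]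
    have h2 : lightV inf z inf = 1 := by simp [lightV]
    rw [h1, h2] at hv
    linear_combination -hv

end Charts

/-! ### Dimension bounds -/

namespace SpecializesTo

variable {Θ : Type*} {θ : Θ → ℝ} {n k : ℕ} {Λ : Type} [Fintype Λ] [DecidableEq Λ]
  {lab : Fin n → Option Λ} {inf κ : Λ} {A : Fin n → FractionRing (MvPolynomial Θ ℝ)}
  {a : Fin n → ℝ} {Z : Λ → Fin k → FractionRing (MvPolynomial Θ ℝ)} {z : Λ → Fin k → ℝ}

theorem piSingle {f : FractionRing (MvPolynomial Θ ℝ)} {v : ℝ} (h : SpecializesTo θ f v)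
    (i j : Fin n) : SpecializesTo θ ((Pi.single i f : Fin n → _) j) ((Pi.single i v : Fin n → ℝ) j) := by
  simp only [Pi.single_apply]
  exact h.ite zero

theorem solvePoint (hA : ∀ i, SpecializesTo θ (A i) (a i))
    (hZ : ∀ x t, SpecializesTo θ (Z x t) (z x t)) (hc : _root_.labelWeight lab a κ ≠ 0) (x : Λ)
    (t : Fin k) :
    SpecializesTo θ (_root_.solvePoint lab κ A Z x t) (_root_.solvePoint lab κ a z x t) := by
  simp only [_root_.solvePoint, Pi.add_apply, Pi.single_apply, ite_apply, Pi.smul_apply,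
    Finset.sum_apply, Pi.zero_apply, smul_eq_mul]
  exact (hZ x t).add ((((labelWeight hA κ).inv hc).neg.mul
    (sum _ fun y _ => (labelWeight hA y).mul (hZ y t))).ite zero)

theorem solveMult (hA : ∀ i, SpecializesTo θ (A i) (a i))
    (hZ : ∀ x t, SpecializesTo θ (Z x t) (z x t)) (p p' i : Fin n) :
    SpecializesTo θ (_root_.solveMult lab inf p p' A Z i) (_root_.solveMult lab inf p p' a z i) :=
  ((hA i).add ((sum _ fun y _ => (labelWeight hA y).mul (lightU y)).neg.piSingle p' i)).add
    ((sum _ fun y _ => (labelWeight hA y).mul (lightV hZ y)).neg.piSingle p i)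

theorem balanceMult (hA : ∀ i, SpecializesTo θ (A i) (a i)) (rep : Λ → Fin n) (i : Fin n) :
    SpecializesTo θ (_root_.balanceMult lab rep A i) (_root_.balanceMult lab rep a i) :=
  (hA i).sub (sum _ fun y _ => (labelWeight hA y).ite zero)

end SpecializesTo

/-! ### The chart with a non-zero weight. -/

section SolveChart

variable {n k : ℕ} {Λ : Type} [Fintype Λ] [DecidableEq Λ] {lab : Fin n → Option Λ} {ε : Fin n → ℝ}
  {inf o κ : Λ} {p p' q : Fin n} {e : Fin k → Λ}

/-- The indices with free multiples in a chart with non-zero weight. -/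
def solveIndices (lab : Fin n → Option Λ) (p p' q : Fin n) : Finset (Fin n) :=
  Finset.univ.filter fun i => lab i ≠ none ∧ i ≠ p ∧ i ≠ p' ∧ i ≠ q

/-- The labels with free points in a chart with non-zero weight. -/
def solveLabels (inf o κ : Λ) : Finset Λ :=
  Finset.univ.filter fun x => x ≠ inf ∧ x ≠ o ∧ x ≠ κ

theorem mem_solveIndices {i : Fin n} :
    i ∈ solveIndices lab p p' q ↔ lab i ≠ none ∧ i ≠ p ∧ i ≠ p' ∧ i ≠ q := by
  simp [solveIndices]

theorem mem_solveLabels {x : Λ} : x ∈ solveLabels inf o κ ↔ x ≠ inf ∧ x ≠ o ∧ x ≠ κ := by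
  simp [solveLabels]

theorem card_solveLabels (hne : inf ≠ o) (hκinf : κ ≠ inf) (hκo : κ ≠ o) :
    (solveLabels inf o κ).card + 3 = Fintype.card Λ := by
  have h1 : solveLabels inf o κ = ((Finset.univ.erase inf).erase o).erase κ := by
    ext x; simp [mem_solveLabels, and_comm, and_assoc]
  have h2 : κ ∈ (Finset.univ.erase inf).erase o := by simp [hκinf, hκo]
  rw [h1, ← Finset.card_erase_erase_univ hne, ← Finset.card_erase_add_one h2]

theorem card_solveIndices (hne : inf ≠ o) (hκinf : κ ≠ inf) (hκo : κ ≠ o) (hp : lab p = some inf)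
    (hp' : lab p' = some o) (hq : lab q = some κ) :
    (solveIndices lab p p' q).card + 3 = (Finset.univ.filter fun i => lab i ≠ none).card := by
  have hpp' : p' ≠ p := by rintro rfl; simp_all
  have hpq : q ≠ p := by rintro rfl; simp_all
  have hpq' : q ≠ p' := by rintro rfl; simp_all
  have h1 : solveIndices lab p p' q =
      (((Finset.univ.filter fun i => lab i ≠ none).erase p).erase p').erase q := by
    ext x; simp [mem_solveIndices]; tauto
  rw [h1, ← Finset.card_erase_add_one (s := Finset.univ.filter fun i => lab i ≠ none) (a := p),
    ← Finset.card_erase_add_one (s := (Finset.univ.filter fun i => lab i ≠ none).erase p) (a := p'),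
    ← Finset.card_erase_add_one
      (s := ((Finset.univ.filter fun i => lab i ≠ none).erase p).erase p') (a := q)]
  all_goals simp [*]

/-- A normalized configuration is recovered from its parameters. -/
theorem IsMomentumConfig.solve_paramsOf {a : Fin n → ℝ} {z : Λ → Fin k → ℝ}
    (h : IsMomentumConfig lab ε inf o a z) (hne : inf ≠ o) (hκinf : κ ≠ inf) (hκo : κ ≠ o)
    (hp : lab p = some inf) (hp' : lab p' = some o) (hq : lab q = some κ) (haq : a q = 1)
    (htri : ∀ i j, i < j → z (e i) j = 0) (hc : labelWeight lab a κ ≠ 0) :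
    let θ := paramsOf (solveIndices lab p p' q) (solveLabels inf o κ) e a z
    solvePoint lab κ (baseMult q θ) (basePoint θ) = z ∧
      solveMult lab inf p p' (baseMult q θ) z = a ∧ labelWeight lab (baseMult q θ) κ ≠ 0 := by
  intro θ
  have hpq : p ≠ q := by rintro rfl; simp_all
  have hpq' : p' ≠ q := by rintro rfl; simp_all
  refine solve_eq hne hκinf hκo hp hp' h.z_inf h.z_origin hc h.sum_u h.sum_v h.sum_z ?_ ?_ ?_ ?_ ?_
  · intro i hi hi'
    by_cases hl : lab i = none
    · rw [h.loops i hl]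
      exact baseMult_eq_zero _ (by rintro rfl; simp_all) (by simp [mem_solveIndices, hl])
    · exact baseMult_paramsOf z haq (by rw [mem_solveIndices]; tauto)
  · exact baseMult_eq_zero _ hpq (by simp [mem_solveIndices])
  · exact baseMult_eq_zero _ hpq' (by simp [mem_solveIndices])
  · intro x hx
    by_cases h1 : x = inf
    · rw [h1, h.z_inf]; exact basePoint_eq_zero _ (by simp [mem_solveLabels])
    by_cases h2 : x = o
    · rw [h2, h.z_origin]; exact basePoint_eq_zero _ (by simp [mem_solveLabels])
    exact basePoint_paramsOf a htri (mem_solveLabels.mpr ⟨h1, h2, hx⟩)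
  · exact basePoint_eq_zero _ (by simp [mem_solveLabels])

/-- Normalization does not change the matrix, and a normalized configuration is the value of the
rational chart at its own parameters. -/
theorem algDimLE_of_labelWeight_ne_zero (hne : inf ≠ o) (hκinf : κ ≠ inf) (hκo : κ ≠ o)
    (hp : lab p = some inf) (hp' : lab p' = some o) (hq : lab q = some κ) (e : Fin k → Λ)
    {𝒮 : Set (Matrix (Fin n) (Fin n) ℝ)}
    (h : ∀ S ∈ 𝒮, ∃ (a : Fin n → ℝ) (z : Λ → Fin k → ℝ), IsMomentumConfig lab ε inf o a z ∧
      labelWeight lab a κ ≠ 0 ∧ configMatrix lab inf a z = S) :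
    AlgDimLE (matrixEntries '' 𝒮)
      (freeParams (solveIndices lab p p' q) (solveLabels inf o κ) e).card := by
  set Θ := freeParams (solveIndices lab p p' q) (solveLabels inf o κ) e
  rw [← Fintype.card_coe]
  refine algDimLE_image_matrixEntries (lab := lab) (inf := inf)
    (solveMult lab inf p p' (baseMult q (genericParams Θ))
      (solvePoint lab κ (baseMult q (genericParams Θ)) (basePoint (genericParams Θ))))
    (solvePoint lab κ (baseMult q (genericParams Θ)) (basePoint (genericParams Θ))) ?_
  intro S hS
  obtain ⟨a₁, z₁, h₁, hc₁, rfl⟩ := h S hS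
  obtain ⟨a, z, h₂, hconf, haq, htri, hw, -⟩ := h₁.exists_normalized hq hκinf e
  have hc : labelWeight lab a κ ≠ 0 := fun h0 => hc₁ ((hw κ).mp h0)
  obtain ⟨hz, ha, hc'⟩ := h₂.solve_paramsOf hne hκinf hκo hp hp' hq haq htri hc
  have hB := specializesTo_baseMult q
    (paramsOf (solveIndices lab p p' q) (solveLabels inf o κ) e a z)
  have hW := specializesTo_basePoint
    (paramsOf (solveIndices lab p p' q) (solveLabels inf o κ) e a z)
  have hZ := SpecializesTo.solvePoint hB hW hc'
  have hA := SpecializesTo.solveMult (lab := lab) (inf := inf) hB hZ p p'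
  rw [hz] at hA hZ
  rw [ha] at hA
  exact ⟨_, a, z, hA, hZ, hconf⟩

/-- The chart is defined near the given configuration because its only division is by the weight of
`κ`. The labels `e j` avoid `κ`, so the triangular shape is imposed on free points. -/
theorem card_le_of_labelWeight_ne_zero {a : Fin n → ℝ} {z : Λ → Fin k → ℝ}
    (h : IsMomentumConfig lab ε inf o a z) (hne : inf ≠ o) (hκinf : κ ≠ inf) (hκo : κ ≠ o)
    (hlab : ∀ x, ∃ i, lab i = some x)
    (hp : lab p = some inf) (hp' : lab p' = some o) (hq : lab q = some κ)
    (hc : labelWeight lab a κ ≠ 0) (heJ : ∀ j, e j ∈ solveLabels inf o κ)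
    (hli : LinearIndependent ℝ (z ∘ e)) {𝒮 : Set (Matrix (Fin n) (Fin n) ℝ)}
    (h𝒮 : ∀ (a : Fin n → ℝ) (z : Λ → Fin k → ℝ), IsMomentumConfig lab ε inf o a z →
      configMatrix lab inf a z ∈ 𝒮)
    {d : ℕ} (hd : semialgebraicDim (matrixEntries '' 𝒮) = d) :
    (freeParams (solveIndices lab p p' q) (solveLabels inf o κ) e).card ≤ d := by
  obtain ⟨a, z, h, -, haq, htri, hw, hli'⟩ := h.exists_normalized hq hκinf e
  replace hc : labelWeight lab a κ ≠ 0 := fun h0 => hc ((hw κ).mp h0)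
  replace hli := hli' hli
  clear hw hli'
  obtain ⟨hz, ha, hc'⟩ := h.solve_paramsOf hne hκinf hκo hp hp' hq haq htri hc
  set Θ := freeParams (solveIndices lab p p' q) (solveLabels inf o κ) e
  set θ₀ := paramsOf (solveIndices lab p p' q) (solveLabels inf o κ) e a z
  have hpq : q ≠ p := by rintro rfl; simp_all
  have hpq' : q ≠ p' := by rintro rfl; simp_all
  -- These facts are used over `ℝ` as well as over the function field.
  have hsub : ∀ {𝕂 : Type} [Field 𝕂] (a : Fin n → 𝕂) (z : Λ → Fin k → 𝕂) (i : Fin n),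
      i ≠ p → i ≠ p' → solveMult lab inf p p' a z i = a i := by
    intro 𝕂 _ a z i h1 h2
    simp [solveMult, h1, h2]
  have hsubz : ∀ {𝕂 : Type} [Field 𝕂] (a : Fin n → 𝕂) (z : Λ → Fin k → 𝕂) (x : Λ),
      x ≠ κ → solvePoint lab κ a z x = z x := by
    intro 𝕂 _ a z x h1
    simp [solvePoint, h1]
  have hloop : ∀ {𝕂 : Type} [Field 𝕂] (θ : Θ → 𝕂) (z : Λ → Fin k → 𝕂) (i : Fin n),
      lab i = none → solveMult lab inf p p' (baseMult q θ) z i = 0 := by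
    intro 𝕂 _ θ z i hi
    rw [hsub _ _ i (by rintro rfl; simp_all) (by rintro rfl; simp_all)]
    exact baseMult_eq_zero _ (by rintro rfl; simp_all) (by simp [mem_solveIndices, hi])
  have hzero : ∀ {𝕂 : Type} [Field 𝕂] (θ : Θ → 𝕂) (x : Λ), x = inf ∨ x = o ∨ x = κ →
      basePoint θ x = 0 := by
    intro 𝕂 _ θ x hx
    exact basePoint_eq_zero θ (by rw [mem_solveLabels]; tauto)
  have hcev : ∀ᶠ θ in nhds θ₀, labelWeight lab (baseMult q θ) κ ≠ 0 := by
    refine ContinuousAt.eventually_ne (SpecializesTo.continuousAt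
      (f := labelWeight lab (baseMult q (genericParams Θ)) κ) ?_) hc'
    exact Filter.Eventually.of_forall fun θ =>
      SpecializesTo.labelWeight (specializesTo_baseMult q θ) κ
  have hZ : ∀ᶠ θ in nhds θ₀, ∀ x t, SpecializesTo θ
      (solvePoint lab κ (baseMult q (genericParams Θ)) (basePoint (genericParams Θ)) x t)
      (solvePoint lab κ (baseMult q θ) (basePoint θ) x t) := by
    filter_upwards [hcev] with θ hθ
    exact SpecializesTo.solvePoint (specializesTo_baseMult q θ) (specializesTo_basePoint θ) hθ
  rw [← Fintype.card_coe]
  refine card_le_of_family (lab := lab) (inf := inf) (o := o) (ε := ε) (e := e)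
    (solveMult lab inf p p' (baseMult q (genericParams Θ))
      (solvePoint lab κ (baseMult q (genericParams Θ)) (basePoint (genericParams Θ))))
    (solvePoint lab κ (baseMult q (genericParams Θ)) (basePoint (genericParams Θ)))
    (fun θ => solveMult lab inf p p' (baseMult q θ)
      (solvePoint lab κ (baseMult q θ) (basePoint θ)))
    (fun θ => solvePoint lab κ (baseMult q θ) (basePoint θ)) θ₀ ?_ hZ ?_ hne hlab ?_ ?_ ?_ hq hκinf
    ?_ ?_ ?_ ?_ ?_ h𝒮 hd
  · filter_upwards [hZ] with θ hθ
    exact SpecializesTo.solveMult (specializesTo_baseMult q θ) hθ p p'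
  · simp only [hz, ha]; exact h
  · filter_upwards [hcev] with θ hθ
    refine ⟨hloop θ _, ?_, ?_, ?_⟩
    · rw [hsubz _ _ _ hκinf.symm, hzero θ _ (by simp)]
    · rw [hsubz _ _ _ hκo.symm, hzero θ _ (by simp)]
    · exact solve_momentum hne hκinf hκo hp hp' (hzero θ _ (by simp)) (hzero θ _ (by simp))
        (hzero θ _ (by simp)) hθ
  · simp only [hz]; exact hli
  · exact hloop _ _
  · rw [hsub _ _ _ hpq hpq']; simp [baseMult]
  · rw [hsubz _ _ _ hκinf.symm, hzero _ _ (by simp)]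
  · rw [hsubz _ _ _ hκo.symm, hzero _ _ (by simp)]
  · intro i j hij
    rw [hsubz _ _ _ (mem_solveLabels.mp (heJ i)).2.2]
    exact basePoint_triangular _ hij
  · intro j
    rcases genericParams_eq_baseMult_or_basePoint (q := q) (by simp [mem_solveIndices]) j with
      ⟨i, hi, h1⟩ | ⟨x, hx, t, h1⟩
    · rw [mem_solveIndices] at hi
      exact Or.inl ⟨i, by rw [hsub _ _ _ hi.2.1 hi.2.2.1, h1]; rfl⟩
    · rw [mem_solveLabels] at hx
      exact Or.inr ⟨x, t, by rw [hsubz _ _ _ hx.2.2, h1]; rfl⟩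

end SolveChart

/-! ### The chart with vanishing weights. -/

section BalanceChart

variable {n k : ℕ} {Λ : Type} [Fintype Λ] [DecidableEq Λ] {lab : Fin n → Option Λ} {ε : Fin n → ℝ}
  {inf o κ : Λ} {rep : Λ → Fin n} {q : Fin n} {e : Fin k → Λ}

/-- The indices with free multiples in a chart with vanishing weights. -/
def balanceIndices (lab : Fin n → Option Λ) (rep : Λ → Fin n) (q : Fin n) : Finset (Fin n) :=
  Finset.univ.filter fun i => lab i ≠ none ∧ i ≠ q ∧ ∀ x, i ≠ rep x

theorem mem_balanceIndices {i : Fin n} :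
    i ∈ balanceIndices lab rep q ↔ lab i ≠ none ∧ i ≠ q ∧ ∀ x, i ≠ rep x := by
  simp [balanceIndices]

theorem card_balanceIndices (hrep : ∀ x, lab (rep x) = some x) (hq : lab q ≠ none)
    (hqrep : ∀ x, q ≠ rep x) : (balanceIndices lab rep q).card + Fintype.card Λ + 1 =
      (Finset.univ.filter fun i => lab i ≠ none).card := by
  have hinj : Function.Injective rep := fun x y hxy =>
    Option.some_injective _ (by rw [← hrep x, ← hrep y, hxy])
  have h1 : (Finset.univ.filter fun i => lab i ≠ none) =
      insert q (balanceIndices lab rep q ∪ Finset.univ.image rep) := by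
    ext i
    simp only [Finset.mem_filter, Finset.mem_univ, true_and, Finset.mem_insert, Finset.mem_union,
      mem_balanceIndices, Finset.mem_image]
    constructor
    · intro hi
      by_cases h2 : i = q
      · exact Or.inl h2
      by_cases h3 : ∃ x, rep x = i
      · exact Or.inr (Or.inr h3)
      · push Not at h3
        exact Or.inr (Or.inl ⟨hi, h2, fun x hx => h3 x hx.symm⟩)
    · rintro (rfl | h2 | ⟨x, rfl⟩)
      · exact hq
      · exact h2.1
      · simp [hrep]
  rw [h1, Finset.card_insert_of_notMem, Finset.card_union_of_disjoint,
    Finset.card_image_of_injective _ hinj, Finset.card_univ]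
  · rw [Finset.disjoint_left]
    simp only [mem_balanceIndices, Finset.mem_image, Finset.mem_univ, true_and, not_exists]
    exact fun i hi x hx => hi.2.2 x hx.symm
  · simp only [Finset.mem_union, mem_balanceIndices, Finset.mem_image, Finset.mem_univ, true_and,
      ne_eq, not_true, false_and, and_false, false_or, not_exists]
    exact fun x hx => hqrep x hx.symm

theorem IsMomentumConfig.balance_paramsOf {a : Fin n → ℝ} {z : Λ → Fin k → ℝ}
    (h : IsMomentumConfig lab ε inf o a z) (hrep : ∀ x, lab (rep x) = some x)
    (hq : lab q ≠ none) (hqrep : ∀ x, q ≠ rep x) (haq : a q = 1)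
    (htri : ∀ i j, i < j → z (e i) j = 0) (hc : labelWeight lab a = 0) :
    let θ := paramsOf (balanceIndices lab rep q) ((Finset.univ.erase inf).erase o) e a z
    basePoint θ = z ∧ balanceMult lab rep (baseMult q θ) = a := by
  intro θ
  constructor
  · funext x
    by_cases h1 : x = inf
    · rw [h1, h.z_inf]; exact basePoint_eq_zero _ (by simp)
    by_cases h2 : x = o
    · rw [h2, h.z_origin]; exact basePoint_eq_zero _ (by simp)
    exact basePoint_paramsOf a htri (by simp [h1, h2])
  · refine balanceMult_eq hrep (congrFun hc) ?_ ?_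
    · exact fun x => baseMult_eq_zero _ (hqrep x).symm (by simp [mem_balanceIndices])
    · intro i hi
      by_cases hl : lab i = none
      · rw [h.loops i hl]
        exact baseMult_eq_zero _ (by rintro rfl; exact hq hl) (by simp [mem_balanceIndices, hl])
      · exact baseMult_paramsOf z haq (by rw [mem_balanceIndices]; tauto)

/-- With zero weights the momentum equations hold for all points. Points away from `inf` and `o` are
free up to triangularity, and each label determines the multiple of its representative; the scale is
fixed at an index `q` that is not a representative. -/
theorem algDimLE_of_labelWeight_eq_zero (hrep : ∀ x, lab (rep x) = some x)
    (hq : lab q = some κ) (hκinf : κ ≠ inf) (hqrep : ∀ x, q ≠ rep x) (e : Fin k → Λ)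
    {𝒮 : Set (Matrix (Fin n) (Fin n) ℝ)}
    (h : ∀ S ∈ 𝒮, ∃ (a : Fin n → ℝ) (z : Λ → Fin k → ℝ), IsMomentumConfig lab ε inf o a z ∧
      labelWeight lab a = 0 ∧ configMatrix lab inf a z = S) :
    AlgDimLE (matrixEntries '' 𝒮)
      (freeParams (balanceIndices lab rep q) ((Finset.univ.erase inf).erase o) e).card := by
  set Θ := freeParams (balanceIndices lab rep q) ((Finset.univ.erase inf).erase o) e
  rw [← Fintype.card_coe]
  refine algDimLE_image_matrixEntries (lab := lab) (inf := inf)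
    (balanceMult lab rep (baseMult q (genericParams Θ))) (basePoint (genericParams Θ)) ?_
  intro S hS
  obtain ⟨a₁, z₁, h₁, hc₁, rfl⟩ := h S hS
  obtain ⟨a, z, h₂, hconf, haq, htri, hw, -⟩ := h₁.exists_normalized hq hκinf e
  have hc : labelWeight lab a = 0 := funext fun x => (hw x).mpr (congrFun hc₁ x)
  obtain ⟨hz, ha⟩ := h₂.balance_paramsOf hrep (by simp [hq]) hqrep haq htri hc
  have hA := (SpecializesTo.balanceMult (lab := lab) (specializesTo_baseMult q
    (paramsOf (balanceIndices lab rep q) ((Finset.univ.erase inf).erase o) e a z)) rep)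
  have hZ := specializesTo_basePoint
    (paramsOf (balanceIndices lab rep q) ((Finset.univ.erase inf).erase o) e a z)
  rw [ha] at hA
  rw [hz] at hZ
  exact ⟨_, a, z, hA, hZ, hconf⟩

theorem card_le_of_labelWeight_eq_zero {a : Fin n → ℝ} {z : Λ → Fin k → ℝ}
    (h : IsMomentumConfig lab ε inf o a z) (hne : inf ≠ o) (hrep : ∀ x, lab (rep x) = some x)
    (hq : lab q = some κ) (hκinf : κ ≠ inf) (hqrep : ∀ x, q ≠ rep x)
    (hc : labelWeight lab a = 0) (hli : LinearIndependent ℝ (z ∘ e))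
    {𝒮 : Set (Matrix (Fin n) (Fin n) ℝ)}
    (h𝒮 : ∀ (a : Fin n → ℝ) (z : Λ → Fin k → ℝ), IsMomentumConfig lab ε inf o a z →
      configMatrix lab inf a z ∈ 𝒮)
    {d : ℕ} (hd : semialgebraicDim (matrixEntries '' 𝒮) = d) :
    (freeParams (balanceIndices lab rep q) ((Finset.univ.erase inf).erase o) e).card ≤ d := by
  obtain ⟨a, z, h, -, haq, htri, hw, hli'⟩ := h.exists_normalized hq hκinf e
  replace hc : labelWeight lab a = 0 := funext fun x => (hw x).mpr (congrFun hc x)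
  replace hli := hli' hli
  obtain ⟨hz, ha⟩ := h.balance_paramsOf hrep (by simp [hq]) hqrep haq htri hc
  set Θ := freeParams (balanceIndices lab rep q) ((Finset.univ.erase inf).erase o) e
  set θ₀ := paramsOf (balanceIndices lab rep q) ((Finset.univ.erase inf).erase o) e a z
  have hzero : ∀ {𝕂 : Type} [Field 𝕂] (θ : Θ → 𝕂), basePoint θ inf = 0 ∧ basePoint θ o = 0 := by
    intro 𝕂 _ θ
    exact ⟨basePoint_eq_zero θ (by simp), basePoint_eq_zero θ (by simp)⟩
  have hloop : ∀ {𝕂 : Type} [Field 𝕂] (θ : Θ → 𝕂) (i : Fin n),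
      lab i = none → balanceMult lab rep (baseMult q θ) i = 0 := by
    intro 𝕂 _ θ i hi
    rw [balanceMult_apply_of_ne _ (by rintro x rfl; simp [hrep] at hi)]
    exact baseMult_eq_zero _ (by rintro rfl; simp_all) (by simp [mem_balanceIndices, hi])
  rw [← Fintype.card_coe]
  refine card_le_of_family (lab := lab) (inf := inf) (o := o) (ε := ε) (e := e)
    (balanceMult lab rep (baseMult q (genericParams Θ))) (basePoint (genericParams Θ))
    (fun θ => balanceMult lab rep (baseMult q θ)) (fun θ => basePoint θ) θ₀
    (Filter.Eventually.of_forall fun θ =>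
      SpecializesTo.balanceMult (specializesTo_baseMult q θ) rep)
    (Filter.Eventually.of_forall fun θ => specializesTo_basePoint θ)
    ?_ hne (fun x => ⟨rep x, hrep x⟩) (Filter.Eventually.of_forall fun θ => ⟨hloop θ, (hzero θ).1,
      (hzero θ).2, ?_⟩) ?_ (hloop _) hq hκinf ?_ (hzero _).1 (hzero _).2
    (fun i j hij => basePoint_triangular _ hij) ?_ h𝒮 hd
  · simp only [hz, ha]; exact h
  · simp [labelWeight_balanceMult hrep]
  · simp only [hz]; exact hli
  · rw [balanceMult_apply_of_ne _ hqrep]; simp [baseMult]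
  · intro j
    rcases genericParams_eq_baseMult_or_basePoint (q := q) (by simp [mem_balanceIndices]) j with
      ⟨i, hi, h1⟩ | ⟨x, -, t, h1⟩
    · rw [mem_balanceIndices] at hi
      exact Or.inl ⟨i, by rw [balanceMult_apply_of_ne _ hi.2.2, h1]; rfl⟩
    · exact Or.inr ⟨x, t, by rw [h1]; rfl⟩

end BalanceChart

/-! ### The dimension of a stratum -/

theorem exists_linearIndependent_of_span_eq_top {k : ℕ} {Λ : Type} {z : Λ → Fin k → ℝ}
    {J : Finset Λ} (h : Submodule.span ℝ (Set.range fun x : J => z x) = ⊤) :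
    ∃ e : Fin k → Λ, Function.Injective e ∧ (∀ j, e j ∈ J) ∧ LinearIndependent ℝ (z ∘ e) := by
  obtain ⟨κ, f, hf, hspan, hli⟩ := exists_linearIndependent' ℝ (fun x : J => z x)
  have := Finite.of_injective f hf
  have := Fintype.ofFinite κ
  rw [h] at hspan
  have hcard : Fintype.card κ = k := by
    have h2 := Module.finrank_eq_card_basis (Module.Basis.mk hli hspan.ge)
    simpa using h2.symm
  let g : Fin k ≃ κ := (Fintype.equivFinOfCardEq hcard).symm
  exact ⟨fun j => f (g j), Subtype.val_injective.comp (hf.comp g.injective),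
    fun j => (f (g j)).2, hli.comp g g.injective⟩

theorem exists_injective_of_card_le {k : ℕ} {Λ : Type} {J : Finset Λ} (h : k ≤ J.card) :
    ∃ e : Fin k → Λ, Function.Injective e ∧ ∀ j, e j ∈ J := by
  obtain ⟨f⟩ := Function.Embedding.nonempty_of_card_le (α := Fin k) (β := J) (by simpa using h)
  exact ⟨fun j => f j, Subtype.val_injective.comp f.injective, fun j => (f j).2⟩

section Stratum

variable {n k : ℕ} {Λ : Type} [Fintype Λ] [DecidableEq Λ] {lab : Fin n → Option Λ}
  {ε : Fin n → ℝ} {inf o : Λ}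

/-- Momentum conservation expresses the point of `κ` through the others, so it can be dropped from a
spanning set. -/
theorem IsMomentumConfig.span_solveLabels {a : Fin n → ℝ} {z : Λ → Fin k → ℝ}
    (h : IsMomentumConfig lab ε inf o a z) {κ : Λ} (hc : labelWeight lab a κ ≠ 0) :
    Submodule.span ℝ (Set.range fun x : solveLabels inf o κ => z x) = ⊤ := by
  have h1 : ∀ x, x ≠ κ → z x ∈ Submodule.span ℝ (Set.range fun x : solveLabels inf o κ => z x) := by
    intro x hx
    by_cases hxi : x = inf
    · rw [hxi, h.z_inf]; exact Submodule.zero_mem _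
    by_cases hxo : x = o
    · rw [hxo, h.z_origin]; exact Submodule.zero_mem _
    exact Submodule.subset_span ⟨⟨x, mem_solveLabels.mpr ⟨hxi, hxo, hx⟩⟩, rfl⟩
  rw [eq_top_iff, ← h.span, Submodule.span_le]
  rintro _ ⟨x, rfl⟩
  by_cases hx : x = κ
  · subst hx
    have h2 := h.sum_z
    rw [← Finset.add_sum_erase _ _ (Finset.mem_univ x), add_eq_zero_iff_eq_neg] at h2
    have h3 : labelWeight lab a x • z x ∈
        Submodule.span ℝ (Set.range fun y : solveLabels inf o x => z y) := by
      rw [h2]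
      exact Submodule.neg_mem _ (Submodule.sum_mem _ fun y hy =>
        Submodule.smul_mem _ _ (h1 y (Finset.ne_of_mem_erase hy)))
    simpa [smul_smul, hc] using Submodule.smul_mem _ (labelWeight lab a x)⁻¹ h3
  · exact h1 x hx

/-- The matrices of the massless momentum conserving region with a given sign pattern. -/
def patternStratum (lab : Fin n → Option Λ) (ε : Fin n → ℝ) (r : ℕ) :
    Set (Matrix (Fin n) (Fin n) ℝ) :=
  {S | S ∈ mmcRegion n r ∧ HasSignPattern lab ε S}

/-- A label whose total weight vanishes has at least two indices. -/
theorem IsMomentumConfig.exists_ne_of_labelWeight_eq_zero {a : Fin n → ℝ} {z : Λ → Fin k → ℝ}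
    (h : IsMomentumConfig lab ε inf o a z) {x : Λ} (hc : labelWeight lab a x = 0) {i : Fin n}
    (hi : lab i = some x) : ∃ j, lab j = some x ∧ j ≠ i := by
  by_contra! hcon
  apply h.ne_zero (i := i) (by simp [hi])
  rw [← hc, labelWeight, Finset.sum_eq_single i]
  · simp [hi]
  · intro j _ hj
    rw [if_neg fun h' => hj (hcon j h')]
  · simp

/-- The stratum is a finite union of charts: all weights vanish, or some weight away from `inf` and
`o` does not. `hD` is the parameter count of the second kind, written without subtraction. -/
theorem algDimLE_patternStratum (hε : ∀ i, ε i * ε i = 1) (hne : inf ≠ o)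
    (hlab : ∀ x, ∃ i, lab i = some x) {D : ℕ}
    (hD : D + k.choose 2 + 3 * k + 3 =
      (Finset.univ.filter fun i => lab i ≠ none).card + Fintype.card Λ * k) :
    AlgDimLE (matrixEntries '' patternStratum lab ε (k + 2)) D := by
  choose rep hrep using hlab
  have hinj : Function.Injective rep := fun x y hxy =>
    Option.some_injective _ (by rw [← hrep x, ← hrep y, hxy])
  set 𝒮₀ : Set (Matrix (Fin n) (Fin n) ℝ) := {S | ∃ (a : Fin n → ℝ) (z : Λ → Fin k → ℝ),
    IsMomentumConfig lab ε inf o a z ∧ labelWeight lab a = 0 ∧ configMatrix lab inf a z = S}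
  set 𝒮₁ : {κ // κ ≠ inf ∧ κ ≠ o} → Set (Matrix (Fin n) (Fin n) ℝ) := fun κ =>
    {S | ∃ (a : Fin n → ℝ) (z : Λ → Fin k → ℝ), IsMomentumConfig lab ε inf o a z ∧
      labelWeight lab a κ ≠ 0 ∧ configMatrix lab inf a z = S}
  have hcover : patternStratum lab ε (k + 2) ⊆ 𝒮₀ ∪ ⋃ κ, 𝒮₁ κ := by
    rintro S ⟨hS, hpat⟩
    obtain ⟨k', a, z, hk, h, hmat⟩ :=
      exists_isMomentumConfig hε hne (fun x => ⟨rep x, hrep x⟩) hS hpat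
    obtain rfl : k = k' := by omega
    by_cases hc : ∀ x, x ≠ inf → x ≠ o → labelWeight lab a x = 0
    · exact Or.inl ⟨a, z, h, h.labelWeight_eq_zero hne hc, hmat⟩
    · push Not at hc
      obtain ⟨x, hx, hx', hcx⟩ := hc
      exact Or.inr (Set.mem_iUnion.mpr ⟨⟨x, hx, hx'⟩, a, z, h, hcx, hmat⟩)
  have h₀ : AlgDimLE (matrixEntries '' 𝒮₀) D := by
    by_cases hemp : 𝒮₀ = ∅
    · rw [hemp, Set.image_empty]; exact AlgDimLE.empty
    obtain ⟨S, a, z, h, hc, -⟩ := Set.nonempty_iff_ne_empty.mpr hemp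
    obtain ⟨q, hq, hqo⟩ := h.exists_ne_of_labelWeight_eq_zero (congrFun hc o) (hrep o)
    have hqrep : ∀ x, q ≠ rep x := by
      rintro x rfl
      rw [hrep] at hq
      exact hqo (by rw [Option.some_injective _ hq])
    have hm := h.add_two_le_card hne
    have hJ := Finset.card_erase_erase_univ hne
    obtain ⟨e, he, heJ⟩ := exists_injective_of_card_le
      (J := (Finset.univ.erase inf).erase o) (k := k) (by omega)
    refine (algDimLE_of_labelWeight_eq_zero hrep hq hne.symm hqrep e (ε := ε) (𝒮 := 𝒮₀)
      fun S hS => hS).mono subset_rfl ?_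
    have h1 := card_freeParams (I := balanceIndices lab rep q) he heJ
    have h2 := card_balanceIndices hrep (by simp [hq]) hqrep
    rw [← hJ] at h2 hD
    rw [← hJ] at hm
    -- The zero-weight chart has `card Λ - 2 - k` fewer parameters than `D`, which is non-negative
    -- by `hm`.
    nlinarith
  have h₁ : ∀ κ, AlgDimLE (matrixEntries '' 𝒮₁ κ) D := by
    rintro ⟨κ, hκinf, hκo⟩
    by_cases hemp : 𝒮₁ ⟨κ, hκinf, hκo⟩ = ∅
    · rw [hemp, Set.image_empty]; exact AlgDimLE.empty
    obtain ⟨S, a, z, h, hc, -⟩ := Set.nonempty_iff_ne_empty.mpr hemp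
    obtain ⟨e, he, heJ, -⟩ := exists_linearIndependent_of_span_eq_top (h.span_solveLabels hc)
    refine (algDimLE_of_labelWeight_ne_zero hne hκinf hκo (hrep inf) (hrep o) (hrep κ) e (ε := ε)
      (𝒮 := 𝒮₁ ⟨κ, hκinf, hκo⟩) fun S hS => hS).mono subset_rfl ?_
    have h1 := card_freeParams
      (I := solveIndices lab (rep inf) (rep o) (rep κ)) he heJ
    have h2 := card_solveIndices hne hκinf hκo (hrep inf) (hrep o) (hrep κ)
    have h3 := card_solveLabels hne hκinf hκo
    rw [← h2, ← h3] at hD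
    nlinarith
  refine (h₀.union (AlgDimLE.iUnion h₁)).mono ?_ le_rfl
  rw [← Set.image_iUnion, ← Set.image_union]
  exact Set.image_mono hcover

/-- The dimension of a stratum that contains a suitable configuration. -/
theorem semialgebraicDim_patternStratum (hε : ∀ i, ε i * ε i = 1) (hne : inf ≠ o)
    (hlab : ∀ x, ∃ i, lab i = some x) {a : Fin n → ℝ} {z : Λ → Fin k → ℝ}
    (h : IsMomentumConfig lab ε inf o a z)
    (hw : k + 2 < Fintype.card Λ → labelWeight lab a ≠ 0) :
    ∃ d : ℕ, semialgebraicDim (matrixEntries '' patternStratum lab ε (k + 2)) = d ∧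
      d + k.choose 2 + 3 * k + 3 =
        (Finset.univ.filter fun i => lab i ≠ none).card + Fintype.card Λ * k := by
  choose rep hrep using hlab
  have hlab : ∀ x, ∃ i, lab i = some x := fun x => ⟨rep x, hrep x⟩
  have h𝒮 : ∀ (a : Fin n → ℝ) (z : Λ → Fin k → ℝ), IsMomentumConfig lab ε inf o a z →
      configMatrix lab inf a z ∈ patternStratum lab ε (k + 2) :=
    fun a z h => ⟨h.mem_mmcRegion hne hlab, h.hasSignPattern⟩
  have hnonempty : (matrixEntries '' patternStratum lab ε (k + 2)).Nonempty :=
    ⟨_, _, h𝒮 a z h, rfl⟩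
  obtain ⟨d, -, hd, -⟩ := exists_noether_normalization_of_set hnonempty
  suffices H : ∃ D : ℕ, D + k.choose 2 + 3 * k + 3 =
      (Finset.univ.filter fun i => lab i ≠ none).card + Fintype.card Λ * k ∧ D ≤ d by
    obtain ⟨D, hD, hDd⟩ := H
    have := (algDimLE_patternStratum hε hne hlab hD).semialgebraicDim_le hnonempty hd
    exact ⟨d, hd, by omega⟩
  -- Below the maximal rank, `hw` provides a chart with a non-zero weight. At the maximal rank all
  -- weights vanish, and the two parameter counts agree.
  rcases (h.add_two_le_card hne).lt_or_eq with hm | hm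
  · obtain ⟨κ, hκinf, hκo, hc⟩ : ∃ x, x ≠ inf ∧ x ≠ o ∧ labelWeight lab a x ≠ 0 := by
      by_contra! hcon
      exact hw hm (h.labelWeight_eq_zero hne hcon)
    obtain ⟨e, he, heJ, hli⟩ := exists_linearIndependent_of_span_eq_top (h.span_solveLabels hc)
    refine ⟨_, ?_, card_le_of_labelWeight_ne_zero h hne hκinf hκo hlab (hrep inf) (hrep o) (hrep κ)
      hc heJ hli h𝒮 hd⟩
    have h1 := card_freeParams
      (I := solveIndices lab (rep inf) (rep o) (rep κ)) he heJ
    have h2 := card_solveIndices hne hκinf hκo (hrep inf) (hrep o) (hrep κ)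
    have h3 := card_solveLabels hne hκinf hκo
    rw [← h2, ← h3]
    linarith
  · have hc := h.labelWeight_eq_zero_of_card_eq hne hm
    obtain ⟨q, hq, hqo⟩ := h.exists_ne_of_labelWeight_eq_zero (congrFun hc o) (hrep o)
    have hqrep : ∀ x, q ≠ rep x := by
      rintro x rfl
      rw [hrep] at hq
      exact hqo (by rw [Option.some_injective _ hq])
    obtain ⟨e, he, heJ, hli⟩ := exists_linearIndependent_of_span_eq_top h.span_image_erase
    refine ⟨_, ?_, card_le_of_labelWeight_eq_zero h hne hrep hq hne.symm hqrep hc hli h𝒮 hd⟩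
    have h1 := card_freeParams (I := balanceIndices lab rep q) he heJ
    have h2 := card_balanceIndices hrep (by simp [hq]) hqrep
    have h3 := Finset.card_erase_erase_univ hne
    have h4 : ((Finset.univ.erase inf).erase o).card = k := by omega
    rw [h4] at h1
    rw [← h2, ← hm]
    linarith

end Stratum

/-! ### Existence of configurations -/

theorem Finset.exists_sum_eq_of_mul_pos {ι : Type*} [DecidableEq ι] {ε : ι → ℝ}
    (hε : ∀ i, ε i * ε i = 1) (s : Finset ι) {c : ℝ} (h : ∃ i ∈ s, 0 < ε i * c) :
    ∃ a : ι → ℝ, (∀ i ∈ s, 0 < ε i * a i) ∧ ∑ i ∈ s, a i = c := by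
  obtain ⟨i, hi, hc⟩ := h
  -- Every other index `j` gets `ε j * δ`. The index `i` absorbs the rest, and at least `δ` of its
  -- own sign is left for it.
  set δ : ℝ := ε i * c / s.card
  have hs : (0 : ℝ) < s.card := by exact_mod_cast Finset.card_pos.mpr ⟨i, hi⟩
  have hδ : 0 < δ := div_pos hc hs
  have hεle : ∀ j, ε i * ε j ≤ 1 := fun j => by nlinarith [hε i, hε j, sq_nonneg (ε i - ε j)]
  have hle : ∑ j ∈ s.erase i, ε i * ε j * δ ≤ ((s.card : ℝ) - 1) * δ := by
    have h1 := Finset.sum_le_card_nsmul (s.erase i) (fun j => ε i * ε j * δ) δ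
      fun j _ => mul_le_of_le_one_left hδ.le (hεle j)
    rw [Finset.card_erase_of_mem hi, nsmul_eq_mul,
      Nat.cast_pred (Finset.card_pos.mpr ⟨i, hi⟩)] at h1
    exact h1
  refine ⟨fun j => if j = i then c - ∑ j ∈ s.erase i, ε j * δ else ε j * δ, fun j _ => ?_, ?_⟩
  · by_cases hj : j = i
    · subst hj
      simp only [if_true]
      have h1 : ∑ l ∈ s.erase j, ε j * ε l * δ = ε j * ∑ l ∈ s.erase j, ε l * δ := by
        rw [Finset.mul_sum]
        exact Finset.sum_congr rfl fun l _ => by ring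
      have h2 : (s.card : ℝ) * δ = ε j * c := mul_div_cancel₀ _ hs.ne'
      rw [mul_sub, ← h1, ← h2]
      linarith
    · simp only [hj, if_false]
      rw [← mul_assoc, hε, one_mul]
      exact hδ
  · rw [← Finset.add_sum_erase _ _ hi]
    simp only [if_true]
    rw [Finset.sum_congr rfl fun j hj => if_neg (Finset.ne_of_mem_erase hj)]
    ring

/-- One negative index gets `-1`, and the others, among them a positive one, are made to sum to `1`.
-/
theorem Finset.exists_sum_eq_zero_of_signs {ι : Type*} [DecidableEq ι] {ε : ι → ℝ}
    (hε : ∀ i, ε i * ε i = 1) (s : Finset ι) (hpos : ∃ i ∈ s, 0 < ε i) (hneg : ∃ i ∈ s, ε i < 0) :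
    ∃ a : ι → ℝ, (∀ i ∈ s, 0 < ε i * a i) ∧ ∑ i ∈ s, a i = 0 := by
  obtain ⟨i, hi, hi'⟩ := hpos
  obtain ⟨j, hj, hj'⟩ := hneg
  have hij : i ≠ j := by rintro rfl; exact lt_asymm hi' hj'
  obtain ⟨a, ha, hsum⟩ := Finset.exists_sum_eq_of_mul_pos hε (s.erase j) (c := 1)
    ⟨i, Finset.mem_erase.mpr ⟨hij, hi⟩, by simpa using hi'⟩
  refine ⟨Function.update a j (-1), fun l hl => ?_, ?_⟩
  · by_cases h : l = j
    · subst h; simpa using hj'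
    · rw [Function.update_of_ne h]; exact ha l (Finset.mem_erase.mpr ⟨h, hl⟩)
  · rw [← Finset.add_sum_erase _ _ hj, Function.update_self]
    rw [Finset.sum_congr rfl fun l hl => Function.update_of_ne (Finset.ne_of_mem_erase hl) _ _, hsum]
    ring

section Existence

variable {n : ℕ} {Λ : Type} [DecidableEq Λ] {lab : Fin n → Option Λ} {ε : Fin n → ℝ}

/-- The real numbers that are the total weight of a label for suitable multiples with prescribed
signs. -/
def IsFeasibleWeight (lab : Fin n → Option Λ) (ε : Fin n → ℝ) (x : Λ) (c : ℝ) : Prop :=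
  (∃ i, lab i = some x ∧ 0 < ε i * c) ∨
    c = 0 ∧ (∃ i, lab i = some x ∧ 0 < ε i) ∧ ∃ i, lab i = some x ∧ ε i < 0

/-- A label with both signs. -/
def IsMixedLabel (lab : Fin n → Option Λ) (ε : Fin n → ℝ) (x : Λ) : Prop :=
  (∃ i, lab i = some x ∧ 0 < ε i) ∧ ∃ i, lab i = some x ∧ ε i < 0

theorem IsMixedLabel.isFeasibleWeight {x : Λ} (h : IsMixedLabel lab ε x) (c : ℝ) :
    IsFeasibleWeight lab ε x c := by
  obtain ⟨⟨i, hi, hi'⟩, j, hj, hj'⟩ := h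
  rcases lt_trichotomy c 0 with hc | hc | hc
  · exact Or.inl ⟨j, hj, mul_pos_of_neg_of_neg hj' hc⟩
  · exact Or.inr ⟨hc, ⟨i, hi, hi'⟩, j, hj, hj'⟩
  · exact Or.inl ⟨i, hi, mul_pos hi' hc⟩

theorem exists_labelWeight_eq (hε : ∀ i, ε i * ε i = 1) {c : Λ → ℝ}
    (hc : ∀ x, IsFeasibleWeight lab ε x (c x)) :
    ∃ a : Fin n → ℝ, (∀ i, lab i = none → a i = 0) ∧ (∀ i, lab i ≠ none → 0 < ε i * a i) ∧
      labelWeight lab a = c := by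
  have h1 : ∀ x, ∃ a : Fin n → ℝ, (∀ i, lab i = some x → 0 < ε i * a i) ∧
      ∑ i ∈ Finset.univ.filter (fun i => lab i = some x), a i = c x := by
    intro x
    have h2 : ∃ a : Fin n → ℝ,
        (∀ i ∈ Finset.univ.filter (fun i => lab i = some x), 0 < ε i * a i) ∧
        ∑ i ∈ Finset.univ.filter (fun i => lab i = some x), a i = c x := by
      rcases hc x with ⟨i, hi⟩ | ⟨h0, ⟨i, hi⟩, j, hj⟩
      · exact Finset.exists_sum_eq_of_mul_pos hε _ ⟨i, by simpa using hi⟩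
      · rw [h0]
        exact Finset.exists_sum_eq_zero_of_signs hε _ ⟨i, by simpa using hi⟩ ⟨j, by simpa using hj⟩
    simpa using h2
  choose a ha hsum using h1
  refine ⟨fun i => (lab i).elim 0 fun x => a x i, fun i hi => by simp [hi], fun i hi => ?_, ?_⟩
  · obtain ⟨x, hx⟩ := Option.ne_none_iff_exists'.mp hi
    simpa [hx] using ha x i hx
  · funext x
    rw [← hsum x, labelWeight, Finset.sum_filter]
    refine Finset.sum_congr rfl fun i _ => ?_
    split_ifs with h
    · simp [h]
    · rfl

variable [Fintype Λ]

theorem exists_isMomentumConfig_of_weights (hε : ∀ i, ε i * ε i = 1) {k : ℕ} {inf o : Λ}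
    {c : Λ → ℝ} {z : Λ → Fin k → ℝ} (hc : ∀ x, IsFeasibleWeight lab ε x (c x))
    (hinf : z inf = 0) (ho : z o = 0)
    (hinj : ∀ x y, x ≠ inf → y ≠ inf → x ≠ y → z x ≠ z y)
    (hspan : Submodule.span ℝ (Set.range z) = ⊤) (hu : ∑ x, c x * lightU ℝ inf x = 0)
    (hv : ∑ x, c x * lightV inf z x = 0) (hz : ∑ x, c x • z x = 0) :
    ∃ a, IsMomentumConfig lab ε inf o a z ∧ labelWeight lab a = c := by
  obtain ⟨a, h0, ha, hw⟩ := exists_labelWeight_eq hε hc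
  refine ⟨a, ⟨h0, fun i j hi hj => ?_, hinf, ho, hinj, hspan, ?_, ?_, ?_⟩, hw⟩
  · have := mul_pos (ha i hi) (ha j hj)
    linarith
  all_goals rw [hw]; assumption

theorem exists_isMomentumConfig_of_card_eq (hε : ∀ i, ε i * ε i = 1) {k : ℕ} {inf o : Λ}
    (hne : inf ≠ o) (hk : k + 2 = Fintype.card Λ) (hmix : ∀ x, IsMixedLabel lab ε x) :
    ∃ (a : Fin n → ℝ) (z : Λ → Fin k → ℝ), IsMomentumConfig lab ε inf o a z := by
  have hJ := Finset.card_erase_erase_univ hne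
  let e : ((Finset.univ.erase inf).erase o : Finset Λ) ≃ Fin k :=
    Finset.equivFinOfCardEq (by omega)
  let z : Λ → Fin k → ℝ := fun x => if h : x ∈ (Finset.univ.erase inf).erase o then
    Pi.single (e ⟨x, h⟩) 1 else 0
  have hz : ∀ x (h : x ∈ (Finset.univ.erase inf).erase o), z x = Pi.single (e ⟨x, h⟩) 1 :=
    fun x h => dif_pos h
  have hinf : z inf = 0 := dif_neg (by simp)
  have ho : z o = 0 := dif_neg (by simp)
  have hinj : ∀ x y, x ≠ inf → y ≠ inf → x ≠ y → z x ≠ z y := by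
    intro x y hx hy hxy hzxy
    have key : ∀ u (hu : u ∈ (Finset.univ.erase inf).erase o) v, v ≠ inf → z u = z v → u = v := by
      intro u hu v hv huv
      have h1 := congrFun huv (e ⟨u, hu⟩)
      rw [hz u hu, Pi.single_eq_same] at h1
      by_cases hvo : v = o
      · simp [hvo, ho] at h1
      · rw [hz v (by simp [hv, hvo]), Pi.single_apply] at h1
        split_ifs at h1 with h2
        · exact congrArg Subtype.val (e.injective h2)
        · exact absurd h1 one_ne_zero
    by_cases hxo : x = o
    · have hyo : y ≠ o := fun h => hxy (hxo.trans h.symm)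
      exact hxy (key y (by simp [hy, hyo]) x hx hzxy.symm).symm
    · exact hxy (key x (by simp [hx, hxo]) y hy hzxy)
  have hspan : Submodule.span ℝ (Set.range z) = ⊤ := by
    rw [eq_top_iff, ← (Pi.basisFun ℝ (Fin k)).span_eq, Submodule.span_le]
    rintro _ ⟨j, rfl⟩
    refine Submodule.subset_span ⟨(e.symm j).1, ?_⟩
    rw [hz _ (e.symm j).2]
    simp
  obtain ⟨a, h, -⟩ := exists_isMomentumConfig_of_weights (c := 0) hε
    (fun x => (hmix x).isFeasibleWeight _) hinf ho hinj hspan (by simp) (by simp) (by simp)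
  exact ⟨a, z, h⟩

/-- `A` is at infinity and `B` at the origin. `C` and `D` get weights `s C` and `s D / 2`, all
others the small weight `η * s x`, and the point of `D` and the weights of `B` and `A` are solved
for. As `η` tends to zero, the latter tend to the values at which `F` is assumed to hold nearby.
Without the factor `1 / 2` the point of `D` could tend to that of `C`. -/
theorem exists_weights_and_points {k : ℕ} {A B C D : Λ} (hAB : A ≠ B) (hAC : A ≠ C) (hAD : A ≠ D)
    (hBC : B ≠ C) (hBD : B ≠ D) (hCD : C ≠ D) (hcard : k + 4 ≤ Fintype.card Λ) {s : Λ → ℝ}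
    (hs : ∀ x, s x * s x = 1) {F : Λ → ℝ → Prop} (hF : ∀ x t, 0 < t → F x (t * s x))
    (hFA : ∀ᶠ c in nhds (-(s C / 2 + s D)), F A c) (hFB : ∀ᶠ c in nhds (-(s C + s D / 2)), F B c) :
    ∃ (c : Λ → ℝ) (z : Λ → Fin (k + 1) → ℝ), (∀ x, F x (c x)) ∧ c C ≠ 0 ∧ z A = 0 ∧ z B = 0 ∧
      (∀ x y, x ≠ A → y ≠ A → x ≠ y → z x ≠ z y) ∧ Submodule.span ℝ (Set.range z) = ⊤ ∧
      ∑ x, c x * lightU ℝ A x = 0 ∧ ∑ x, c x * lightV A z x = 0 ∧ ∑ x, c x • z x = 0 := by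
  set R : Finset Λ := (((Finset.univ.erase A).erase B).erase C).erase D
  have hR : ∀ {x}, x ∈ R ↔ x ≠ D ∧ x ≠ C ∧ x ≠ B ∧ x ≠ A := by simp [R]
  have hsplit : ∀ {V : Type} [AddCommMonoid V] (G : Λ → V),
      ∑ x, G x = G A + (G B + (G C + (G D + ∑ x ∈ R, G x))) := by
    intro V _ G
    rw [← Finset.add_sum_erase _ _ (Finset.mem_univ A), ← Finset.add_sum_erase _ _
      (show B ∈ Finset.univ.erase A by simp [hAB.symm]), ← Finset.add_sum_erase _ _
      (show C ∈ (Finset.univ.erase A).erase B by simp [hAC.symm, hBC.symm]),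
      ← Finset.add_sum_erase _ _ (show D ∈ ((Finset.univ.erase A).erase B).erase C by
        simp [hAD.symm, hBD.symm, hCD.symm])]
  have hRcard : k ≤ R.card := by
    have := hsplit fun _ => 1
    simp at this
    omega
  obtain ⟨e, he, heR⟩ := exists_injective_of_card_le hRcard
  -- The labels `e i` take the axes other than the first, so that together with `δ` the points span.
  -- The lengths are at least `3` and pairwise different, so coordinate sums separate these points
  -- from each other and from those of `B`, `C` and `D`, whose sums are `0`, `1` and close to `±2`.
  let w : Λ → Fin (k + 1) → ℝ := fun x =>
    Pi.single (Function.extend e Fin.succ 0 x) (3 + (Fintype.equivFin Λ x : ℝ))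
  let δ : Fin (k + 1) → ℝ := Pi.single 0 1
  let W : Fin (k + 1) → ℝ := ∑ x ∈ R, s x • w x
  let zD : ℝ → Fin (k + 1) → ℝ := fun η => -(2 * s D) • (s C • δ + η • W)
  let cB : ℝ → ℝ := fun η => -(s C + s D / 2 + η * ∑ x ∈ R, s x)
  let cA : ℝ → ℝ := fun η =>
    -(s C / 2 + s D / 2 * (zD η ⬝ᵥ zD η / 2) + η * ∑ x ∈ R, s x * (w x ⬝ᵥ w x / 2))
  have hzD : Continuous zD := by fun_prop
  have hcB : Continuous cB := by fun_prop
  have hcA : Continuous cA := by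
    have := hzD.dotProduct hzD
    fun_prop
  have hδ : δ ⬝ᵥ δ = 1 := by simp [δ]
  have hδs : ∑ t, δ t = 1 := by simp [δ]
  have hzD0 : zD 0 = -(2 * s D * s C) • δ := by simp [zD, smul_smul]
  have hcA0 : cA 0 = -(s C / 2 + s D) := by
    simp only [cA, hzD0, smul_dotProduct, dotProduct_smul, hδ, smul_eq_mul]
    linear_combination -s D * (s D * s D) * hs C - s D * hs D
  have hcB0 : cB 0 = -(s C + s D / 2) := by simp [cB]
  have hsum0 : (∑ t, zD 0 t) ^ 2 = 4 := by
    rw [hzD0]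
    simp only [Pi.smul_apply, smul_eq_mul, ← Finset.mul_sum, hδs]
    linear_combination 4 * (s D * s D) * hs C + 4 * hs D
  have hev : ∀ᶠ η in nhds (0 : ℝ), F A (cA η) ∧ F B (cB η) ∧ 1 < (∑ t, zD η t) ^ 2 ∧
      (∑ t, zD η t) ^ 2 < 9 := by
    rw [← hcA0] at hFA
    rw [← hcB0] at hFB
    have hc : Continuous fun η => (∑ t, zD η t) ^ 2 := by fun_prop
    refine (hcA.continuousAt.eventually hFA).and ((hcB.continuousAt.eventually hFB).and
      ((hc.continuousAt.eventually (lt_mem_nhds ?_)).and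
        (hc.continuousAt.eventually (gt_mem_nhds ?_)))) <;> simp only [hsum0] <;> norm_num
  obtain ⟨η, hη, hηA, hηB, hη1, hη9⟩ :=
    ((eventually_mem_nhdsWithin (a := (0 : ℝ)) (s := Set.Ioi 0)).and
      (hev.filter_mono nhdsWithin_le_nhds)).exists
  let z : Λ → Fin (k + 1) → ℝ := fun x => if x = A then 0 else if x = B then 0 else
    if x = C then δ else if x = D then zD η else w x
  let c : Λ → ℝ := fun x => if x = A then cA η else if x = B then cB η else
    if x = C then s C else if x = D then s D / 2 else η * s x
  have zA : z A = 0 := by simp [z]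
  have zB : z B = 0 := by simp [z]
  have zC : z C = δ := by simp [z, hAC.symm, hBC.symm]
  have zD' : z D = zD η := by simp [z, hAD.symm, hBD.symm, hCD.symm]
  have zR : ∀ x ∈ R, z x = w x := by
    intro x hx
    rw [hR] at hx
    simp [z, hx]
  have wA : c A = cA η := by simp [c]
  have wB : c B = cB η := by simp [c, hAB.symm]
  have wC : c C = s C := by simp [c, hAC.symm, hBC.symm]
  have wD : c D = s D / 2 := by simp [c, hAD.symm, hBD.symm, hCD.symm]
  have wR : ∀ x ∈ R, c x = η * s x := by
    intro x hx
    rw [hR] at hx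
    simp [c, hx]
  have hcases : ∀ x, x ≠ A → x = B ∨ x = C ∨ x = D ∨ x ∈ R := by
    intro x hx
    rw [hR]
    tauto
  refine ⟨c, z, ?_, ?_, zA, zB, ?_, ?_, ?_, ?_, ?_⟩
  · intro x
    by_cases hx : x = A
    · rw [hx, wA]; exact hηA
    rcases hcases x hx with rfl | rfl | rfl | hx
    · rw [wB]; exact hηB
    · rw [wC]; simpa using hF x 1 one_pos
    · rw [wD]; convert hF x (1 / 2) (by norm_num) using 1; ring
    · rw [wR x hx]; exact hF x η hη
  · rw [wC]
    intro h
    simpa [h] using hs C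
  · have hτ : ∃ τ : Λ → ℝ, (∀ x, ∑ t, z x t = τ x) ∧
        ∀ x y, x ≠ A → y ≠ A → τ x = τ y → x = y := by
      refine ⟨_, fun x => rfl, ?_⟩
      have hB : ∑ t, z B t = 0 := by simp [zB]
      have hC : ∑ t, z C t = 1 := by rw [zC, hδs]
      have hRs : ∀ x ∈ R, ∑ t, z x t = 3 + (Fintype.equivFin Λ x : ℝ) := by
        intro x hx
        rw [zR x hx]
        simp [w]
      have hR3 : ∀ x ∈ R, 3 ≤ ∑ t, z x t := by
        intro x hx
        rw [hRs x hx]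
        simp
      rw [← zD'] at hη1 hη9
      intro x y hx hy hxy
      rcases hcases x hx with rfl | rfl | rfl | hx <;> rcases hcases y hy with rfl | rfl | rfl | hy
      · rfl
      · linarith
      · nlinarith
      · linarith [hR3 y hy]
      · linarith
      · rfl
      · nlinarith
      · linarith [hR3 y hy]
      · nlinarith
      · nlinarith
      · rfl
      · nlinarith [hR3 y hy]
      · linarith [hR3 x hx]
      · linarith [hR3 x hx]
      · nlinarith [hR3 x hx]
      · rw [hRs x hx, hRs y hy, add_right_inj, Nat.cast_inj] at hxy
        exact (Fintype.equivFin Λ).injective (Fin.ext hxy)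
    obtain ⟨τ, hτ, hinj⟩ := hτ
    intro x y hx hy hxy h
    exact hxy (hinj x y hx hy (by rw [← hτ, ← hτ, h]))
  · rw [eq_top_iff, ← (Pi.basisFun ℝ (Fin (k + 1))).span_eq, Submodule.span_le]
    rintro _ ⟨j, rfl⟩
    rw [Pi.basisFun_apply]
    cases j using Fin.cases with
    | zero => exact Submodule.subset_span ⟨C, zC⟩
    | succ i =>
      have h1 : z (e i) ∈ Submodule.span ℝ (Set.range z) := Submodule.subset_span ⟨e i, rfl⟩
      have h2 := Submodule.smul_mem _ (3 + (Fintype.equivFin Λ (e i) : ℝ))⁻¹ h1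
      have h3 : (3 + (Fintype.equivFin Λ (e i) : ℝ)) ≠ 0 := by positivity
      rw [zR _ (heR i)] at h2
      simp only [w, he.extend_apply, ← Pi.single_smul', smul_eq_mul, inv_mul_cancel₀ h3] at h2
      exact h2
  · rw [hsplit, Finset.sum_congr rfl fun x hx => by
      rw [wR x hx, lightU, if_neg (hR.mp hx).2.2.2, mul_one], ← Finset.mul_sum]
    simp only [wB, wC, wD, lightU, if_true, hAB.symm, hAC.symm, hAD.symm, if_false, cB]
    ring
  · rw [hsplit, Finset.sum_congr rfl fun x hx => by
      rw [wR x hx, lightV, if_neg (hR.mp hx).2.2.2, zR x hx, mul_assoc], ← Finset.mul_sum]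
    simp only [wA, wB, wC, wD, lightV, if_true, hAB.symm, hAC.symm, hAD.symm, if_false, cA, zB, zC,
      zD', hδ, zero_dotProduct]
    ring
  · rw [hsplit, Finset.sum_congr rfl fun x hx => by rw [wR x hx, zR x hx, mul_smul],
      ← Finset.smul_sum, zA, zB, zC, zD', wC, wD, smul_zero, smul_zero, zero_add, zero_add]
    have h1 : s D / 2 * -(2 * s D) = -1 := by linear_combination -hs D
    simp only [zD, smul_smul, h1]
    simp only [W]
    module

/-- If two labels have positive signs and two other labels have negative signs, or if two labels
have both signs, then there are configurations with a non-zero weight. -/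
theorem exists_isMomentumConfig_of_lt_card (hε : ∀ i, ε i * ε i = 1)
    (hlab : ∀ x, ∃ i, lab i = some x) {k : ℕ} {A B : Λ} (hAB : A ≠ B)
    (hcard : k + 4 ≤ Fintype.card Λ)
    (h : (∃ C D, A ≠ C ∧ A ≠ D ∧ B ≠ C ∧ B ≠ D ∧ C ≠ D ∧
        (∃ i, lab i = some A ∧ 0 < ε i) ∧ (∃ i, lab i = some B ∧ 0 < ε i) ∧
        (∃ i, lab i = some C ∧ ε i < 0) ∧ ∃ i, lab i = some D ∧ ε i < 0) ∨
      IsMixedLabel lab ε A ∧ IsMixedLabel lab ε B) :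
    ∃ (a : Fin n → ℝ) (z : Λ → Fin (k + 1) → ℝ), IsMomentumConfig lab ε A B a z ∧
      labelWeight lab a ≠ 0 := by
  obtain ⟨rep, C, D, hrep, hAC, hAD, hBC, hBD, hCD, hFA, hFB⟩ : ∃ (rep : Λ → Fin n) (C D : Λ),
      (∀ x, lab (rep x) = some x) ∧ A ≠ C ∧ A ≠ D ∧ B ≠ C ∧ B ≠ D ∧ C ≠ D ∧
      (∀ᶠ c in nhds (-(ε (rep C) / 2 + ε (rep D))), IsFeasibleWeight lab ε A c) ∧
      ∀ᶠ c in nhds (-(ε (rep C) + ε (rep D) / 2)), IsFeasibleWeight lab ε B c := by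
    choose rep hrep using hlab
    rcases h with ⟨C, D, hAC, hAD, hBC, hBD, hCD, ⟨i, hi, hi'⟩, ⟨j, hj, hj'⟩, ⟨c, hc, hc'⟩,
      ⟨d, hd, hd'⟩⟩ | ⟨hA, hB⟩
    -- Negative representatives at `C` and `D` make the limiting weights at `A` and `B` positive,
    -- and positive weights are feasible there. In the other case every weight is feasible at `A`
    -- and `B`, so any two further labels serve as `C` and `D`.
    · refine ⟨Function.update (Function.update rep C c) D d, C, D, ?_, hAC, hAD, hBC, hBD, hCD, ?_⟩
      · intro x
        by_cases hxD : x = D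
        · subst hxD; simpa using hd
        by_cases hxC : x = C
        · subst hxC; simpa [hxD] using hc
        simpa [hxD, hxC] using hrep x
      · simp only [Function.update_self, Function.update_of_ne hCD]
        constructor
        · filter_upwards [lt_mem_nhds (show 0 < -(ε c / 2 + ε d) by linarith)] with t ht
          exact Or.inl ⟨i, hi, mul_pos hi' ht⟩
        · filter_upwards [lt_mem_nhds (show 0 < -(ε c + ε d / 2) by linarith)] with t ht
          exact Or.inl ⟨j, hj, mul_pos hj' ht⟩
    · have h1 := Finset.card_erase_erase_univ hAB
      obtain ⟨C, hC, D, hD, hCD⟩ := Finset.one_lt_card.mp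
        (show 1 < ((Finset.univ.erase A).erase B).card by omega)
      simp only [Finset.mem_erase, Finset.mem_univ, and_true] at hC hD
      exact ⟨rep, C, D, hrep, hC.2.symm, hD.2.symm, hC.1.symm, hD.1.symm, hCD,
        Filter.Eventually.of_forall hA.isFeasibleWeight,
        Filter.Eventually.of_forall hB.isFeasibleWeight⟩
  obtain ⟨c, z, hc, hcC, hzA, hzB, hinj, hspan, hu, hv, hz⟩ := exists_weights_and_points hAB hAC
    hAD hBC hBD hCD hcard (s := fun x => ε (rep x)) (fun x => hε _)
    (F := IsFeasibleWeight lab ε) (fun x t ht => Or.inl ⟨rep x, hrep x, by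
      rw [mul_left_comm, hε, mul_one]; exact ht⟩) hFA hFB
  obtain ⟨a, h, hw⟩ := exists_isMomentumConfig_of_weights hε hc hzA hzB hinj hspan hu hv hz
  exact ⟨a, z, h, fun h0 => hcC (by rw [← hw, h0]; rfl)⟩

end Existence

/-! ### Signed matroids -/

/-! ### Signs forced by momentum conservation. -/

section Necessity

variable {n k : ℕ} {Λ : Type} [Fintype Λ] [DecidableEq Λ] {lab : Fin n → Option Λ} {ε : Fin n → ℝ}
  {inf o : Λ} {a : Fin n → ℝ} {z : Λ → Fin k → ℝ}

namespace IsMomentumConfig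

/-- Matrix entries only see products of two signs, so the multiples match `ε` up to one global sign.
-/
theorem mul_pos_or_mul_neg (h : IsMomentumConfig lab ε inf o a z) :
    (∀ i, lab i ≠ none → 0 < ε i * a i) ∨ ∀ i, lab i ≠ none → ε i * a i < 0 := by
  have h1 : ∀ i j, lab i ≠ none → lab j ≠ none → 0 < ε i * a i * (ε j * a j) := by
    intro i j hi hj
    have := h.signs i j hi hj
    linarith
  by_contra! hcon
  obtain ⟨⟨i, hi, hi'⟩, j, hj, hj'⟩ := hcon
  exact (h1 i j hi hj).not_ge (mul_nonpos_of_nonpos_of_nonneg hi' hj')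

theorem isMixedLabel (hlab : ∀ x, ∃ i, lab i = some x)
    (h : IsMomentumConfig lab ε inf o a z) {x : Λ} (hc : labelWeight lab a x = 0) :
    IsMixedLabel lab ε x := by
  obtain ⟨i, hi, hi'⟩ := exists_pos_of_labelWeight_nonneg (fun i hi => h.ne_zero hi) (hlab x) hc.ge
  obtain ⟨j, hj, hj'⟩ := exists_neg_of_labelWeight_nonpos (fun i hi => h.ne_zero hi) (hlab x) hc.le
  have hi0 : lab i ≠ none := by simp [hi]
  have hj0 : lab j ≠ none := by simp [hj]
  rcases h.mul_pos_or_mul_neg with h1 | h1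
  · exact ⟨⟨i, hi, pos_of_mul_pos_left (h1 i hi0) hi'.le⟩, j, hj,
      neg_of_mul_pos_left (h1 j hj0) hj'.le⟩
  · exact ⟨⟨j, hj, pos_of_mul_neg_left (h1 j hj0) hj'.le⟩, i, hi,
      neg_of_mul_neg_left (h1 i hi0) hi'.le⟩

/-- The signs that are necessary for the existence of configurations. -/
theorem exists_signs (hlab : ∀ x, ∃ i, lab i = some x) (hne : inf ≠ o)
    (h : IsMomentumConfig lab ε inf o a z) :
    ∃ A B, A ≠ B ∧ ((∃ C D, A ≠ C ∧ A ≠ D ∧ B ≠ C ∧ B ≠ D ∧ C ≠ D ∧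
        (∃ i, lab i = some A ∧ 0 < ε i) ∧ (∃ i, lab i = some B ∧ 0 < ε i) ∧
        (∃ i, lab i = some C ∧ ε i < 0) ∧ ∃ i, lab i = some D ∧ ε i < 0) ∨
      IsMixedLabel lab ε A ∧ IsMixedLabel lab ε B) := by
  by_cases hc : labelWeight lab a = 0
  · exact ⟨inf, o, hne, Or.inr ⟨h.isMixedLabel hlab (congrFun hc _),
      h.isMixedLabel hlab (congrFun hc _)⟩⟩
  obtain ⟨A, B, hAB, hA, hB⟩ := h.exists_two_pos hne hc
  obtain ⟨C, D, hCD, hC, hD⟩ := h.exists_two_neg hne hc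
  have hAC : A ≠ C := by rintro rfl; exact lt_asymm hA hC
  have hAD : A ≠ D := by rintro rfl; exact lt_asymm hA hD
  have hBC : B ≠ C := by rintro rfl; exact lt_asymm hB hC
  have hBD : B ≠ D := by rintro rfl; exact lt_asymm hB hD
  obtain ⟨i, hi, hi'⟩ := exists_pos_of_labelWeight_pos hA
  obtain ⟨j, hj, hj'⟩ := exists_pos_of_labelWeight_pos hB
  obtain ⟨c, hc, hc'⟩ := exists_neg_of_labelWeight_neg hC
  obtain ⟨d, hd, hd'⟩ := exists_neg_of_labelWeight_neg hD
  rcases h.mul_pos_or_mul_neg with h1 | h1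
  · exact ⟨A, B, hAB, Or.inl ⟨C, D, hAC, hAD, hBC, hBD, hCD,
      ⟨i, hi, pos_of_mul_pos_left (h1 i (by simp [hi])) hi'.le⟩,
      ⟨j, hj, pos_of_mul_pos_left (h1 j (by simp [hj])) hj'.le⟩,
      ⟨c, hc, neg_of_mul_pos_left (h1 c (by simp [hc])) hc'.le⟩,
      ⟨d, hd, neg_of_mul_pos_left (h1 d (by simp [hd])) hd'.le⟩⟩⟩
  -- With the opposite global sign, the labels of negative weight carry the positive signs.
  · exact ⟨C, D, hCD, Or.inl ⟨A, B, hAC.symm, hBC.symm, hAD.symm, hBD.symm, hAB,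
      ⟨c, hc, pos_of_mul_neg_left (h1 c (by simp [hc])) hc'.le⟩,
      ⟨d, hd, pos_of_mul_neg_left (h1 d (by simp [hd])) hd'.le⟩,
      ⟨i, hi, neg_of_mul_neg_left (h1 i (by simp [hi])) hi'.le⟩,
      ⟨j, hj, neg_of_mul_neg_left (h1 j (by simp [hj])) hj'.le⟩⟩⟩

end IsMomentumConfig

end Necessity

/-! ### Translation of matroid restrictions into labels. -/

namespace RankTwoMatroid

variable {n : ℕ} (P : RankTwoMatroid n)

/-- The part that contains an element, or `none` for loops. -/
def partOf (i : Fin n) : Option P.partition.parts :=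
  if h : i ∈ P.nonloops then some ⟨P.partition.part i, P.partition.part_mem.mpr h⟩ else none

theorem partOf_eq_some {i : Fin n} {A : P.partition.parts} : P.partOf i = some A ↔ i ∈ A.1 := by
  unfold partOf
  split_ifs with h
  · rw [Option.some_inj, Subtype.ext_iff, P.partition.part_eq_iff_mem A.2]
  · simp only [false_iff]
    exact fun hi => h (P.partition.subset A.2 hi)

theorem partOf_ne_none {i : Fin n} : P.partOf i ≠ none ↔ i ∈ P.nonloops := by
  unfold partOf
  split_ifs with h <;> simp [h]

theorem exists_partOf_eq (A : P.partition.parts) : ∃ i, P.partOf i = some A := by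
  obtain ⟨i, hi⟩ := P.partition.nonempty_of_mem_parts A.2
  exact ⟨i, P.partOf_eq_some.mpr hi⟩

theorem isBasis_iff {i j : Fin n} :
    P.IsBasis i j ↔ ∃ A B, P.partOf i = some A ∧ P.partOf j = some B ∧ A ≠ B := by
  simp only [partOf_eq_some]
  constructor
  · rintro ⟨A, hA, B, hB, hAB, hi, hj⟩
    exact ⟨⟨A, hA⟩, ⟨B, hB⟩, hi, hj, fun h => hAB (congrArg Subtype.val h)⟩
  · rintro ⟨A, B, hi, hj, hAB⟩
    exact ⟨A, A.2, B, B.2, fun h => hAB (Subtype.ext h), hi, hj⟩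

theorem card_filter_partOf_ne_none :
    (Finset.univ.filter fun i => P.partOf i ≠ none).card + P.numLoops = n := by
  have : (Finset.univ.filter fun i => P.partOf i ≠ none) = P.nonloops := by
    ext i; simp [partOf_ne_none]
  rw [this, numLoops, Finset.card_add_card_compl, Fintype.card_fin]

theorem mem_restrictParts {I X : Finset (Fin n)} :
    X ∈ P.restrictParts I ↔ X.Nonempty ∧ ∃ A ∈ P.partition.parts, A ∩ I = X := by
  simp [restrictParts, Finset.nonempty_iff_ne_empty]

theorem restrictParts_eq_iff {I : Finset (Fin n)} {𝒳 : Finset (Finset (Fin n))} :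
    P.restrictParts I = 𝒳 ↔ (∀ X ∈ 𝒳, X.Nonempty ∧ ∃ A ∈ P.partition.parts, A ∩ I = X) ∧
      ∀ A ∈ P.partition.parts, (A ∩ I).Nonempty → A ∩ I ∈ 𝒳 := by
  constructor
  · rintro rfl
    exact ⟨fun X hX => P.mem_restrictParts.mp hX,
      fun A hA h => P.mem_restrictParts.mpr ⟨h, A, hA, rfl⟩⟩
  · rintro ⟨h1, h2⟩
    ext X
    rw [mem_restrictParts]
    exact ⟨fun ⟨hX, A, hA, h⟩ => h ▸ h2 A hA (h.symm ▸ hX), h1 X⟩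

theorem restrictParts_eq_singletons_iff {i j k l : Fin n} (hd : [i, j, k, l].Nodup) :
    P.restrictParts {i, j, k, l} = {{i}, {j}, {k}, {l}} ↔
      ∃ A B C D, A ≠ B ∧ A ≠ C ∧ A ≠ D ∧ B ≠ C ∧ B ≠ D ∧ C ≠ D ∧ P.partOf i = some A ∧
        P.partOf j = some B ∧ P.partOf k = some C ∧ P.partOf l = some D := by
  simp only [List.nodup_cons, List.mem_cons, List.not_mem_nil, or_false, not_or, not_false_eq_true,
    List.nodup_nil, and_true] at hd
  obtain ⟨⟨hij, hik, hil⟩, ⟨hjk, hjl⟩, hkl⟩ := hd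
  rw [restrictParts_eq_iff]
  simp only [partOf_eq_some]
  constructor
  · rintro ⟨h, -⟩
    have key : ∀ x ∈ ({i, j, k, l} : Finset (Fin n)), {x} ∈ ({{i}, {j}, {k}, {l}} : Finset (Finset (Fin n))) →
        ∃ A : P.partition.parts, x ∈ A.1 ∧ ∀ y ∈ ({i, j, k, l} : Finset (Fin n)), y ≠ x → y ∉ A.1 := by
      intro x hx hxX
      obtain ⟨-, A, hA, hAx⟩ := h _ hxX
      have hmem : ∀ y, y ∈ A ∩ {i, j, k, l} ↔ y = x := by simp [hAx]
      refine ⟨⟨A, hA⟩, (Finset.mem_inter.mp ((hmem x).mpr rfl)).1, fun y hy hyx hyA => hyx ?_⟩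
      exact (hmem y).mp (Finset.mem_inter.mpr ⟨hyA, hy⟩)
    obtain ⟨A, hiA, hA⟩ := key i (by simp) (by simp)
    obtain ⟨B, hjB, hB⟩ := key j (by simp) (by simp)
    obtain ⟨C, hkC, hC⟩ := key k (by simp) (by simp)
    obtain ⟨D, hlD, hD⟩ := key l (by simp) (by simp)
    refine ⟨A, B, C, D, ?_, ?_, ?_, ?_, ?_, ?_, hiA, hjB, hkC, hlD⟩
    · rintro rfl; exact hA j (by simp) (Ne.symm hij) hjB
    · rintro rfl; exact hA k (by simp) (Ne.symm hik) hkC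
    · rintro rfl; exact hA l (by simp) (Ne.symm hil) hlD
    · rintro rfl; exact hB k (by simp) (Ne.symm hjk) hkC
    · rintro rfl; exact hB l (by simp) (Ne.symm hjl) hlD
    · rintro rfl; exact hC l (by simp) (Ne.symm hkl) hlD
  · rintro ⟨A, B, C, D, hAB, hAC, hAD, hBC, hBD, hCD, hi, hj, hk, hl⟩
    have key : ∀ {E : P.partition.parts} {x : Fin n}, x ∈ E.1 → ∀ F : P.partition.parts, x ∈ F.1 ↔ F = E :=
      fun {E x} hx F => ⟨fun h => Subtype.ext (P.partition.eq_of_mem_parts F.2 E.2 h hx),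
        fun h => h ▸ hx⟩
    have hA : A.1 ∩ {i, j, k, l} = {i} := by
      ext y
      simp only [Finset.mem_inter, Finset.mem_insert, Finset.mem_singleton]
      have h1 := key hi A; have h2 := key hj A; have h3 := key hk A; have h4 := key hl A
      grind
    have hB : B.1 ∩ {i, j, k, l} = {j} := by
      ext y
      simp only [Finset.mem_inter, Finset.mem_insert, Finset.mem_singleton]
      have h1 := key hi B; have h2 := key hj B; have h3 := key hk B; have h4 := key hl B
      grind
    have hC : C.1 ∩ {i, j, k, l} = {k} := by
      ext y
      simp only [Finset.mem_inter, Finset.mem_insert, Finset.mem_singleton]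
      have h1 := key hi C; have h2 := key hj C; have h3 := key hk C; have h4 := key hl C
      grind
    have hD : D.1 ∩ {i, j, k, l} = {l} := by
      ext y
      simp only [Finset.mem_inter, Finset.mem_insert, Finset.mem_singleton]
      have h1 := key hi D; have h2 := key hj D; have h3 := key hk D; have h4 := key hl D
      grind
    refine ⟨?_, ?_⟩
    · simp only [Finset.mem_insert, Finset.mem_singleton]
      rintro X (rfl | rfl | rfl | rfl)
      · exact ⟨by simp, A, A.2, hA⟩
      · exact ⟨by simp, B, B.2, hB⟩
      · exact ⟨by simp, C, C.2, hC⟩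
      · exact ⟨by simp, D, D.2, hD⟩
    · rintro E hE ⟨y, hy⟩
      simp only [Finset.mem_inter, Finset.mem_insert, Finset.mem_singleton] at hy
      obtain ⟨hyE, rfl | rfl | rfl | rfl⟩ := hy
      · rw [show E = A from congrArg Subtype.val ((key hi ⟨E, hE⟩).mp hyE), hA]; simp
      · rw [show E = B from congrArg Subtype.val ((key hj ⟨E, hE⟩).mp hyE), hB]; simp
      · rw [show E = C from congrArg Subtype.val ((key hk ⟨E, hE⟩).mp hyE), hC]; simp
      · rw [show E = D from congrArg Subtype.val ((key hl ⟨E, hE⟩).mp hyE), hD]; simp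

theorem restrictParts_eq_pairs_iff {i j k l : Fin n} (hd : [i, j, k, l].Nodup) :
    P.restrictParts {i, j, k, l} = {{i, k}, {j, l}} ↔
      ∃ A B, A ≠ B ∧ P.partOf i = some A ∧ P.partOf k = some A ∧ P.partOf j = some B ∧
        P.partOf l = some B := by
  simp only [List.nodup_cons, List.mem_cons, List.not_mem_nil, or_false, not_or, not_false_eq_true,
    List.nodup_nil, and_true] at hd
  obtain ⟨⟨hij, hik, hil⟩, ⟨hjk, hjl⟩, hkl⟩ := hd
  rw [restrictParts_eq_iff]
  simp only [partOf_eq_some]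
  constructor
  · rintro ⟨h, -⟩
    obtain ⟨-, A, hA, hA'⟩ := h {i, k} (by simp)
    obtain ⟨-, B, hB, hB'⟩ := h {j, l} (by simp)
    have hmA : ∀ y, y ∈ A ∩ {i, j, k, l} ↔ y = i ∨ y = k := by simp [hA']
    have hmB : ∀ y, y ∈ B ∩ {i, j, k, l} ↔ y = j ∨ y = l := by simp [hB']
    refine ⟨⟨A, hA⟩, ⟨B, hB⟩, ?_, (Finset.mem_inter.mp ((hmA i).mpr (by simp))).1,
      (Finset.mem_inter.mp ((hmA k).mpr (by simp))).1,
      (Finset.mem_inter.mp ((hmB j).mpr (by simp))).1,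
      (Finset.mem_inter.mp ((hmB l).mpr (by simp))).1⟩
    intro hAB
    obtain rfl : A = B := congrArg Subtype.val hAB
    rcases (hmB i).mp ((hmA i).mpr (by simp)) with h | h
    · exact hij h
    · exact hil h
  · rintro ⟨A, B, hAB, hi, hk, hj, hl⟩
    have key : ∀ {E : P.partition.parts} {x : Fin n}, x ∈ E.1 → ∀ F : P.partition.parts, x ∈ F.1 ↔ F = E :=
      fun {E x} hx F => ⟨fun h => Subtype.ext (P.partition.eq_of_mem_parts F.2 E.2 h hx),
        fun h => h ▸ hx⟩
    have hA : A.1 ∩ {i, j, k, l} = {i, k} := by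
      ext y
      simp only [Finset.mem_inter, Finset.mem_insert, Finset.mem_singleton]
      have h1 := key hi A; have h2 := key hj A; have h3 := key hk A; have h4 := key hl A
      grind
    have hB : B.1 ∩ {i, j, k, l} = {j, l} := by
      ext y
      simp only [Finset.mem_inter, Finset.mem_insert, Finset.mem_singleton]
      have h1 := key hi B; have h2 := key hj B; have h3 := key hk B; have h4 := key hl B
      grind
    refine ⟨?_, ?_⟩
    · simp only [Finset.mem_insert, Finset.mem_singleton]
      rintro X (rfl | rfl)
      · exact ⟨by simp, A, A.2, hA⟩
      · exact ⟨by simp, B, B.2, hB⟩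
    · rintro E hE ⟨y, hy⟩
      simp only [Finset.mem_inter, Finset.mem_insert, Finset.mem_singleton] at hy
      obtain ⟨hyE, rfl | rfl | rfl | rfl⟩ := hy
      · rw [show E = A from congrArg Subtype.val ((key hi ⟨E, hE⟩).mp hyE), hA]; simp
      · rw [show E = B from congrArg Subtype.val ((key hj ⟨E, hE⟩).mp hyE), hB]; simp
      · rw [show E = A from congrArg Subtype.val ((key hk ⟨E, hE⟩).mp hyE), hA]; simp
      · rw [show E = B from congrArg Subtype.val ((key hl ⟨E, hE⟩).mp hyE), hB]; simp

end RankTwoMatroid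

namespace SignedMatroid

variable {n : ℕ} (M : SignedMatroid n)

/-- The signs of a signed matroid as real numbers. -/
def realSign (i : Fin n) : ℝ := ((M.sign i : ℤ) : ℝ)

theorem realSign_mul_self (i : Fin n) : M.realSign i * M.realSign i = 1 := by
  rcases Int.units_eq_one_or (M.sign i) with h | h <;> simp [realSign, h]

theorem realSign_pos {i : Fin n} : 0 < M.realSign i ↔ M.sign i = 1 := by
  rcases Int.units_eq_one_or (M.sign i) with h | h <;> simp [realSign, h]

theorem realSign_neg {i : Fin n} : M.realSign i < 0 ↔ M.sign i = -1 := by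
  rcases Int.units_eq_one_or (M.sign i) with h | h <;> simp [realSign, h]

theorem real_sign_eq_iff (i j : Fin n) (x : ℝ) :
    Real.sign x = ((M.sign i * M.sign j : ℤˣ) : ℤ) ↔ 0 < M.realSign i * M.realSign j * x := by
  have h1 : M.realSign i * M.realSign j = (((M.sign i * M.sign j : ℤˣ) : ℤ) : ℝ) := by
    simp [realSign]
  rw [h1]
  rcases Int.units_eq_one_or (M.sign i * M.sign j) with h | h <;> rw [h] <;>
    rcases lt_trichotomy x 0 with hx | hx | hx
  · simp [Real.sign_of_neg hx]; norm_num; exact hx.le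
  · simp [hx]
  · simp [Real.sign_of_pos hx, hx]
  · simp [Real.sign_of_neg hx, hx]
  · simp [hx]
  · simp [Real.sign_of_pos hx]; norm_num; exact hx.le

/-- Bases are precisely the pairs of indices with different labels. -/
theorem mmcStratum_eq (r : ℕ) : M.mmcStratum r = patternStratum M.partOf M.realSign r := by
  ext S
  constructor
  · rintro ⟨⟨-, h1, h2⟩, h3⟩
    refine ⟨h3, fun i j A B hi hj hAB => ?_, fun i j h => h2 i j ?_⟩
    · exact (M.real_sign_eq_iff i j _).mp (h1 i j (M.isBasis_iff.mpr ⟨A, B, hi, hj, hAB⟩))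
    · rw [M.isBasis_iff]
      rintro ⟨A, B, hi, hj, hAB⟩
      exact hAB (h A B hi hj)
  · rintro ⟨h1, h2⟩
    refine ⟨⟨h1.1, fun i j h => ?_, fun i j h => h2.zero i j fun A B hi hj => ?_⟩, h1⟩
    · obtain ⟨A, B, hi, hj, hAB⟩ := M.isBasis_iff.mp h
      exact (M.real_sign_eq_iff i j _).mpr (h2.sign i j A B hi hj hAB)
    · by_contra hAB
      exact h (M.isBasis_iff.mpr ⟨A, B, hi, hj, hAB⟩)

theorem isMixedLabel_iff (A : M.partition.parts) :
    IsMixedLabel M.partOf M.realSign A ↔ ∃ i ∈ A.1, ∃ j ∈ A.1, M.sign i = 1 ∧ M.sign j = -1 := by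
  simp only [IsMixedLabel, RankTwoMatroid.partOf_eq_some, realSign_pos, realSign_neg]
  constructor
  · rintro ⟨⟨i, hi, hi'⟩, j, hj, hj'⟩
    exact ⟨i, hi, j, hj, hi', hj'⟩
  · rintro ⟨i, hi, j, hj, hi', hj'⟩
    exact ⟨⟨i, hi, hi'⟩, j, hj, hj'⟩

/-- A `U_4` restriction corresponds to four labels, a restriction to two pairs to two mixed labels.
Conversely, the chosen elements are distinct because they differ in sign or in label. -/
theorem exists_restrictParts_iff :
    (∃ i j k l : Fin n, [i, j, k, l].Nodup ∧
      M.sign i = 1 ∧ M.sign j = 1 ∧ M.sign k = -1 ∧ M.sign l = -1 ∧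
      (M.restrictParts {i, j, k, l} = {{i}, {j}, {k}, {l}} ∨
        M.restrictParts {i, j, k, l} = {{i, k}, {j, l}})) ↔
    ∃ A B, A ≠ B ∧ ((∃ C D, A ≠ C ∧ A ≠ D ∧ B ≠ C ∧ B ≠ D ∧ C ≠ D ∧
        (∃ i, M.partOf i = some A ∧ 0 < M.realSign i) ∧
        (∃ i, M.partOf i = some B ∧ 0 < M.realSign i) ∧
        (∃ i, M.partOf i = some C ∧ M.realSign i < 0) ∧
        ∃ i, M.partOf i = some D ∧ M.realSign i < 0) ∨
      IsMixedLabel M.partOf M.realSign A ∧ IsMixedLabel M.partOf M.realSign B) := by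
  have hsome : ∀ {i j : Fin n} {A B : M.partition.parts}, M.partOf i = some A →
      M.partOf j = some B → A ≠ B → i ≠ j := by
    rintro i j A B hi hj hAB rfl
    exact hAB (Option.some_injective _ (hi.symm.trans hj))
  have hsign : ∀ {i j : Fin n}, M.sign i = 1 → M.sign j = -1 → i ≠ j := by
    rintro i j hi hj rfl
    rw [hi] at hj
    exact absurd hj (by decide)
  simp only [IsMixedLabel, realSign_pos, realSign_neg]
  constructor
  · rintro ⟨i, j, k, l, hd, hi, hj, hk, hl, h | h⟩
    · obtain ⟨A, B, C, D, hAB, hAC, hAD, hBC, hBD, hCD, hiA, hjB, hkC, hlD⟩ :=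
        (M.restrictParts_eq_singletons_iff hd).mp h
      exact ⟨A, B, hAB, Or.inl ⟨C, D, hAC, hAD, hBC, hBD, hCD, ⟨i, hiA, hi⟩, ⟨j, hjB, hj⟩,
        ⟨k, hkC, hk⟩, ⟨l, hlD, hl⟩⟩⟩
    · obtain ⟨A, B, hAB, hiA, hkA, hjB, hlB⟩ := (M.restrictParts_eq_pairs_iff hd).mp h
      exact ⟨A, B, hAB, Or.inr ⟨⟨⟨i, hiA, hi⟩, k, hkA, hk⟩, ⟨j, hjB, hj⟩, l, hlB, hl⟩⟩
  · rintro ⟨A, B, hAB, ⟨C, D, hAC, hAD, hBC, hBD, hCD, ⟨i, hiA, hi⟩, ⟨j, hjB, hj⟩,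
      ⟨k, hkC, hk⟩, ⟨l, hlD, hl⟩⟩ | ⟨⟨⟨i, hiA, hi⟩, k, hkA, hk⟩, ⟨j, hjB, hj⟩, l, hlB, hl⟩⟩
    · have hd : [i, j, k, l].Nodup := by
        simp [hsome hiA hjB hAB, hsign hi hk, hsign hi hl, hsign hj hk, hsign hj hl,
          hsome hkC hlD hCD]
      exact ⟨i, j, k, l, hd, hi, hj, hk, hl, Or.inl ((M.restrictParts_eq_singletons_iff hd).mpr
        ⟨A, B, C, D, hAB, hAC, hAD, hBC, hBD, hCD, hiA, hjB, hkC, hlD⟩)⟩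
    · have hd : [i, j, k, l].Nodup := by
        simp [hsome hiA hjB hAB, hsign hi hk, hsign hi hl, hsign hj hk, hsign hj hl,
          hsome hkA hlB hAB]
      exact ⟨i, j, k, l, hd, hi, hj, hk, hl, Or.inr ((M.restrictParts_eq_pairs_iff hd).mpr
        ⟨A, B, hAB, hiA, hkA, hjB, hlB⟩)⟩

end SignedMatroid

theorem theorem5p1 (n r : ℕ) (M : SignedMatroid n) :
    (M.IsMomentumConserving r ↔
      (3 ≤ r ∧ r < M.numParts ∧
        ∃ i j k l : Fin n, [i, j, k, l].Nodup ∧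
          M.sign i = 1 ∧ M.sign j = 1 ∧ M.sign k = -1 ∧ M.sign l = -1 ∧
          (M.restrictParts {i, j, k, l} = {{i}, {j}, {k}, {l}} ∨
            M.restrictParts {i, j, k, l} = {{i, k}, {j, l}})) ∨
      (2 ≤ r ∧ r = M.numParts ∧
        ∀ A ∈ M.partition.parts, ∃ i ∈ A, ∃ j ∈ A, M.sign i = 1 ∧ M.sign j = -1)) ∧
    (M.IsMomentumConserving r →
      ∃ d : ℕ, matrixSetDim (M.mmcStratum r) = d ∧
        (d : ℤ) = ((M.numParts : ℤ) - 1) * ((r : ℤ) - 1) - (r.choose 2 : ℤ)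
          + ((n : ℤ) - (M.numLoops : ℤ) - (M.numParts : ℤ)) - 1) := by
  have hε := M.realSign_mul_self
  have hlab := M.exists_partOf_eq
  have hm : Fintype.card M.partition.parts = M.numParts := Fintype.card_coe _
  have hm2 : 2 ≤ M.numParts := M.two_le_card_parts
  have hmix : (∀ A ∈ M.partition.parts, ∃ i ∈ A, ∃ j ∈ A, M.sign i = 1 ∧ M.sign j = -1) ↔
      ∀ A : M.partition.parts, IsMixedLabel M.partOf M.realSign A := by
    simp only [M.isMixedLabel_iff, Subtype.forall]
  rw [M.exists_restrictParts_iff, hmix]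
  have hnec : M.IsMomentumConserving r → (3 ≤ r ∧ r < M.numParts ∧ ∃ A B, A ≠ B ∧
      ((∃ C D, A ≠ C ∧ A ≠ D ∧ B ≠ C ∧ B ≠ D ∧ C ≠ D ∧
        (∃ i, M.partOf i = some A ∧ 0 < M.realSign i) ∧
        (∃ i, M.partOf i = some B ∧ 0 < M.realSign i) ∧
        (∃ i, M.partOf i = some C ∧ M.realSign i < 0) ∧
        ∃ i, M.partOf i = some D ∧ M.realSign i < 0) ∨
      IsMixedLabel M.partOf M.realSign A ∧ IsMixedLabel M.partOf M.realSign B)) ∨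
      (2 ≤ r ∧ r = M.numParts ∧ ∀ A, IsMixedLabel M.partOf M.realSign A) := by
    rintro ⟨S, hS⟩
    rw [M.mmcStratum_eq] at hS
    obtain ⟨inf, o, hne⟩ := Fintype.exists_pair_of_one_lt_card
      (α := M.partition.parts) (by omega)
    obtain ⟨k, a, z, rfl, h, -⟩ := exists_isMomentumConfig hε hne hlab hS.1 hS.2
    have hle := h.add_two_le_card hne
    rw [hm] at hle
    rcases hle.lt_or_eq with hlt | heq
    · have := h.pos_of_two_lt_card (by omega)
      exact Or.inl ⟨by omega, hlt, h.exists_signs hlab hne⟩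
    · have hc := h.labelWeight_eq_zero_of_card_eq hne (heq.trans hm.symm)
      exact Or.inr ⟨by omega, heq, fun A => h.isMixedLabel hlab (congrFun hc A)⟩
  -- Below the maximal rank the configuration is required to have a non-zero weight, which existence
  -- alone does not need but the dimension does.
  have hsuf : (3 ≤ r ∧ r < M.numParts ∧ ∃ A B, A ≠ B ∧
      ((∃ C D, A ≠ C ∧ A ≠ D ∧ B ≠ C ∧ B ≠ D ∧ C ≠ D ∧
        (∃ i, M.partOf i = some A ∧ 0 < M.realSign i) ∧
        (∃ i, M.partOf i = some B ∧ 0 < M.realSign i) ∧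
        (∃ i, M.partOf i = some C ∧ M.realSign i < 0) ∧
        ∃ i, M.partOf i = some D ∧ M.realSign i < 0) ∨
      IsMixedLabel M.partOf M.realSign A ∧ IsMixedLabel M.partOf M.realSign B)) ∨
      (2 ≤ r ∧ r = M.numParts ∧ ∀ A, IsMixedLabel M.partOf M.realSign A) →
      ∃ (k : ℕ) (inf o : M.partition.parts) (a : Fin n → ℝ) (z : M.partition.parts → Fin k → ℝ),
        r = k + 2 ∧ inf ≠ o ∧ IsMomentumConfig M.partOf M.realSign inf o a z ∧
        (k + 2 < Fintype.card M.partition.parts → labelWeight M.partOf a ≠ 0) := by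
    rintro (⟨hr, hrm, A, B, hAB, h⟩ | ⟨hr, hrm, h⟩)
    · obtain ⟨k, rfl⟩ := Nat.exists_eq_add_of_le' hr
      obtain ⟨a, z, hconf, hw⟩ := exists_isMomentumConfig_of_lt_card hε hlab hAB (k := k)
        (by omega) h
      exact ⟨k + 1, A, B, a, z, rfl, hAB, hconf, fun _ => hw⟩
    · obtain ⟨k, rfl⟩ := Nat.exists_eq_add_of_le' hr
      obtain ⟨inf, o, hne⟩ := Fintype.exists_pair_of_one_lt_card
        (α := M.partition.parts) (by omega)
      obtain ⟨a, z, hconf⟩ := exists_isMomentumConfig_of_card_eq hε hne (k := k) (by omega) h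
      exact ⟨k, inf, o, a, z, rfl, hne, hconf, fun hlt => by omega⟩
  refine ⟨⟨hnec, fun h => ?_⟩, fun h => ?_⟩
  · obtain ⟨k, inf, o, a, z, rfl, hne, hconf, -⟩ := hsuf h
    rw [SignedMatroid.IsMomentumConserving, M.mmcStratum_eq]
    exact ⟨_, hconf.mem_mmcRegion hne hlab, hconf.hasSignPattern⟩
  -- A given point of the stratum might have only zero weights, where the chart is too small.
  -- Passing through the sign condition replaces it by a suitable configuration in the same stratum.
  · obtain ⟨k, inf, o, a, z, rfl, hne, hconf, hw⟩ := hsuf (hnec h)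
    obtain ⟨d, hd, hd'⟩ := semialgebraicDim_patternStratum hε hne hlab hconf hw
    refine ⟨d, ?_, ?_⟩
    · rw [M.mmcStratum_eq]; exact hd
    · have h1 := M.card_filter_partOf_ne_none
      have h2 : (k + 2).choose 2 = k.choose 2 + 2 * k + 1 := by
        simp [Nat.choose_succ_succ]
        ring
      rw [hm] at hd'
      rw [h2]
      zify at hd' h1
      push_cast
      linear_combination hd' + h1
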